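/- Notation. Functions on $(0,\infty)$ are extended by $0$ to $\mathbb R$; $B(0,\infty)$ is the set of bounded Borel functions on $(0,\infty)$, $C^1(0,\infty)$ the set of bounded continuously differentiable functions on $(0,\infty)$ with bounded derivative, and a superscript $+$ denotes nonnegative elements. $\mathfrak N(0,\infty)$ is the set of integer-valued finite Borel measures on $(0,\infty)$ with the topology of weak convergence; $\langle\nu,f\rangle=\int f\,d\nu$. Let $\alpha\in C^1(0,\infty)^+$; for each $x>0$ let $(p(x,i))_{i\ge0}$ be a probability distribution on $\mathbb N$ with $p(\cdot,i)\in C^1(0,\infty)^+$ for every $i$; write $g(x,z)=\sum_i p(x,i)z^i$, $g'(x,1-)=\sum_i i\,p(x,i)$, $g''(x,1-)=\sum_i i(i-1)p(x,i)$ and assume $\sup_{x>0} g'(x,1-)<\infty$. Let $G$ be a probability measure without atoms on $(0,\infty)$, $G(t)=G(0,t]$, and let $L$ be a finite measure on $\mathfrak N(0,\infty)^\circ=\mathfrak N(0,\infty)\setminus\{0\}$, with $\psi(f)=\int(1-e^{-\langle\nu,f\rangle})L(d\nu)$. For $f\in B(0,\infty)^+$ let $u_tf(x)$ be the unique locally bounded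 (that is, bounded on $[0,T]\times(0,\infty)$ for every $T$) nonnegative Borel solution of $$u_tf(x)=f(x-t)+\int_0^t\alpha(x-s)\bigl[1-g(x-s,\langle G,e^{-u_{t-s}f}\rangle)\bigr]ds .$$ An $(\alpha,g,G,\psi)$-process is a Markov process in $\mathfrak N(0,\infty)$ with transition semigroup $(P_t)$ given by $$\int e^{-\langle\nu,f\rangle}P_t(\sigma,d\nu)=\exp\Bigl\{-\langle\sigma,u_tf\rangle-\int_0^t\psi(u_sf)\,ds\Bigr\},\qquad f\in B(0,\infty)^+ .$$ Assume: (a) $\int_0^\infty ds\int_{(s,\infty)}\alpha(x-s)g'(x-s,1-)\,G(dx)<1$; (b) $\alpha_1\in(0,\infty)$ is such that $t\mapsto e^{\alpha_1t}[1-G(t)]$ is directly Riemann integrable over $[0,\infty)$ and $\int_0^\infty e^{\alpha_1s}ds\int_{(s,\infty)}\alpha(x-s)g'(x-s,1-)\,G(dx)=1$; (c) $\int L(d\nu)\int_0^\infty e^{\alpha_1x}\,\nu(dx)<\infty$; (d) $\int_0^\infty e^{2\alpha_1x}\,G(dx)<\infty$ and $\sup_{x>0}g''(x,1-)<\infty$.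 Theorem. Let $f\in B(0,\infty)$. There is a unique locally bounded Borel solution $(t,x)\mapsto\pi_tf(x)$ of $$\pi_tf(x)=f(x-t)+\int_0^t\alpha(x-s)g'(x-s,1-)\langle G,\pi_{t-s}f\rangle\,ds ,$$ the integral $\Pi_\infty f(x)=\int_0^\infty\pi_sf(x)\,ds$ converges absolutely for every $x>0$, $\Pi_\infty f$ is $\nu$-integrable for $L$-almost every $\nu$, and $\nu\mapsto\langle\nu,\Pi_\infty f\rangle$ is $L$-integrable. Let $\sigma\in\mathfrak N(0,\infty)$ and let $Y=(Y_t)_{t\ge0}$ be an $(\alpha,g,G,\psi)$-process with $Y_0=\sigma$ a.s. and with right-continuous paths in $\mathfrak N(0,\infty)$. Then almost surely $s\mapsto\langle Y_s,f\rangle$ is integrable over $[0,t]$ for every $t\ge 0$, and the occupation time process $\langle Z_t,f\rangle=\int_0^t\langle Y_s,f\rangle\,ds$ satisfies $$\frac1t\langle Z_t,f\rangle\longrightarrow\int_{\mathfrak N(0,\infty)^\circ}\langle\nu,\Pi_\infty f\rangle\,L(d\nu)\qquad\text{in probability as }t\to\infty .$$ -/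

import Mathlib

open MeasureTheory ProbabilityTheory Filter Topology
open scoped NNReal ENNReal

namespace AgeBranching

/-- The open half line `(0,∞)`, in which remaining lifetimes live. -/
abbrev PosReal : Type := ↥(Set.Ioi (0 : ℝ))

/-- A function on `(0,∞)` is understood to vanish on the rest of the real line. -/
noncomputable def zeroExt (h : PosReal → ℝ) (y : ℝ) : ℝ :=
  open Classical in if hy : 0 < y then h ⟨y, hy⟩ else 0

/-- `C¹(0,∞)`: bounded continuously differentiable functions on `(0,∞)` with bounded derivative. -/
def IsC1b (h : PosReal → ℝ) : Prop :=
  ContDiffOn ℝ 1 (zeroExt h) (Set.Ioi 0) ∧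
  (∃ C : ℝ, ∀ x, |h x| ≤ C) ∧
  (∃ C : ℝ, ∀ x : ℝ, 0 < x → |deriv (zeroExt h) x| ≤ C)

/-- `B(0,∞)`: bounded Borel functions on `(0,∞)`. -/
def IsBddBorel (f : PosReal → ℝ) : Prop :=
  Measurable f ∧ ∃ C : ℝ, ∀ x, |f x| ≤ C

/-- `𝔑(0,∞)`: integer-valued finite Borel measures on `(0,∞)`, with the topology of weak convergence
and the σ-algebra generated by the evaluations `ν ↦ ν B`, both inherited from `FiniteMeasure`. -/
abbrev CountMeas : Type :=
  {ν : FiniteMeasure PosReal //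
    ∀ B : Set PosReal, MeasurableSet B → ∃ n : ℕ, (ν : Measure PosReal) B = n}

/-- The measure on `(0,∞)` underlying an element of `𝔑(0,∞)`. -/
def CountMeas.toMeas (ν : CountMeas) : Measure PosReal := (ν.1 : Measure PosReal)

/-- The pairing `⟨ν, f⟩ = ∫ f dν`. -/
noncomputable def pairing (ν : CountMeas) (f : PosReal → ℝ) : ℝ := ∫ x, f x ∂ν.toMeas

/-! ### Parameters -/

/-- The birth rate: `α ∈ C¹(0,∞)⁺`. -/
def IsBirthRate (α : PosReal → ℝ) : Prop := IsC1b α ∧ ∀ x, 0 ≤ α x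

/-- The offspring laws: for each `x`, `(p x i)_i` is a probability distribution on `ℕ`; each
`p · i` is in `C¹(0,∞)⁺`; and `sup_x ∑ i, i * p x i < ∞`. -/
structure IsOffspringLaw (p : PosReal → ℕ → ℝ) : Prop where
  nonneg : ∀ x i, 0 ≤ p x i
  hasSum_one : ∀ x, HasSum (p x) 1
  smooth : ∀ i, IsC1b (fun x => p x i)
  mean_bdd : ∃ C : ℝ, ∀ x, Summable (fun i : ℕ => p x i * i) ∧ ∑' i : ℕ, p x i * i ≤ C

/-- The generating function `g(x,z) = ∑ p(x,i) zⁱ`. -/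
noncomputable def genFun (p : PosReal → ℕ → ℝ) (x : PosReal) (z : ℝ) : ℝ := ∑' i : ℕ, p x i * z ^ i

/-- `g'(x,1-) = ∑ i p(x,i)`. -/
noncomputable def genFunDeriv (p : PosReal → ℕ → ℝ) (x : PosReal) : ℝ := ∑' i : ℕ, p x i * i

/-- `‖g''(·,1-)‖ < ∞`, where `g''(x,1-) = ∑ i (i-1) p(x,i)`. -/
def SecondDerivBdd (p : PosReal → ℕ → ℝ) : Prop :=
  ∃ C : ℝ, ∀ x, Summable (fun i : ℕ => p x i * ((i : ℝ) * ((i : ℝ) - 1))) ∧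
    ∑' i : ℕ, p x i * ((i : ℝ) * ((i : ℝ) - 1)) ≤ C

/-! ### Cumulant and mean equations -/

/-- `u` is the bounded-on-compact-time-intervals nonnegative Borel solution `(t,x) ↦ u_t f(x)` of
`u_t f(x) = f(x-t) + ∫₀ᵗ α(x-s) [1 - g(x-s, ⟨G, exp(-u_{t-s} f)⟩)] ds`. -/
structure IsCumulant (α : PosReal → ℝ) (p : PosReal → ℕ → ℝ) (G : Measure PosReal)
    (f : PosReal → ℝ) (u : ℝ≥0 → PosReal → ℝ) : Prop where
  measurable : Measurable (Function.uncurry u)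
  nonneg : ∀ t x, 0 ≤ u t x
  locBdd : ∀ T : ℝ≥0, ∃ C : ℝ, ∀ t ≤ T, ∀ x, u t x ≤ C
  eqn : ∀ (t : ℝ≥0) (x : PosReal), u t x = zeroExt f ((x : ℝ) - t) +
    ∫ s in (0 : ℝ)..t,
      zeroExt (fun y => α y * (1 - genFun p y (∫ z, Real.exp (-u (t - s.toNNReal) z) ∂G)))
        ((x : ℝ) - s)

/-- `π` is the locally bounded Borel solution `(t,x) ↦ π_t f(x)` of
`π_t f(x) = f(x-t) + ∫₀ᵗ α(x-s) g'(x-s,1-) ⟨G, π_{t-s} f⟩ ds`. -/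
structure IsMeanSolution (α : PosReal → ℝ) (p : PosReal → ℕ → ℝ) (G : Measure PosReal)
    (f : PosReal → ℝ) (π : ℝ≥0 → PosReal → ℝ) : Prop where
  measurable : Measurable (Function.uncurry π)
  locBdd : ∀ T : ℝ≥0, ∃ C : ℝ, ∀ t ≤ T, ∀ x, |π t x| ≤ C
  eqn : ∀ (t : ℝ≥0) (x : PosReal), π t x = zeroExt f ((x : ℝ) - t) +
    ∫ s in (0 : ℝ)..t,
      zeroExt (fun y => α y * genFunDeriv p y) ((x : ℝ) - s) *
        ∫ z, π (t - s.toNNReal) z ∂G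

/-- `Π_∞ f(x) = ∫₀^∞ π_s f(x) ds`. -/
noncomputable def totalMean (π : ℝ≥0 → PosReal → ℝ) (x : PosReal) : ℝ :=
  ∫ s in Set.Ioi (0 : ℝ), π s.toNNReal x

/-! ### The process with immigration -/

/-- `ψ(f) = ∫ (1 - exp(-⟨ν,f⟩)) L(dν)`. -/
noncomputable def immExponent (L : Measure CountMeas) (f : PosReal → ℝ) : ℝ :=
  ∫ ν, (1 - Real.exp (-pairing ν f)) ∂L

/-- `(P_t)` is the transition semigroup of the `(α,g,G,ψ)`-process: probability kernels on
`𝔑(0,∞)` with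
`∫ exp(-⟨ν,f⟩) P_t(σ,dν) = exp(-⟨σ,u_t f⟩ - ∫₀ᵗ ψ(u_s f) ds)` for all `f ∈ B(0,∞)⁺`. -/
structure IsImmigrationSemigroup (α : PosReal → ℝ) (p : PosReal → ℕ → ℝ) (G : Measure PosReal)
    (L : Measure CountMeas) (P : ℝ≥0 → Kernel CountMeas CountMeas) : Prop where
  markov : ∀ t, IsMarkovKernel (P t)
  laplace : ∀ f : PosReal → ℝ, IsBddBorel f → (∀ x, 0 ≤ f x) →
    ∀ u : ℝ≥0 → PosReal → ℝ, IsCumulant α p G f u →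
    ∀ (t : ℝ≥0) (σ : CountMeas),
      ∫ ν, Real.exp (-pairing ν f) ∂(P t σ) =
        Real.exp (-pairing σ (u t) - ∫ s in (0 : ℝ)..t, immExponent L (u s.toNNReal))

/-- `Y`, started from `σ`, is a Markov process relative to `𝓕` with transition semigroup `(P_t)`
and with right-continuous paths in `𝔑(0,∞)`. -/
structure IsRightContMarkov {Ω : Type*} [mΩ : MeasurableSpace Ω] (μ : Measure Ω)
    (𝓕 : Filtration ℝ≥0 mΩ) (P : ℝ≥0 → Kernel CountMeas CountMeas) (σ : CountMeas)
    (Y : ℝ≥0 → Ω → CountMeas) : Prop where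
  adapted : ∀ t, Measurable[𝓕 t] (Y t)
  initial : ∀ᵐ ω ∂μ, Y 0 ω = σ
  rightCont : ∀ ω t, ContinuousWithinAt (fun s => Y s ω) (Set.Ici t) t
  markov : ∀ s t : ℝ≥0, s ≤ t → ∀ h : CountMeas → ℝ, Measurable h → (∃ C : ℝ, ∀ ν, |h ν| ≤ C) →
    μ[fun ω => h (Y t ω) | 𝓕 s] =ᵐ[μ] fun ω => ∫ ν, h ν ∂(P (t - s) (Y s ω))

/-- The occupation time process `⟨Z_t, f⟩ = ∫₀ᵗ ⟨Y_s, f⟩ ds`. -/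
noncomputable def occupation {Ω : Type*} (Y : ℝ≥0 → Ω → CountMeas) (f : PosReal → ℝ)
    (t : ℝ) (ω : Ω) : ℝ :=
  ∫ s in (0 : ℝ)..t, pairing (Y s.toNNReal ω) f

/-! ### Subcriticality and the Malthusian condition -/

/-- Direct Riemann integrability over `[0,∞)` of a nonnegative function: upper sums are finite for
every mesh, and upper and lower sums have the same limit as the mesh tends to `0`. -/
def DirectlyRiemannIntegrable (f : ℝ → ℝ) : Prop :=
  (∀ a : ℝ, 0 < a →
    ∑' n : ℕ, ENNReal.ofReal a * (⨆ x ∈ Set.Icc (n * a) ((n + 1) * a), ENNReal.ofReal (f x)) < ∞) ∧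
  ∃ l : ℝ≥0∞,
    Tendsto (fun a : ℝ => ∑' n : ℕ, ENNReal.ofReal a *
      (⨆ x ∈ Set.Icc (n * a) ((n + 1) * a), ENNReal.ofReal (f x))) (𝓝[>] 0) (𝓝 l) ∧
    Tendsto (fun a : ℝ => ∑' n : ℕ, ENNReal.ofReal a *
      (⨅ x ∈ Set.Icc (n * a) ((n + 1) * a), ENNReal.ofReal (f x))) (𝓝[>] 0) (𝓝 l)

/-- `∫_{(s,∞)} α(x-s) g'(x-s,1-) G(dx)`, as an extended nonnegative number. -/
noncomputable def renewalDensity (α : PosReal → ℝ) (p : PosReal → ℕ → ℝ) (G : Measure PosReal)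
    (s : ℝ) : ℝ≥0∞ :=
  ∫⁻ x, ENNReal.ofReal (zeroExt (fun y => α y * genFunDeriv p y) ((x : ℝ) - s)) ∂G

/-- The process is subcritical, and `α₁ > 0` is its Malthusian parameter, for which moreover
`t ↦ exp(α₁ t) (1 - G(t))` is directly Riemann integrable. -/
structure SubcriticalMalthusian (α : PosReal → ℝ) (p : PosReal → ℕ → ℝ) (G : Measure PosReal)
    (α₁ : ℝ) : Prop where
  subcritical : ∫⁻ s in Set.Ioi (0 : ℝ), renewalDensity α p G s < 1
  pos : 0 < α₁
  dri : DirectlyRiemannIntegrable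
    (fun t => Real.exp (α₁ * t) * (1 - G.real {x : PosReal | (x : ℝ) ≤ t}))
  malthus : ∫⁻ s in Set.Ioi (0 : ℝ), ENNReal.ofReal (Real.exp (α₁ * s)) * renewalDensity α p G s = 1

end AgeBranching

open AgeBranching

/-!
The proof bounds the Laplace transform and the mean of `⟨Z_t, f⟩ / t`, for `f ≥ 0`, from above.

Jensen's inequality over the offset `θ ∈ (0,1]` reduces the Laplace transform of a time integral to
those of sums over the unit grids `θ, θ + 1, …`. By the Markov property the joint Laplace functional
on such a grid is that of a cumulant driven by a train of impulses, and from the `m`-th on each unit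
of time contributes at least the immigration exponent of the cumulant driven by the last `m`
impulses. The cumulant driven by impulses `f / t` is at least the corresponding mean minus an error
`B x / t²`, and `B` does not depend on the number of impulses: subcriticality and the finite second
moment of `G` bound the accumulated mean. Letting `t → ∞` and then `m → ∞`, the upper limit of the
Laplace transform is at most `exp(-∫ ⟨ν, Π_∞ f⟩ L(dν))`.

The mean of `⟨Y_s, f⟩` is at most `⟨σ, π_s f⟩ + ∫₀ˢ ∫ ⟨ν, π_r f⟩ L(dν) dr`, so the upper limit of
the mean of `⟨Z_t, f⟩ / t` is at most `c = ∫ ⟨ν, Π_∞ f⟩ L(dν)`. The function `e⁻ᶻ - 1 + z` is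
nonnegative and bounded below by a positive constant away from `0`. The two bounds make its mean at
`z = ⟨Z_t, f⟩ / t - c` tend to `0`, which is convergence in probability. Signed `f` follow by
linearity.
-/

namespace AgeBranching

/-! ### Extension by zero -/

lemma zeroExt_of_pos (h : PosReal → ℝ) {y : ℝ} (hy : 0 < y) : zeroExt h y = h ⟨y, hy⟩ := by
  simp [zeroExt, hy]

lemma zeroExt_of_nonpos (h : PosReal → ℝ) {y : ℝ} (hy : y ≤ 0) : zeroExt h y = 0 := by
  simp [zeroExt, not_lt.2 hy]

@[simp] lemma zeroExt_coe (h : PosReal → ℝ) (x : PosReal) : zeroExt h x = h x :=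
  zeroExt_of_pos h x.2

lemma zeroExt_mono {h k : PosReal → ℝ} (hhk : ∀ x, h x ≤ k x) (y : ℝ) :
    zeroExt h y ≤ zeroExt k y := by
  rcases lt_or_ge 0 y with hy | hy
  · simpa only [zeroExt_of_pos _ hy] using hhk _
  · simp only [zeroExt_of_nonpos _ hy, le_refl]

lemma zeroExt_nonneg {h : PosReal → ℝ} (h0 : ∀ x, 0 ≤ h x) (y : ℝ) : 0 ≤ zeroExt h y := by
  rcases lt_or_ge 0 y with hy | hy
  · simpa only [zeroExt_of_pos _ hy] using h0 _
  · exact (zeroExt_of_nonpos _ hy).ge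

lemma abs_zeroExt_le {h : PosReal → ℝ} {C : ℝ} (hC : ∀ x, |h x| ≤ C) (y : ℝ) :
    |zeroExt h y| ≤ C := by
  rcases lt_or_ge 0 y with hy | hy
  · simpa only [zeroExt_of_pos _ hy] using hC _
  · simpa only [zeroExt_of_nonpos _ hy, abs_zero] using
      (abs_nonneg _).trans (hC ⟨1, Set.mem_Ioi.2 one_pos⟩)

lemma zeroExt_le {h : PosReal → ℝ} {C : ℝ} (hC0 : 0 ≤ C) (hC : ∀ x, h x ≤ C) (y : ℝ) :
    zeroExt h y ≤ C := by
  rcases lt_or_ge 0 y with hy | hy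
  · simpa only [zeroExt_of_pos _ hy] using hC _
  · simpa only [zeroExt_of_nonpos _ hy] using hC0

lemma zeroExt_sub (h k : PosReal → ℝ) (y : ℝ) :
    zeroExt (fun x => h x - k x) y = zeroExt h y - zeroExt k y := by
  rcases lt_or_ge 0 y with hy | hy
  · simp only [zeroExt_of_pos _ hy]
  · simp only [zeroExt_of_nonpos _ hy, sub_zero]

lemma zeroExt_const_mul (c : ℝ) (h : PosReal → ℝ) (y : ℝ) :
    zeroExt (fun x => c * h x) y = c * zeroExt h y := by
  rcases lt_or_ge 0 y with hy | hy
  · simp only [zeroExt_of_pos _ hy]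
  · simp only [zeroExt_of_nonpos _ hy, mul_zero]

lemma zeroExt_mul_const (h : PosReal → ℝ) (c y : ℝ) :
    zeroExt (fun x => h x * c) y = zeroExt h y * c := by
  simpa only [mul_comm c] using zeroExt_const_mul c h y

lemma measurable_zeroExt_uncurry {β : Type*} [MeasurableSpace β] {h : β → PosReal → ℝ}
    (hh : Measurable (Function.uncurry h)) :
    Measurable fun q : β × ℝ => zeroExt (h q.1) q.2 := by
  classical
  have hs : MeasurableSet {q : β × ℝ | 0 < q.2} := measurableSet_lt measurable_const measurable_snd
  have hpos : Measurable fun q : {q : β × ℝ | 0 < q.2} => h q.1.1 ⟨q.1.2, q.2⟩ :=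
    hh.comp ((measurable_fst.comp measurable_subtype_coe).prodMk
      ((measurable_snd.comp measurable_subtype_coe).subtype_mk))
  convert! Measurable.dite hpos (measurable_const (a := (0 : ℝ))) hs

lemma measurable_zeroExt {h : PosReal → ℝ} (hh : Measurable h) : Measurable (zeroExt h) :=
  (measurable_zeroExt_uncurry (β := Unit) (h := fun _ => h) (hh.comp measurable_snd)).comp
    (measurable_const (a := ()).prodMk measurable_id)

lemma measurable_zeroExt_const_sub {h : PosReal → ℝ} (hh : Measurable h) (y : ℝ) :
    Measurable fun s => zeroExt h (y - s) :=
  (measurable_zeroExt hh).comp (measurable_const.sub measurable_id)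

lemma abs_zeroExt_sub_le_indicator {h : PosReal → ℝ} {C : ℝ} (hC : ∀ x, |h x| ≤ C) (y : ℝ) {s : ℝ}
    (hs : 0 ≤ s) : |zeroExt h (y - s)| ≤ (Set.Ico 0 y).indicator (fun _ => C) s := by
  by_cases hsy : s < y
  · rw [Set.indicator_of_mem (Set.mem_Ico.2 ⟨hs, hsy⟩)]
    exact abs_zeroExt_le hC _
  · rw [zeroExt_of_nonpos _ (by linarith), abs_zero, Set.indicator_of_notMem (by simp [hsy])]

lemma integrableOn_Ioi_indicator_Ico_const (y c : ℝ) :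
    IntegrableOn ((Set.Ico 0 y).indicator fun _ => c) (Set.Ioi (0 : ℝ)) :=
  ((integrable_indicator_iff measurableSet_Ico).2 (integrableOn_const (by simp))).integrableOn

lemma setIntegral_Ioi_indicator_Ico_const {y : ℝ} (hy : 0 ≤ y) (c : ℝ) :
    ∫ s in Set.Ioi (0 : ℝ), (Set.Ico 0 y).indicator (fun _ => c) s = c * y := by
  have hinter : Set.Ioi (0 : ℝ) ∩ Set.Ico 0 y = Set.Ioo 0 y := by
    ext s; simp only [Set.mem_inter_iff, Set.mem_Ioi, Set.mem_Ico, Set.mem_Ioo]; grind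
  rw [setIntegral_indicator measurableSet_Ico, hinter, setIntegral_const, Measure.real,
    Real.volume_Ioo, sub_zero, ENNReal.toReal_ofReal hy, smul_eq_mul, mul_comm]

lemma integrableOn_zeroExt_const_sub {h : PosReal → ℝ} (hm : Measurable h) {C : ℝ}
    (hC : ∀ x, |h x| ≤ C) (y : ℝ) : IntegrableOn (fun s => zeroExt h (y - s)) (Set.Ioi 0) :=
  (integrableOn_Ioi_indicator_Ico_const y C).mono'
    (measurable_zeroExt_const_sub hm y).aestronglyMeasurable <|
    (ae_restrict_iff' measurableSet_Ioi).2 <| ae_of_all _ fun _ hs =>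
      abs_zeroExt_sub_le_indicator hC y (le_of_lt hs)

lemma IsC1b.measurable {h : PosReal → ℝ} (hh : IsC1b h) : Measurable h := by
  have hcont : Continuous fun x : PosReal => zeroExt h x :=
    continuousOn_iff_continuous_domRestrict.1 hh.1.continuousOn
  simpa only [zeroExt_coe] using hcont.measurable

/-! ### Offspring laws -/

/-- A measurable family of probability distributions on `ℕ` with finite means. This is the part of
`IsOffspringLaw` that does not involve smoothness or uniform bounds. -/
structure IsOffspringKernel (p : PosReal → ℕ → ℝ) : Prop where
  measurable : ∀ i, Measurable fun x => p x i
  nonneg : ∀ x i, 0 ≤ p x i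
  hasSum_one : ∀ x, HasSum (p x) 1
  summable_mean : ∀ x, Summable fun i : ℕ => p x i * i

lemma IsOffspringLaw.isOffspringKernel {p : PosReal → ℕ → ℝ} (hp : IsOffspringLaw p) :
    IsOffspringKernel p where
  measurable i := (hp.smooth i).measurable
  nonneg := hp.nonneg
  hasSum_one := hp.hasSum_one
  summable_mean x := hp.mean_bdd.elim fun _ hC => (hC x).1

lemma pow_sub_pow_le_mul_sub {z w : ℝ} (h0 : 0 ≤ z) (hzw : z ≤ w) (h1 : w ≤ 1) (i : ℕ) :
    w ^ i - z ^ i ≤ i * (w - z) := by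
  have hw : 0 ≤ w := h0.trans hzw
  calc w ^ i - z ^ i ≤ |w ^ i - z ^ i| := le_abs_self _
    _ ≤ |w - z| * i * max |w| |z| ^ (i - 1) := abs_pow_sub_pow_le w z i
    _ = i * (w - z) * w ^ (i - 1) := by
      rw [abs_of_nonneg (sub_nonneg.2 hzw), abs_of_nonneg hw, abs_of_nonneg h0, max_eq_left hzw,
        mul_comm (i : ℝ)]
    _ ≤ i * (w - z) :=
      mul_le_of_le_one_right (mul_nonneg i.cast_nonneg (sub_nonneg.2 hzw)) (pow_le_one₀ hw h1)

lemma mul_sub_mul_sq_le_one_sub_pow {q : ℝ} (h0 : 0 ≤ q) (h1 : q ≤ 1) (i : ℕ) :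
    i * q - i * ((i : ℝ) - 1) * q ^ 2 ≤ 1 - (1 - q) ^ i := by
  induction i with
  | zero => simp
  | succ i ih =>
    have hpow : 1 - (1 - q) ^ i ≤ i * q := by
      simpa using pow_sub_pow_le_mul_sub (sub_nonneg.2 h1) (sub_le_self 1 h0) le_rfl i
    have hq := mul_le_mul_of_nonneg_left hpow h0
    have hi : 0 ≤ (i : ℝ) * q ^ 2 := mul_nonneg i.cast_nonneg (sq_nonneg q)
    rw [pow_succ (1 - q) i]
    push_cast
    nlinarith

namespace IsOffspringKernel

variable {p : PosReal → ℕ → ℝ}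

lemma summable_genFun (hp : IsOffspringKernel p) (x : PosReal) {z : ℝ} (h0 : 0 ≤ z) (h1 : z ≤ 1) :
    Summable fun i : ℕ => p x i * z ^ i :=
  .of_nonneg_of_le (fun i => mul_nonneg (hp.nonneg x i) (pow_nonneg h0 i))
    (fun i => mul_le_of_le_one_right (hp.nonneg x i) (pow_le_one₀ h0 h1)) (hp.hasSum_one x).summable

lemma genFunDeriv_nonneg (hp : IsOffspringKernel p) (x : PosReal) : 0 ≤ genFunDeriv p x :=
  tsum_nonneg fun i => mul_nonneg (hp.nonneg x i) i.cast_nonneg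

lemma genFun_one (hp : IsOffspringKernel p) (x : PosReal) : genFun p x 1 = 1 := by
  simpa only [genFun, one_pow, mul_one] using (hp.hasSum_one x).tsum_eq

lemma genFun_mono (hp : IsOffspringKernel p) (x : PosReal) {z w : ℝ} (h0 : 0 ≤ z) (hzw : z ≤ w)
    (h1 : w ≤ 1) : genFun p x z ≤ genFun p x w :=
  (hp.summable_genFun x h0 (hzw.trans h1)).tsum_le_tsum
    (fun i => mul_le_mul_of_nonneg_left (pow_le_pow_left₀ h0 hzw i) (hp.nonneg x i))
    (hp.summable_genFun x (h0.trans hzw) h1)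

lemma genFun_le_one (hp : IsOffspringKernel p) (x : PosReal) {z : ℝ} (h0 : 0 ≤ z) (h1 : z ≤ 1) :
    genFun p x z ≤ 1 :=
  (hp.genFun_mono x h0 h1 le_rfl).trans_eq (hp.genFun_one x)

lemma genFun_sub_le (hp : IsOffspringKernel p) (x : PosReal) {z w : ℝ} (h0 : 0 ≤ z) (hzw : z ≤ w)
    (h1 : w ≤ 1) : genFun p x w - genFun p x z ≤ genFunDeriv p x * (w - z) := by
  have hw := hp.summable_genFun x (h0.trans hzw) h1
  have hz := hp.summable_genFun x h0 (hzw.trans h1)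
  rw [genFun, genFun, genFunDeriv, ← hw.tsum_sub hz, ← tsum_mul_right]
  refine (hw.sub hz).tsum_le_tsum (fun i => ?_) ((hp.summable_mean x).mul_right _)
  rw [← mul_sub, mul_assoc]
  exact mul_le_mul_of_nonneg_left (pow_sub_pow_le_mul_sub h0 hzw h1 i) (hp.nonneg x i)

lemma le_one_sub_genFun (hp : IsOffspringKernel p) {x : PosReal}
    (hs : Summable fun i : ℕ => p x i * ((i : ℝ) * ((i : ℝ) - 1))) {q : ℝ} (h0 : 0 ≤ q)
    (h1 : q ≤ 1) :
    genFunDeriv p x * q - (∑' i : ℕ, p x i * ((i : ℝ) * ((i : ℝ) - 1))) * q ^ 2 ≤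
      1 - genFun p x (1 - q) := by
  have hg := hp.summable_genFun x (sub_nonneg.2 h1) (sub_le_self 1 h0)
  have hm := (hp.summable_mean x).mul_right q
  have hone := (hp.hasSum_one x).summable
  have hsub : 1 - genFun p x (1 - q) = ∑' i : ℕ, (p x i - p x i * (1 - q) ^ i) := by
    rw [hone.tsum_sub hg, (hp.hasSum_one x).tsum_eq, genFun]
  rw [hsub, genFunDeriv, ← tsum_mul_right, ← tsum_mul_right, ← hm.tsum_sub (hs.mul_right _)]
  refine (hm.sub (hs.mul_right _)).tsum_le_tsum (fun i => ?_) (hone.sub hg)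
  linarith [mul_le_mul_of_nonneg_left (mul_sub_mul_sq_le_one_sub_pow h0 h1 i) (hp.nonneg x i)]

lemma measurable_genFun (hp : IsOffspringKernel p) {β : Type*} [MeasurableSpace β]
    {x : β → PosReal} {z : β → ℝ} (hx : Measurable x) (hz : Measurable z)
    (h0 : ∀ b, 0 ≤ z b) (h1 : ∀ b, z b ≤ 1) : Measurable fun b => genFun p (x b) (z b) :=
  measurable_of_tendsto_metrizable
    (f := fun n b => ∑ i ∈ Finset.range n, p (x b) i * z b ^ i)
    (fun _ => Finset.measurable_sum _ fun i _ => ((hp.measurable i).comp hx).mul (hz.pow_const i))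
    (tendsto_pi_nhds.2 fun b => (hp.summable_genFun (x b) (h0 b) (h1 b)).hasSum.tendsto_sum_nat)

lemma measurable_genFunDeriv (hp : IsOffspringKernel p) : Measurable (genFunDeriv p) :=
  measurable_of_tendsto_metrizable (f := fun n x => ∑ i ∈ Finset.range n, p x i * i)
    (fun _ => Finset.measurable_sum _ fun i _ => (hp.measurable i).mul_const _)
    (tendsto_pi_nhds.2 fun x => (hp.summable_mean x).hasSum.tendsto_sum_nat)

end IsOffspringKernel

/-! ### Evolution equations -/

/-- A time-dependent function on `(0,∞)` that is Borel, vanishes at negative times, and is bounded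
on bounded time intervals. Letting time run through `ℝ` keeps shifts in time unrestricted. -/
structure IsPath (φ : ℝ → PosReal → ℝ) : Prop where
  measurable : Measurable (Function.uncurry φ)
  zero_of_neg : ∀ t < 0, ∀ x, φ t x = 0
  locBdd : ∀ T : ℝ, ∃ C : ℝ, ∀ t ≤ T, ∀ x, |φ t x| ≤ C

/-- A nonnegative `IsPath`. -/
structure IsNonnegPath (φ : ℝ → PosReal → ℝ) : Prop extends IsPath φ where
  nonneg : ∀ t x, 0 ≤ φ t x

/-- A bounded nonnegative Borel source term, vanishing at negative times. -/
structure IsSource (F : ℝ → PosReal → ℝ) (C : ℝ) : Prop where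
  measurable : Measurable (Function.uncurry F)
  zero_of_neg : ∀ t < 0, ∀ x, F t x = 0
  nonneg : ∀ t x, 0 ≤ F t x
  le : ∀ t x, F t x ≤ C

/-- The a priori bound `0 ≤ φ t ≤ C e^{κt}` satisfied by the Picard iterates of an evolution
equation. -/
structure IsExpBddPath (κ C : ℝ) (φ : ℝ → PosReal → ℝ) : Prop where
  measurable : Measurable (Function.uncurry φ)
  zero_of_neg : ∀ t < 0, ∀ x, φ t x = 0
  nonneg : ∀ t x, 0 ≤ φ t x
  le_exp : ∀ t x, φ t x ≤ C * Real.exp (κ * t)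

/-- A map `H y φ`, the rate at which an individual of remaining lifetime `y` produces offspring
whose contributions are distributed as `φ`, that is monotone, dominated by `κ sup φ`, and continuous
under bounded pointwise convergence. Both the cumulant and the mean equation are driven by such a
map. -/
structure IsBranchingMechanism (κ : ℝ) (H : ℝ → (PosReal → ℝ) → ℝ) : Prop where
  zero_of_nonpos : ∀ y ≤ 0, ∀ φ, H y φ = 0
  nonneg : ∀ y φ, (∀ x, 0 ≤ φ x) → 0 ≤ H y φ
  mono : ∀ y φ ψ, Measurable φ → Measurable ψ → (∀ x, 0 ≤ φ x) → (∀ x, φ x ≤ ψ x) →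
    (∃ C, ∀ x, ψ x ≤ C) → H y φ ≤ H y ψ
  le : ∀ y φ C, Measurable φ → (∀ x, 0 ≤ φ x) → (∀ x, φ x ≤ C) → H y φ ≤ κ * C
  tendsto : ∀ y (φ : ℕ → PosReal → ℝ) ψ C, (∀ n, Measurable (φ n)) →
    (∀ n x, 0 ≤ φ n x) → (∀ n x, φ n x ≤ C) → (∀ x, Tendsto (fun n => φ n x) atTop (𝓝 (ψ x))) →
    Tendsto (fun n => H y (φ n)) atTop (𝓝 (H y ψ))
  measurable : ∀ φ : ℝ → PosReal → ℝ, Measurable (Function.uncurry φ) → (∀ t x, 0 ≤ φ t x) →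
    Measurable fun q : ℝ × ℝ => H q.1 (φ q.2)

/-- The Duhamel integral `(t,x) ↦ ∫_{s>0} H(x-s, φ_{t-s}) ds` of an evolution equation. For paths
`φ` the integrand vanishes for `s > t`, which makes this an integral over `[0,t]`. -/
noncomputable def duhamel (H : ℝ → (PosReal → ℝ) → ℝ) (φ : ℝ → PosReal → ℝ) (t : ℝ)
    (x : PosReal) : ℝ :=
  ∫ s in Set.Ioi (0 : ℝ), H (x - s) (φ (t - s))

/-- `U` is a nonnegative path solving `U = F + duhamel H U`. -/
structure IsMildSolution (H : ℝ → (PosReal → ℝ) → ℝ) (F U : ℝ → PosReal → ℝ) : Prop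
    extends IsNonnegPath U where
  eqn : ∀ t x, U t x = F t x + duhamel H U t x

/-- Picard iterates, started from `0`, of `U = F + duhamel H U`. -/
noncomputable def picard (H : ℝ → (PosReal → ℝ) → ℝ) (F : ℝ → PosReal → ℝ) :
    ℕ → ℝ → PosReal → ℝ
  | 0 => fun _ _ => 0
  | n + 1 => fun t x => F t x + duhamel H (picard H F n) t x

/-- The increasing limit of the Picard iterates, which is the least nonnegative solution of
`U = F + duhamel H U`. -/
noncomputable def mildSolution (H : ℝ → (PosReal → ℝ) → ℝ) (F : ℝ → PosReal → ℝ) (t : ℝ)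
    (x : PosReal) : ℝ :=
  ⨆ n, picard H F n t x

section Paths

variable {φ ψ : ℝ → PosReal → ℝ}

lemma measurable_apply_of_uncurry (hφ : Measurable (Function.uncurry φ)) (t : ℝ) :
    Measurable (φ t) :=
  hφ.comp (measurable_const.prodMk measurable_id)

lemma IsPath.measurable_apply (hφ : IsPath φ) (t : ℝ) : Measurable (φ t) :=
  measurable_apply_of_uncurry hφ.measurable t

lemma IsPath.integrable (hφ : IsPath φ) (t : ℝ) (ν : Measure PosReal) [IsFiniteMeasure ν] :
    Integrable (φ t) ν := by
  obtain ⟨C, hC⟩ := hφ.locBdd t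
  exact .of_bound (hφ.measurable_apply t).aestronglyMeasurable C (ae_of_all _ (hC t le_rfl))

lemma isPath_zero : IsPath fun _ _ => 0 where
  measurable := measurable_const
  zero_of_neg _ _ _ := rfl
  locBdd _ := ⟨0, fun _ _ _ => abs_zero.le⟩

lemma IsPath.add (hφ : IsPath φ) (hψ : IsPath ψ) : IsPath fun t x => φ t x + ψ t x where
  measurable := hφ.measurable.add hψ.measurable
  zero_of_neg t ht x := by rw [hφ.zero_of_neg t ht, hψ.zero_of_neg t ht, add_zero]
  locBdd T := by
    obtain ⟨C, hC⟩ := hφ.locBdd T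
    obtain ⟨D, hD⟩ := hψ.locBdd T
    exact ⟨C + D, fun t ht x => (abs_add_le _ _).trans (add_le_add (hC t ht x) (hD t ht x))⟩

lemma IsPath.const_mul (hφ : IsPath φ) (c : ℝ) : IsPath fun t x => c * φ t x where
  measurable := hφ.measurable.const_mul c
  zero_of_neg t ht x := by rw [hφ.zero_of_neg t ht, mul_zero]
  locBdd T := by
    obtain ⟨C, hC⟩ := hφ.locBdd T
    exact ⟨|c| * C, fun t ht x => by
      rw [abs_mul]
      exact mul_le_mul_of_nonneg_left (hC t ht x) (abs_nonneg c)⟩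

lemma IsPath.sub (hφ : IsPath φ) (hψ : IsPath ψ) : IsPath fun t x => φ t x - ψ t x := by
  simpa only [neg_one_mul, ← sub_eq_add_neg] using hφ.add (hψ.const_mul (-1))

lemma IsPath.shift (hφ : IsPath φ) {a : ℝ} (ha : 0 ≤ a) : IsPath fun t x => φ (t - a) x where
  measurable := hφ.measurable.comp ((measurable_fst.sub measurable_const).prodMk measurable_snd)
  zero_of_neg t ht x := hφ.zero_of_neg _ (by linarith) x
  locBdd T := by
    obtain ⟨C, hC⟩ := hφ.locBdd T
    exact ⟨C, fun t ht x => hC _ (by linarith) x⟩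

lemma IsPath.finset_sum {ι : Type*} (s : Finset ι) {φ : ι → ℝ → PosReal → ℝ}
    (hφ : ∀ i, IsPath (φ i)) : IsPath fun t x => ∑ i ∈ s, φ i t x := by
  classical
  induction s using Finset.induction_on with
  | empty => simpa only [Finset.sum_empty] using isPath_zero
  | insert i s hi ih => simpa only [Finset.sum_insert hi] using (hφ i).add ih

lemma IsNonnegPath.exists_le (hφ : IsNonnegPath φ) (T : ℝ) : ∃ C, ∀ t ≤ T, ∀ x, φ t x ≤ C :=
  (hφ.locBdd T).imp fun _ hC t ht x => (le_abs_self _).trans (hC t ht x)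

lemma IsSource.const_nonneg {F : ℝ → PosReal → ℝ} {C : ℝ} (hF : IsSource F C) : 0 ≤ C :=
  (hF.nonneg 0 ⟨1, Set.mem_Ioi.2 one_pos⟩).trans (hF.le 0 _)

lemma IsExpBddPath.const_nonneg {κ C : ℝ} (hφ : IsExpBddPath κ C φ) : 0 ≤ C := by
  simpa using (hφ.nonneg 0 ⟨1, Set.mem_Ioi.2 one_pos⟩).trans (hφ.le_exp 0 _)

lemma IsExpBddPath.isNonnegPath {κ C : ℝ} (hκ : 0 ≤ κ) (hφ : IsExpBddPath κ C φ) :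
    IsNonnegPath φ where
  measurable := hφ.measurable
  zero_of_neg := hφ.zero_of_neg
  nonneg := hφ.nonneg
  locBdd T := ⟨C * Real.exp (κ * T), fun t ht x => by
    have hC := hφ.const_nonneg
    rw [abs_of_nonneg (hφ.nonneg t x)]
    exact (hφ.le_exp t x).trans (by gcongr)⟩

end Paths

lemma setIntegral_Ioi_eq_comp_add (f : ℝ → ℝ) (t : ℝ) :
    ∫ s in Set.Ioi t, f s = ∫ s in Set.Ioi (0 : ℝ), f (s + t) := by
  simpa using ((measurePreserving_add_right (volume : Measure ℝ) t).setIntegral_preimage_emb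
    (measurableEmbedding_addRight t) f (Set.Ioi t)).symm

lemma intervalIntegral_mul_exp_sub (κ C t : ℝ) :
    ∫ s in (0 : ℝ)..t, κ * (C * Real.exp (κ * (t - s))) = C * Real.exp (κ * t) - C := by
  have hderiv : ∀ s ∈ Set.uIcc 0 t, HasDerivAt (fun s => -(C * Real.exp (κ * (t - s))))
      (κ * (C * Real.exp (κ * (t - s)))) s := fun s _ => by
    have hinner : HasDerivAt (fun s => κ * (t - s)) (κ * (-1)) s :=
      ((hasDerivAt_id s).const_sub t).const_mul κ
    convert! ((hinner.exp.const_mul C).neg) using 1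
    ring
  rw [intervalIntegral.integral_eq_sub_of_hasDerivAt hderiv
    (Continuous.intervalIntegrable (by fun_prop) _ _), sub_self, mul_zero, Real.exp_zero, sub_zero]
  ring

section Duhamel

variable {H : ℝ → (PosReal → ℝ) → ℝ} {φ ψ : ℝ → PosReal → ℝ}

lemma duhamel_congr {t : ℝ} (h : ∀ r < t, φ r = ψ r) (x : PosReal) :
    duhamel H φ t x = duhamel H ψ t x :=
  setIntegral_congr_fun measurableSet_Ioi fun s (hs : 0 < s) => by
    simp only [h (t - s) (by linarith)]

lemma duhamel_shift (H : ℝ → (PosReal → ℝ) → ℝ) (φ : ℝ → PosReal → ℝ) (a t : ℝ) (x : PosReal) :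
    duhamel H (fun t x => φ (t - a) x) t x = duhamel H φ (t - a) x :=
  integral_congr_ae <| ae_of_all _ fun s => by simp only [sub_right_comm]

lemma picard_congr {F F' : ℝ → PosReal → ℝ} {τ : ℝ} (h : ∀ t < τ, F t = F' t) (n : ℕ) :
    ∀ t < τ, picard H F n t = picard H F' n t := by
  induction n with
  | zero => exact fun _ _ => rfl
  | succ n ih =>
    intro t ht
    funext x
    simp only [picard, h t ht, duhamel_congr fun r hr => ih r (hr.trans ht)]

lemma mildSolution_congr {F F' : ℝ → PosReal → ℝ} {τ : ℝ} (h : ∀ t < τ, F t = F' t) {t : ℝ}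
    (ht : t < τ) : mildSolution H F t = mildSolution H F' t :=
  funext fun x => iSup_congr fun n => congrFun (picard_congr h n t ht) x

end Duhamel

namespace IsBranchingMechanism

variable {κ C : ℝ} {H : ℝ → (PosReal → ℝ) → ℝ} {φ ψ F : ℝ → PosReal → ℝ}

lemma const_nonneg (hH : IsBranchingMechanism κ H) : 0 ≤ κ := by
  simpa using (hH.nonneg 0 (fun _ => 1) fun _ => zero_le_one).trans
    (hH.le 0 _ 1 measurable_const (fun _ => zero_le_one) fun _ => le_rfl)

lemma map_zero (hH : IsBranchingMechanism κ H) (y : ℝ) : H y (fun _ => 0) = 0 := by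
  refine le_antisymm ?_ (hH.nonneg y _ fun _ => le_rfl)
  simpa using hH.le y (fun _ => 0) 0 measurable_const (fun _ => le_rfl) fun _ => le_rfl

lemma map_eq_zero (hH : IsBranchingMechanism κ H) (hφ : IsPath φ) {t : ℝ} (ht : t < 0) (y : ℝ) :
    H y (φ t) = 0 := by
  rw [show φ t = fun _ => 0 from funext (hφ.zero_of_neg t ht), hH.map_zero]

lemma measurable_integrand (hH : IsBranchingMechanism κ H) (hφ : IsNonnegPath φ) (t y : ℝ) :
    Measurable fun s : ℝ => H (y - s) (φ (t - s)) :=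
  (hH.measurable φ hφ.measurable hφ.nonneg).comp
    ((measurable_const.sub measurable_id).prodMk (measurable_const.sub measurable_id))

lemma integrand_le_indicator (hH : IsBranchingMechanism κ H) (hφ : IsNonnegPath φ) {t B : ℝ}
    (hB : ∀ r ≤ t, ∀ x, φ r x ≤ B) (y : ℝ) {s : ℝ} (hs : 0 ≤ s) :
    ‖H (y - s) (φ (t - s))‖ ≤ (Set.Ico 0 y).indicator (fun _ => κ * B) s := by
  rw [Real.norm_of_nonneg (hH.nonneg _ _ (hφ.nonneg _))]
  by_cases hsy : s < y
  · rw [Set.indicator_of_mem (Set.mem_Ico.2 ⟨hs, hsy⟩)]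
    exact hH.le _ _ _ (hφ.measurable_apply _) (hφ.nonneg _) (hB _ (by linarith))
  · rw [hH.zero_of_nonpos _ (by linarith), Set.indicator_of_notMem (by simp [hsy])]

lemma integrableOn (hH : IsBranchingMechanism κ H) (hφ : IsNonnegPath φ) (t y : ℝ) :
    IntegrableOn (fun s : ℝ => H (y - s) (φ (t - s))) (Set.Ioi 0) := by
  obtain ⟨B, hB⟩ := hφ.exists_le t
  exact (integrableOn_Ioi_indicator_Ico_const y (κ * B)).mono'
    (hH.measurable_integrand hφ t y).aestronglyMeasurable <|
    (ae_restrict_iff' measurableSet_Ioi).2 <| ae_of_all _ fun _ hs =>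
      hH.integrand_le_indicator hφ hB y (le_of_lt hs)

lemma duhamel_nonneg (hH : IsBranchingMechanism κ H) (h0 : ∀ t x, 0 ≤ φ t x) (t : ℝ)
    (x : PosReal) : 0 ≤ duhamel H φ t x :=
  integral_nonneg fun _ => hH.nonneg _ _ (h0 _)

lemma duhamel_eq_intervalIntegral (hH : IsBranchingMechanism κ H) (hφ : IsPath φ) {t : ℝ}
    (ht : 0 ≤ t) (x : PosReal) :
    duhamel H φ t x = ∫ s in (0 : ℝ)..t, H (x - s) (φ (t - s)) := by
  rw [duhamel, intervalIntegral.integral_of_le ht]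
  exact setIntegral_eq_of_subset_of_forall_sdiff_eq_zero measurableSet_Ioi
    Set.Ioc_subset_Ioi_self fun s hs => hH.map_eq_zero hφ (by grind) _

lemma duhamel_of_neg (hH : IsBranchingMechanism κ H) (hφ : IsPath φ) {t : ℝ} (ht : t < 0)
    (x : PosReal) : duhamel H φ t x = 0 :=
  setIntegral_eq_zero_of_forall_eq_zero fun s (hs : 0 < s) =>
    hH.map_eq_zero hφ (by linarith) _

lemma duhamel_mono (hH : IsBranchingMechanism κ H) (hφ : IsNonnegPath φ) (hψ : IsNonnegPath ψ)
    (hle : ∀ t x, φ t x ≤ ψ t x) (t : ℝ) (x : PosReal) : duhamel H φ t x ≤ duhamel H ψ t x :=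
  integral_mono (hH.integrableOn hφ t x) (hH.integrableOn hψ t x) fun s =>
    hH.mono _ _ _ (hφ.measurable_apply _) (hψ.measurable_apply _) (hφ.nonneg _) (hle _)
      ((hψ.exists_le (t - s)).imp fun _ hC => hC _ le_rfl)

lemma measurable_duhamel (hH : IsBranchingMechanism κ H) (hφ : IsNonnegPath φ) :
    Measurable (Function.uncurry (duhamel H φ)) := by
  have hint : Measurable fun q : (ℝ × PosReal) × ℝ => H (q.1.2 - q.2) (φ (q.1.1 - q.2)) :=
    (hH.measurable φ hφ.measurable hφ.nonneg).comp
      (((measurable_subtype_coe.comp (measurable_snd.comp measurable_fst)).sub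
        measurable_snd).prodMk ((measurable_fst.comp measurable_fst).sub measurable_snd))
  exact (hint.stronglyMeasurable.integral_prod_right'
    (ν := volume.restrict (Set.Ioi (0 : ℝ)))).measurable

lemma duhamel_le_exp (hH : IsBranchingMechanism κ H) (hφ : IsExpBddPath κ C φ) {t : ℝ}
    (ht : 0 ≤ t) (x : PosReal) : duhamel H φ t x ≤ C * Real.exp (κ * t) - C := by
  have hpath := hφ.isNonnegPath hH.const_nonneg
  rw [← intervalIntegral_mul_exp_sub, hH.duhamel_eq_intervalIntegral hpath.toIsPath ht]
  refine intervalIntegral.integral_mono_on ht ?_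
    (Continuous.intervalIntegrable (by fun_prop) _ _) fun s _ =>
      hH.le _ _ _ (hpath.measurable_apply _) (hpath.nonneg _) (hφ.le_exp _)
  exact (intervalIntegrable_iff_integrableOn_Ioc_of_le ht).2
    ((hH.integrableOn hpath t x).mono_set Set.Ioc_subset_Ioi_self)

lemma isExpBddPath_add_duhamel (hH : IsBranchingMechanism κ H) (hF : IsSource F C)
    (hφ : IsExpBddPath κ C φ) : IsExpBddPath κ C fun t x => F t x + duhamel H φ t x := by
  have hpath := hφ.isNonnegPath hH.const_nonneg
  have hneg : ∀ t < 0, ∀ x, F t x + duhamel H φ t x = 0 := fun t ht x => by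
    rw [hF.zero_of_neg t ht, hH.duhamel_of_neg hpath.toIsPath ht, add_zero]
  refine ⟨hF.measurable.add (hH.measurable_duhamel hpath), hneg,
    fun t x => add_nonneg (hF.nonneg t x) (hH.duhamel_nonneg hφ.nonneg t x), fun t x => ?_⟩
  rcases lt_or_ge t 0 with ht | ht
  · rw [hneg t ht]
    exact mul_nonneg hF.const_nonneg (Real.exp_pos _).le
  · linarith [hF.le t x, hH.duhamel_le_exp hφ ht x]

lemma isExpBddPath_picard (hH : IsBranchingMechanism κ H) (hF : IsSource F C) (n : ℕ) :
    IsExpBddPath κ C (picard H F n) := by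
  induction n with
  | zero => exact ⟨measurable_const, fun _ _ _ => rfl, fun _ _ => le_rfl, fun _ _ =>
      mul_nonneg hF.const_nonneg (Real.exp_pos _).le⟩
  | succ n ih => exact hH.isExpBddPath_add_duhamel hF ih

lemma isNonnegPath_picard (hH : IsBranchingMechanism κ H) (hF : IsSource F C) (n : ℕ) :
    IsNonnegPath (picard H F n) :=
  (hH.isExpBddPath_picard hF n).isNonnegPath hH.const_nonneg

lemma picard_le_succ (hH : IsBranchingMechanism κ H) (hF : IsSource F C) (n : ℕ) (t : ℝ)
    (x : PosReal) : picard H F n t x ≤ picard H F (n + 1) t x := by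
  induction n generalizing t x with
  | zero => exact (hH.isNonnegPath_picard hF 1).nonneg t x
  | succ n ih =>
    exact add_le_add le_rfl (hH.duhamel_mono (hH.isNonnegPath_picard hF n)
      (hH.isNonnegPath_picard hF (n + 1)) ih t x)

lemma tendsto_picard (hH : IsBranchingMechanism κ H) (hF : IsSource F C) (t : ℝ) (x : PosReal) :
    Tendsto (fun n => picard H F n t x) atTop (𝓝 (mildSolution H F t x)) := by
  refine tendsto_atTop_ciSup (monotone_nat_of_le_succ fun n => hH.picard_le_succ hF n t x)
    ⟨C * Real.exp (κ * t), ?_⟩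
  rintro _ ⟨n, rfl⟩
  exact (hH.isExpBddPath_picard hF n).le_exp t x

lemma isExpBddPath_mildSolution (hH : IsBranchingMechanism κ H) (hF : IsSource F C) :
    IsExpBddPath κ C (mildSolution H F) where
  measurable := measurable_of_tendsto_metrizable (f := fun n => Function.uncurry (picard H F n))
    (fun n => (hH.isExpBddPath_picard hF n).measurable)
    (tendsto_pi_nhds.2 fun q => hH.tendsto_picard hF q.1 q.2)
  zero_of_neg t ht x := tendsto_nhds_unique (hH.tendsto_picard hF t x) <| by
    simp_rw [(hH.isExpBddPath_picard hF _).zero_of_neg t ht x]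
    exact tendsto_const_nhds
  nonneg t x := ge_of_tendsto' (hH.tendsto_picard hF t x) fun n =>
    (hH.isExpBddPath_picard hF n).nonneg t x
  le_exp t x := le_of_tendsto' (hH.tendsto_picard hF t x) fun n =>
    (hH.isExpBddPath_picard hF n).le_exp t x

lemma tendsto_duhamel_picard (hH : IsBranchingMechanism κ H) (hF : IsSource F C) (t : ℝ)
    (x : PosReal) :
    Tendsto (fun n => duhamel H (picard H F n) t x) atTop
      (𝓝 (duhamel H (mildSolution H F) t x)) := by
  have hp := hH.isNonnegPath_picard hF
  have hbound : ∀ n, ∀ r ≤ t, ∀ x, picard H F n r x ≤ C * Real.exp (κ * t) := fun n r hr x => by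
    have hκ := hH.const_nonneg
    have hC := hF.const_nonneg
    exact ((hH.isExpBddPath_picard hF n).le_exp r x).trans (by gcongr)
  refine tendsto_integral_of_dominated_convergence
    ((Set.Ico 0 (x : ℝ)).indicator fun _ => κ * (C * Real.exp (κ * t)))
    (fun n => (hH.measurable_integrand (hp n) t x).aestronglyMeasurable)
    (integrableOn_Ioi_indicator_Ico_const _ _) (fun n => ?_) (ae_of_all _ fun s => ?_)
  · exact (ae_restrict_iff' measurableSet_Ioi).2 <| ae_of_all _ fun s hs =>
      hH.integrand_le_indicator (hp n) (hbound n) x (le_of_lt hs)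
  · exact hH.tendsto _ _ _ _ (fun n => (hp n).measurable_apply _) (fun n => (hp n).nonneg _)
      (fun n => (hH.isExpBddPath_picard hF n).le_exp _) fun z => hH.tendsto_picard hF _ z

lemma isMildSolution_mildSolution (hH : IsBranchingMechanism κ H) (hF : IsSource F C) :
    IsMildSolution H F (mildSolution H F) where
  toIsNonnegPath := (hH.isExpBddPath_mildSolution hF).isNonnegPath hH.const_nonneg
  eqn t x := tendsto_nhds_unique ((tendsto_add_atTop_iff_nat 1).2 (hH.tendsto_picard hF t x))
    ((hH.tendsto_duhamel_picard hF t x).const_add (F t x))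

end IsBranchingMechanism

lemma IsMildSolution.restart {κ : ℝ} {H : ℝ → (PosReal → ℝ) → ℝ} {F U : ℝ → PosReal → ℝ}
    (hH : IsBranchingMechanism κ H) (hU : IsMildSolution H F U) {τ : ℝ}
    (hF : ∀ t, 0 ≤ t → ∀ x : PosReal, F (τ + t) x = zeroExt (F τ) (x - t)) {t : ℝ} (ht : 0 ≤ t)
    (x : PosReal) :
    U (τ + t) x = zeroExt (U τ) (x - t) + ∫ s in (0 : ℝ)..t, H (x - s) (U (τ + t - s)) := by
  have hint := hH.integrableOn hU.toIsNonnegPath (τ + t) x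
  have hpast : ∫ s in Set.Ioi t, H (x - s) (U (τ + t - s)) =
      ∫ s in Set.Ioi (0 : ℝ), H (x - t - s) (U (τ - s)) := by
    rw [setIntegral_Ioi_eq_comp_add]
    refine integral_congr_ae (ae_of_all _ fun s => ?_)
    simp only [show (x : ℝ) - (s + t) = x - t - s by ring, show τ + t - (s + t) = τ - s by ring]
  rw [hU.eqn, duhamel, ← intervalIntegral.integral_interval_add_Ioi hint
    (hint.mono_set (Set.Ioi_subset_Ioi ht)), hF t ht x, hpast]
  rcases lt_or_ge 0 ((x : ℝ) - t) with hx | hx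
  · rw [zeroExt_of_pos _ hx, zeroExt_of_pos _ hx, hU.eqn τ, duhamel]
    ring
  · rw [zeroExt_of_nonpos _ hx, zeroExt_of_nonpos _ hx, setIntegral_eq_zero_of_forall_eq_zero
      (t := Set.Ioi (0 : ℝ)) fun s (hs : 0 < s) => hH.zero_of_nonpos _ (by linarith) _]
    ring

/-! ### The linear equation -/

/-- The mechanism `k(y) ⟨G, φ⟩` of the mean equation: `k` is the rate of reproduction, and `G` the
law of the lifetimes of the offspring. -/
noncomputable def meanMechanism (G : Measure PosReal) (k : PosReal → ℝ) (y : ℝ)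
    (φ : PosReal → ℝ) : ℝ :=
  zeroExt k y * ∫ z, φ z ∂G

/-- The potential `∫₀ˣ k(x-s) ds`: the mean offspring of an individual with remaining lifetime `x`
that reproduces at rate `k`. -/
noncomputable def potential (k : PosReal → ℝ) (x : PosReal) : ℝ :=
  ∫ s in Set.Ioi (0 : ℝ), zeroExt k (x - s)

/-- The geometric series `⟨G,c⟩ + ρ⟨G,c⟩ + ρ²⟨G,c⟩ + …` with ratio the mean offspring
`ρ = ⟨G, potential k⟩ < 1`: the total contribution of an individual drawn from `G` and of all its
descendants, when one with lifetime `x` contributes `c x`. -/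
noncomputable def renewalSum (G : Measure PosReal) (k c : PosReal → ℝ) : ℝ :=
  (∫ z, c z ∂G) / (1 - ∫ z, potential k z ∂G)

/-- A reproduction rate `0 ≤ k ≤ κ` and a lifetime law `G` with finite second moment such that the
mean offspring `⟨G, potential k⟩` of an individual is less than `1`. -/
structure IsSubcritical (G : Measure PosReal) (k : PosReal → ℝ) (κ : ℝ) : Prop where
  measurable : Measurable k
  nonneg : ∀ x, 0 ≤ k x
  le : ∀ x, k x ≤ κ
  lt_one : ∫⁻ x, (∫⁻ s in Set.Ioi (0 : ℝ), ENNReal.ofReal (zeroExt k (x - s))) ∂G < 1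
  sq_integrable : Integrable (fun x : PosReal => (x : ℝ) ^ 2) G

lemma renewalSum_const_mul (G : Measure PosReal) (k c : PosReal → ℝ) (a : ℝ) :
    renewalSum G k (fun x => a * c x) = a * renewalSum G k c := by
  rw [renewalSum, renewalSum, integral_const_mul, mul_div_assoc]

lemma integrable_coe_of_sq {G : Measure PosReal} [IsFiniteMeasure G]
    (h : Integrable (fun x : PosReal => (x : ℝ) ^ 2) G) :
    Integrable (fun x : PosReal => (x : ℝ)) G := by
  refine (h.add (integrable_const 1)).mono' measurable_subtype_coe.aestronglyMeasurable
    (ae_of_all _ fun x => ?_)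
  rw [Real.norm_of_nonneg (le_of_lt x.2), Pi.add_apply]
  nlinarith [sq_nonneg ((x : ℝ) - 1)]

lemma measurable_integral_apply {G : Measure PosReal} [SFinite G] {φ : ℝ → PosReal → ℝ}
    (hφ : Measurable (Function.uncurry φ)) : Measurable fun t => ∫ z, φ t z ∂G :=
  (hφ.stronglyMeasurable.integral_prod_right' (ν := G)).measurable

lemma abs_integral_le_of_forall_abs_le {β : Type*} [MeasurableSpace β] {G : Measure β}
    [IsProbabilityMeasure G] {h : β → ℝ} {C : ℝ} (hC : ∀ x, |h x| ≤ C) : |∫ z, h z ∂G| ≤ C := by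
  simpa using norm_integral_le_of_norm_le_const (μ := G) (f := h) (C := C) (ae_of_all _ hC)

lemma integral_mem_Icc_of_forall_mem {β : Type*} [MeasurableSpace β] {G : Measure β}
    [IsProbabilityMeasure G] {h : β → ℝ} {C : ℝ} (h0 : ∀ x, 0 ≤ h x) (hC : ∀ x, h x ≤ C) :
    ∫ z, h z ∂G ∈ Set.Icc 0 C :=
  ⟨integral_nonneg h0, (le_abs_self _).trans <| abs_integral_le_of_forall_abs_le fun x => by
    rw [abs_of_nonneg (h0 x)]; exact hC x⟩

namespace IsSubcritical

variable {G : Measure PosReal} {k : PosReal → ℝ} {κ : ℝ}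

lemma const_nonneg (hk : IsSubcritical G k κ) : 0 ≤ κ :=
  (hk.nonneg ⟨1, Set.mem_Ioi.2 one_pos⟩).trans (hk.le _)

lemma abs_le (hk : IsSubcritical G k κ) (x : PosReal) : |k x| ≤ κ := by
  rw [abs_of_nonneg (hk.nonneg x)]
  exact hk.le x

lemma potential_nonneg (hk : IsSubcritical G k κ) (x : PosReal) : 0 ≤ potential k x :=
  integral_nonneg fun _ => zeroExt_nonneg hk.nonneg _

lemma potential_le (hk : IsSubcritical G k κ) (x : PosReal) : potential k x ≤ κ * x := by
  rw [← setIntegral_Ioi_indicator_Ico_const (le_of_lt x.2) κ, potential]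
  exact setIntegral_mono_on (integrableOn_zeroExt_const_sub hk.measurable hk.abs_le x)
    (integrableOn_Ioi_indicator_Ico_const _ _) measurableSet_Ioi fun s hs =>
      (le_abs_self _).trans (abs_zeroExt_sub_le_indicator hk.abs_le x (le_of_lt hs))

lemma measurable_potential (hk : IsSubcritical G k κ) : Measurable (potential k) :=
  (((measurable_zeroExt hk.measurable).comp ((measurable_subtype_coe.comp measurable_fst).sub
    measurable_snd)).stronglyMeasurable.integral_prod_right'
    (ν := volume.restrict (Set.Ioi (0 : ℝ)))).measurable

lemma ofReal_potential (hk : IsSubcritical G k κ) (x : PosReal) :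
    ENNReal.ofReal (potential k x) =
      ∫⁻ s in Set.Ioi (0 : ℝ), ENNReal.ofReal (zeroExt k (x - s)) :=
  ofReal_integral_eq_lintegral_ofReal (integrableOn_zeroExt_const_sub hk.measurable hk.abs_le x)
    (ae_of_all _ fun _ => zeroExt_nonneg hk.nonneg _)

lemma integral_potential_nonneg (hk : IsSubcritical G k κ) : 0 ≤ ∫ x, potential k x ∂G :=
  integral_nonneg hk.potential_nonneg

section

variable [IsFiniteMeasure G]

lemma integrable_coe (hk : IsSubcritical G k κ) : Integrable (fun x : PosReal => (x : ℝ)) G :=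
  integrable_coe_of_sq hk.sq_integrable

lemma integrable_potential (hk : IsSubcritical G k κ) : Integrable (potential k) G :=
  (hk.integrable_coe.const_mul κ).mono' hk.measurable_potential.aestronglyMeasurable <|
    ae_of_all _ fun x => by
      rw [Real.norm_of_nonneg (hk.potential_nonneg x)]
      exact hk.potential_le x

lemma integral_potential_lt_one (hk : IsSubcritical G k κ) : ∫ x, potential k x ∂G < 1 := by
  have h := hk.lt_one
  simp_rw [← hk.ofReal_potential] at h
  rwa [← ofReal_integral_eq_lintegral_ofReal hk.integrable_potential
    (ae_of_all _ hk.potential_nonneg), ENNReal.ofReal_lt_one] at h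

lemma renewalSum_nonneg (hk : IsSubcritical G k κ) {c : PosReal → ℝ} (hc : ∀ x, 0 ≤ c x) :
    0 ≤ renewalSum G k c :=
  div_nonneg (integral_nonneg hc) (by linarith [hk.integral_potential_lt_one])

lemma renewalSum_eq_add (hk : IsSubcritical G k κ) (c : PosReal → ℝ) :
    renewalSum G k c = ∫ z, c z ∂G + (∫ z, potential k z ∂G) * renewalSum G k c := by
  have hne : 1 - ∫ z, potential k z ∂G ≠ 0 := by linarith [hk.integral_potential_lt_one]
  rw [renewalSum]
  field_simp
  ring

end

variable [IsProbabilityMeasure G]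

lemma isBranchingMechanism (hk : IsSubcritical G k κ) :
    IsBranchingMechanism κ (meanMechanism G k) where
  zero_of_nonpos y hy φ := by rw [meanMechanism, zeroExt_of_nonpos _ hy, zero_mul]
  nonneg y φ h := mul_nonneg (zeroExt_nonneg hk.nonneg y) (integral_nonneg h)
  mono y φ ψ _ hψ h0 hle hC := by
    obtain ⟨C, hC⟩ := hC
    have hint : Integrable ψ G := .of_bound hψ.aestronglyMeasurable C <| ae_of_all _ fun x => by
      rw [Real.norm_of_nonneg ((h0 x).trans (hle x))]
      exact hC x
    exact mul_le_mul_of_nonneg_left (integral_mono_of_nonneg (ae_of_all _ h0) hint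
      (ae_of_all _ hle)) (zeroExt_nonneg hk.nonneg y)
  le y φ C _ h0 hC := by
    have hmem := integral_mem_Icc_of_forall_mem (G := G) h0 hC
    exact mul_le_mul (zeroExt_le hk.const_nonneg hk.le y) hmem.2 hmem.1 hk.const_nonneg
  tendsto y φ ψ C hφ h0 hC hlim :=
    (tendsto_integral_of_dominated_convergence (fun _ => C)
      (fun n => (hφ n).aestronglyMeasurable) (integrable_const C) (fun n => ae_of_all _ fun x => by
        rw [Real.norm_of_nonneg (h0 n x)]; exact hC n x) (ae_of_all _ hlim)).const_mul _
  measurable φ hφ _ := ((measurable_zeroExt hk.measurable).comp measurable_fst).mul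
    ((measurable_integral_apply hφ).comp measurable_snd)

variable {φ ψ : ℝ → PosReal → ℝ}

lemma integrableOn_meanMechanism (hk : IsSubcritical G k κ) (hφ : IsPath φ) (t y : ℝ) :
    IntegrableOn (fun s => meanMechanism G k (y - s) (φ (t - s))) (Set.Ioi 0) := by
  obtain ⟨C, hC⟩ := hφ.locBdd t
  refine (integrableOn_zeroExt_const_sub hk.measurable hk.abs_le y).mul_bdd (c := C)
    ((measurable_integral_apply hφ.measurable).comp
      (measurable_const.sub measurable_id)).aestronglyMeasurable ?_
  exact (ae_restrict_iff' measurableSet_Ioi).2 <| ae_of_all _ fun s (hs : 0 < s) =>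
    abs_integral_le_of_forall_abs_le (hC (t - s) (by linarith))

lemma duhamel_sub (hk : IsSubcritical G k κ) (hφ : IsPath φ) (hψ : IsPath ψ) (t : ℝ)
    (x : PosReal) : duhamel (meanMechanism G k) (fun t x => φ t x - ψ t x) t x =
      duhamel (meanMechanism G k) φ t x - duhamel (meanMechanism G k) ψ t x := by
  simp only [duhamel]
  rw [← integral_sub (hk.integrableOn_meanMechanism hφ t x) (hk.integrableOn_meanMechanism hψ t x)]
  refine integral_congr_ae (ae_of_all _ fun s => ?_)
  simp only [meanMechanism, integral_sub (hφ.integrable _ G) (hψ.integrable _ G), mul_sub]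

lemma duhamel_finset_sum (hk : IsSubcritical G k κ) {ι : Type*} (s : Finset ι)
    {φ : ι → ℝ → PosReal → ℝ} (hφ : ∀ i, IsPath (φ i)) (t : ℝ) (x : PosReal) :
    duhamel (meanMechanism G k) (fun t x => ∑ i ∈ s, φ i t x) t x =
      ∑ i ∈ s, duhamel (meanMechanism G k) (φ i) t x := by
  simp only [duhamel]
  rw [← integral_finsetSum s fun i _ => hk.integrableOn_meanMechanism (hφ i) t x]
  refine integral_congr_ae (ae_of_all _ fun r => ?_)
  simp only [meanMechanism, integral_finsetSum s fun i _ => (hφ i).integrable _ G, Finset.mul_sum]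

lemma duhamel_le_potential_mul (hk : IsSubcritical G k κ) (hφ : IsPath φ) {t B : ℝ}
    (hB : ∀ r ≤ t, ∫ z, φ r z ∂G ≤ B) (x : PosReal) :
    duhamel (meanMechanism G k) φ t x ≤ potential k x * B := by
  rw [potential, ← integral_mul_const, duhamel]
  exact setIntegral_mono_on (hk.integrableOn_meanMechanism hφ t x)
    ((integrableOn_zeroExt_const_sub hk.measurable hk.abs_le x).mul_const _) measurableSet_Ioi
    fun s (hs : 0 < s) =>
      mul_le_mul_of_nonneg_left (hB _ (by linarith)) (zeroExt_nonneg hk.nonneg _)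

variable {c : PosReal → ℝ}

/-- Integrating the inequality against `G` gives `S ≤ ⟨G,c⟩ + ρ S` for the supremum `S` of the left
hand sides over `r ≤ t`, where `ρ < 1` is the mean offspring number. -/
lemma integral_le_of_le_add_duhamel (hk : IsSubcritical G k κ) (hφ : IsPath φ)
    (hc : Integrable c G) (hc0 : ∀ x, 0 ≤ c x)
    (h : ∀ t, 0 ≤ t → ∀ x, φ t x ≤ c x + duhamel (meanMechanism G k) φ t x) {r t : ℝ}
    (hr : r ≤ t) : ∫ z, φ r z ∂G ≤ renewalSum G k c := by
  obtain ⟨C, hC⟩ := hφ.locBdd t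
  have hbdd : BddAbove (Set.range fun r : Set.Iic t => ∫ z, φ r z ∂G) := ⟨C, by
    rintro _ ⟨r, rfl⟩
    exact (le_abs_self _).trans (abs_integral_le_of_forall_abs_le (hC r r.2))⟩
  set S := ⨆ r : Set.Iic t, ∫ z, φ r z ∂G
  have hle : ∀ r ≤ t, ∫ z, φ r z ∂G ≤ S := fun r hr => le_ciSup hbdd ⟨r, hr⟩
  have hS0 : 0 ≤ S := by
    simpa [hφ.zero_of_neg (min t (-1)) (by simp)] using hle (min t (-1)) (min_le_left _ _)
  have : Nonempty (Set.Iic t) := ⟨⟨t, Set.self_mem_Iic⟩⟩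
  have hS : S ≤ (∫ z, c z ∂G) + (∫ z, potential k z ∂G) * S := by
    refine ciSup_le fun ⟨r, hr⟩ => ?_
    rcases lt_or_ge r 0 with hr0 | hr0
    · simp_rw [hφ.zero_of_neg r hr0, integral_zero]
      exact add_nonneg (integral_nonneg hc0) (mul_nonneg hk.integral_potential_nonneg hS0)
    · have hint := hk.integrable_potential.mul_const S
      rw [← integral_mul_const, ← integral_add hc hint]
      exact integral_mono (hφ.integrable r G) (hc.add hint) fun x =>
        (h r hr0 x).trans <| add_le_add le_rfl <|
          hk.duhamel_le_potential_mul hφ (fun r' hr' => hle r' (hr'.trans hr)) x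
  refine (hle r hr).trans ?_
  rw [renewalSum, le_div_iff₀ (by linarith [hk.integral_potential_lt_one])]
  linarith

lemma le_of_le_add_duhamel (hk : IsSubcritical G k κ) (hφ : IsPath φ) (hc : Integrable c G)
    (hc0 : ∀ x, 0 ≤ c x)
    (h : ∀ t, 0 ≤ t → ∀ x, φ t x ≤ c x + duhamel (meanMechanism G k) φ t x) (t : ℝ)
    (x : PosReal) :
    φ t x ≤ c x + potential k x * renewalSum G k c := by
  rcases lt_or_ge t 0 with ht | ht
  · rw [hφ.zero_of_neg t ht]
    exact add_nonneg (hc0 x) (mul_nonneg (hk.potential_nonneg x) (hk.renewalSum_nonneg hc0))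
  · exact (h t ht x).trans <| add_le_add le_rfl <|
      hk.duhamel_le_potential_mul hφ (fun _ hr => hk.integral_le_of_le_add_duhamel hφ hc hc0 h hr) x

lemma le_mul_of_le_add_duhamel (hk : IsSubcritical G k κ) (hφ : IsPath φ) (hc : Integrable c G)
    (hxc : ∀ x : PosReal, x ≤ c x) {a : ℝ} (ha : 0 ≤ a)
    (h : ∀ t, 0 ≤ t → ∀ x, φ t x ≤ a * c x + duhamel (meanMechanism G k) φ t x) (t : ℝ)
    (x : PosReal) : φ t x ≤ a * ((1 + κ * renewalSum G k c) * c x) := by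
  have hc0 : ∀ x, 0 ≤ c x := fun x => (le_of_lt x.2).trans (hxc x)
  calc φ t x ≤ a * c x + potential k x * renewalSum G k (fun x => a * c x) :=
        hk.le_of_le_add_duhamel hφ (hc.const_mul a) (fun x => mul_nonneg ha (hc0 x)) h t x
    _ = a * (c x + potential k x * renewalSum G k c) := by rw [renewalSum_const_mul]; ring
    _ ≤ a * (c x + κ * c x * renewalSum G k c) := by
        have := (hk.potential_le x).trans (mul_le_mul_of_nonneg_left (hxc x) hk.const_nonneg)
        gcongr
        exact hk.renewalSum_nonneg hc0
    _ = a * ((1 + κ * renewalSum G k c) * c x) := by ring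

lemma nonpos_of_le_duhamel (hk : IsSubcritical G k κ) (hφ : IsPath φ)
    (h : ∀ t, 0 ≤ t → ∀ x, φ t x ≤ duhamel (meanMechanism G k) φ t x) (t : ℝ) (x : PosReal) :
    φ t x ≤ 0 := by
  simpa [renewalSum] using hk.le_of_le_add_duhamel hφ (c := fun _ => 0) (integrable_zero _ _ _)
    (fun _ => le_rfl) (fun t ht x => by simpa using h t ht x) t x

end IsSubcritical

lemma duhamel_meanMechanism_const_mul (G : Measure PosReal) (k : PosReal → ℝ)
    (φ : ℝ → PosReal → ℝ) (c t : ℝ) (x : PosReal) :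
    duhamel (meanMechanism G k) (fun t x => c * φ t x) t x =
      c * duhamel (meanMechanism G k) φ t x := by
  simp only [duhamel, meanMechanism, integral_const_mul, mul_left_comm _ c]

/-! ### The mean equation -/

/-- The source `f(x-t)` of the equations for `π_t f` and `u_t f`, switched on at time `0`. -/
noncomputable def impulse (f : PosReal → ℝ) (t : ℝ) (x : PosReal) : ℝ :=
  if 0 ≤ t then zeroExt f (x - t) else 0

/-- Extension by `0` to negative times. -/
noncomputable def extendTime (u : ℝ≥0 → PosReal → ℝ) (t : ℝ) (x : PosReal) : ℝ :=
  if 0 ≤ t then u t.toNNReal x else 0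

/-- A locally bounded Borel solution of `π_t = f(·-t) + ∫₀ᵗ k(·-s) ⟨G,π_{t-s}⟩ ds`, with time
running through `ℝ`. -/
structure IsMeanPath (G : Measure PosReal) (k f : PosReal → ℝ) (π : ℝ → PosReal → ℝ) : Prop
    extends IsPath π where
  eqn : ∀ t x, π t x = impulse f t x + duhamel (meanMechanism G k) π t x

/-- The solution of the mean equation with initial value `f ≥ 0`. -/
noncomputable def meanPath (G : Measure PosReal) (k f : PosReal → ℝ) : ℝ → PosReal → ℝ :=
  mildSolution (meanMechanism G k) (impulse f)

section Impulse

variable {f : PosReal → ℝ}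

lemma impulse_of_nonneg (f : PosReal → ℝ) {t : ℝ} (ht : 0 ≤ t) (x : PosReal) :
    impulse f t x = zeroExt f (x - t) :=
  if_pos ht

lemma impulse_of_neg (f : PosReal → ℝ) {t : ℝ} (ht : t < 0) (x : PosReal) :
    impulse f t x = 0 :=
  if_neg (not_le.2 ht)

lemma impulse_sub (f g : PosReal → ℝ) (t : ℝ) (x : PosReal) :
    impulse (fun x => f x - g x) t x = impulse f t x - impulse g t x := by
  rcases lt_or_ge t 0 with ht | ht
  · simp only [impulse_of_neg _ ht, sub_zero]
  · simp only [impulse_of_nonneg _ ht, zeroExt_sub]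

lemma isSource_impulse {C : ℝ} (hf : Measurable f) (h0 : ∀ x, 0 ≤ f x) (hC : ∀ x, f x ≤ C) :
    IsSource (impulse f) C where
  measurable := .ite (measurableSet_Ici.preimage measurable_fst)
    ((measurable_zeroExt hf).comp ((measurable_subtype_coe.comp measurable_snd).sub measurable_fst))
    measurable_const
  zero_of_neg t ht x := impulse_of_neg f ht x
  nonneg t x := by
    unfold impulse
    split_ifs
    exacts [zeroExt_nonneg h0 _, le_rfl]
  le t x := by
    have hC0 : 0 ≤ C := (h0 x).trans (hC x)
    unfold impulse
    split_ifs
    exacts [zeroExt_le hC0 hC _, hC0]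

lemma lintegral_impulse_le {C : ℝ} (h0 : ∀ x, 0 ≤ f x) (hC : ∀ x, f x ≤ C) (x : PosReal) :
    ∫⁻ t in Set.Ioi (0 : ℝ), ENNReal.ofReal (impulse f t x) ≤ ENNReal.ofReal (C * x) := by
  have habs : ∀ x, |f x| ≤ C := fun x => by rw [abs_of_nonneg (h0 x)]; exact hC x
  rw [← setIntegral_Ioi_indicator_Ico_const (le_of_lt x.2) C, ofReal_integral_eq_lintegral_ofReal
    (integrableOn_Ioi_indicator_Ico_const _ _)
    (ae_of_all _ fun s => Set.indicator_nonneg (fun _ _ => (h0 x).trans (hC x)) s)]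
  refine setLIntegral_mono' measurableSet_Ioi fun t (ht : 0 < t) => ENNReal.ofReal_le_ofReal ?_
  rw [impulse_of_nonneg f ht.le]
  exact (le_abs_self _).trans (abs_zeroExt_sub_le_indicator habs x ht.le)

end Impulse

lemma isPath_extendTime {u : ℝ≥0 → PosReal → ℝ} (hm : Measurable (Function.uncurry u))
    (hb : ∀ T : ℝ≥0, ∃ C : ℝ, ∀ t ≤ T, ∀ x, |u t x| ≤ C) : IsPath (extendTime u) where
  measurable := .ite (measurableSet_Ici.preimage measurable_fst)
    (hm.comp ((measurable_real_toNNReal.comp measurable_fst).prodMk measurable_snd))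
    measurable_const
  zero_of_neg t ht x := if_neg (not_le.2 ht)
  locBdd T := by
    obtain ⟨C, hC⟩ := hb T.toNNReal
    refine ⟨C, fun t ht x => ?_⟩
    unfold extendTime
    split_ifs
    · exact hC _ (Real.toNNReal_le_toNNReal ht) x
    · simpa using (abs_nonneg _).trans (hC 0 zero_le x)

lemma sub_toNNReal (t : ℝ≥0) {s : ℝ} (hs : 0 ≤ s) :
    t - s.toNNReal = ((t : ℝ) - s).toNNReal := by
  rw [NNReal.sub_def, Real.coe_toNNReal _ hs]

/-- The mean number `α(y) g'(y,1-)` of offspring per unit of time of an individual with remaining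
lifetime `y`. -/
noncomputable abbrev meanRate (α : PosReal → ℝ) (p : PosReal → ℕ → ℝ) (y : PosReal) : ℝ :=
  α y * genFunDeriv p y

section MeanEquation

variable {G : Measure PosReal} [IsProbabilityMeasure G] {α : PosReal → ℝ} {p : PosReal → ℕ → ℝ}
  {k f g : PosReal → ℝ} {κ C : ℝ} {π π' : ℝ → PosReal → ℝ}

lemma IsMeanPath.isMeanSolution (hk : IsSubcritical G (meanRate α p) κ)
    (hπ : IsMeanPath G (meanRate α p) f π) :
    IsMeanSolution α p G f fun t => π t where
  measurable := hπ.measurable.comp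
    ((measurable_subtype_coe.comp measurable_fst).prodMk measurable_snd)
  locBdd T := (hπ.locBdd T).imp fun _ hC t ht x => hC t (by exact_mod_cast ht) x
  eqn t x := by
    rw [hπ.eqn, impulse_of_nonneg f t.coe_nonneg,
      hk.isBranchingMechanism.duhamel_eq_intervalIntegral hπ.toIsPath t.coe_nonneg]
    congr 1
    refine intervalIntegral.integral_congr fun s hs => ?_
    rw [Set.uIcc_of_le t.coe_nonneg] at hs
    simp only [meanMechanism, sub_toNNReal t hs.1, Real.coe_toNNReal _ (sub_nonneg.2 hs.2)]

lemma IsMeanSolution.isMeanPath (hk : IsSubcritical G (meanRate α p) κ)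
    {u : ℝ≥0 → PosReal → ℝ} (hu : IsMeanSolution α p G f u) :
    IsMeanPath G (meanRate α p) f (extendTime u) where
  toIsPath := isPath_extendTime hu.measurable hu.locBdd
  eqn t x := by
    have hpath := isPath_extendTime hu.measurable hu.locBdd
    have hH := hk.isBranchingMechanism
    rcases lt_or_ge t 0 with ht | ht
    · rw [hpath.zero_of_neg t ht, impulse_of_neg f ht, hH.duhamel_of_neg hpath ht, add_zero]
    · rw [impulse_of_nonneg f ht, hH.duhamel_eq_intervalIntegral hpath ht, extendTime, if_pos ht,
        hu.eqn, Real.coe_toNNReal _ ht]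
      congr 1
      refine intervalIntegral.integral_congr fun s hs => ?_
      rw [Set.uIcc_of_le ht] at hs
      simp only [meanMechanism, sub_toNNReal _ hs.1, Real.coe_toNNReal _ ht, extendTime,
        if_pos (sub_nonneg.2 hs.2)]

lemma IsMeanPath.le (hk : IsSubcritical G k κ) (hπ : IsMeanPath G k f π)
    (hπ' : IsMeanPath G k f π') (t : ℝ) (x : PosReal) : π t x ≤ π' t x := by
  refine sub_nonpos.1 (hk.nonpos_of_le_duhamel (hπ.sub hπ'.toIsPath) (fun t _ x => ?_) t x)
  rw [hk.duhamel_sub hπ.toIsPath hπ'.toIsPath, hπ.eqn t x, hπ'.eqn t x]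
  linarith

lemma IsMeanPath.unique (hk : IsSubcritical G k κ) (hπ : IsMeanPath G k f π)
    (hπ' : IsMeanPath G k f π') : π = π' :=
  funext₂ fun t x => le_antisymm (hπ.le hk hπ' t x) (hπ'.le hk hπ t x)

lemma IsMeanPath.sub (hk : IsSubcritical G k κ) (hπ : IsMeanPath G k f π)
    (hπ' : IsMeanPath G k g π') :
    IsMeanPath G k (fun x => f x - g x) fun t x => π t x - π' t x where
  toIsPath := hπ.toIsPath.sub hπ'.toIsPath
  eqn t x := by
    rw [hk.duhamel_sub hπ.toIsPath hπ'.toIsPath, hπ.eqn t x, hπ'.eqn t x, impulse_sub]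
    ring

lemma isMildSolution_meanPath (hk : IsSubcritical G k κ) (hf : Measurable f) (h0 : ∀ x, 0 ≤ f x)
    (hC : ∀ x, f x ≤ C) : IsMildSolution (meanMechanism G k) (impulse f) (meanPath G k f) :=
  hk.isBranchingMechanism.isMildSolution_mildSolution (isSource_impulse hf h0 hC)

lemma isMeanPath_meanPath (hk : IsSubcritical G k κ) (hf : Measurable f) (h0 : ∀ x, 0 ≤ f x)
    (hC : ∀ x, f x ≤ C) : IsMeanPath G k f (meanPath G k f) :=
  have hsol := isMildSolution_meanPath hk hf h0 hC
  ⟨hsol.toIsPath, hsol.eqn⟩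

end MeanEquation

/-! ### Total mass of the mean paths -/

lemma lintegral_Ioi_comp_sub_le {b : ℝ → ℝ≥0∞} (hb : ∀ t < 0, b t = 0) (s : ℝ) :
    ∫⁻ t in Set.Ioi (0 : ℝ), b (t - s) ≤ ∫⁻ t in Set.Ioi (0 : ℝ), b t :=
  calc ∫⁻ t in Set.Ioi (0 : ℝ), b (t - s) ≤ ∫⁻ t, b (t - s) := setLIntegral_le_lintegral _ _
    _ = ∫⁻ t, b t := lintegral_sub_right_eq_self b s
    _ = ∫⁻ t in Set.Ici (0 : ℝ), b t :=
      (setLIntegral_eq_of_support_subset fun t ht => not_lt.1 fun h => ht (hb t h)).symm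
    _ = ∫⁻ t in Set.Ioi (0 : ℝ), b t := setLIntegral_congr Ioi_ae_eq_Ici.symm

section TotalMass

variable {G : Measure PosReal} [IsProbabilityMeasure G] {k f : PosReal → ℝ} {κ C : ℝ}
  {φ : ℝ → PosReal → ℝ}

lemma ofReal_duhamel_eq_lintegral (hk : IsSubcritical G k κ) (hφ : IsNonnegPath φ) (t : ℝ)
    (x : PosReal) : ENNReal.ofReal (duhamel (meanMechanism G k) φ t x) =
      ∫⁻ s in Set.Ioi (0 : ℝ),
        ENNReal.ofReal (zeroExt k (x - s)) * ENNReal.ofReal (∫ z, φ (t - s) z ∂G) := by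
  rw [duhamel, ofReal_integral_eq_lintegral_ofReal (hk.integrableOn_meanMechanism hφ.toIsPath t x)
    (ae_of_all _ fun s => hk.isBranchingMechanism.nonneg _ _ (hφ.nonneg _))]
  exact lintegral_congr fun s => ENNReal.ofReal_mul (zeroExt_nonneg hk.nonneg _)

lemma lintegral_duhamel_le (hk : IsSubcritical G k κ) (hφ : IsNonnegPath φ) (x : PosReal) :
    ∫⁻ t in Set.Ioi (0 : ℝ), ENNReal.ofReal (duhamel (meanMechanism G k) φ t x) ≤
      ENNReal.ofReal (potential k x) *
        ∫⁻ z, (∫⁻ t in Set.Ioi (0 : ℝ), ENNReal.ofReal (φ t z)) ∂G := by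
  set b : ℝ → ℝ≥0∞ := fun t => ENNReal.ofReal (∫ z, φ t z ∂G) with hb
  have hbm : Measurable b := (measurable_integral_apply hφ.measurable).ennreal_ofReal
  have hbneg : ∀ t < 0, b t = 0 := fun t ht => by simp [hb, hφ.zero_of_neg t ht]
  have hbint : ∫⁻ t in Set.Ioi (0 : ℝ), b t =
      ∫⁻ z, (∫⁻ t in Set.Ioi (0 : ℝ), ENNReal.ofReal (φ t z)) ∂G := by
    rw [lintegral_lintegral_swap (f := fun z t => ENNReal.ofReal (φ t z))
      (hφ.measurable.ennreal_ofReal.comp measurable_swap).aemeasurable]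
    exact lintegral_congr fun t =>
      ofReal_integral_eq_lintegral_ofReal (hφ.integrable t G) (ae_of_all _ (hφ.nonneg t))
  have hkm : Measurable fun s : ℝ => ENNReal.ofReal (zeroExt k (x - s)) :=
    (measurable_zeroExt_const_sub hk.measurable x).ennreal_ofReal
  simp_rw [ofReal_duhamel_eq_lintegral hk hφ]
  rw [lintegral_lintegral_swap ((hkm.comp measurable_snd).mul
      (hbm.comp (measurable_fst.sub measurable_snd))).aemeasurable,
    hk.ofReal_potential, ← lintegral_mul_const _ hkm, ← hbint]
  refine lintegral_mono fun s => ?_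
  have hbs : Measurable fun t => b (t - s) := hbm.comp (measurable_id.sub measurable_const)
  exact (lintegral_const_mul _ hbs).trans_le
    (mul_le_mul_right (lintegral_Ioi_comp_sub_le hbneg s) _)

lemma lintegral_ofReal_add_potential_mul (hk : IsSubcritical G k κ) (hC : 0 ≤ C) :
    ∫⁻ z, ENNReal.ofReal (C * z + potential k z * (C * renewalSum G k fun z => z)) ∂G =
      ENNReal.ofReal (C * renewalSum G k fun z => z) := by
  set M := renewalSum G k fun z => (z : ℝ)
  have hM0 : 0 ≤ M := hk.renewalSum_nonneg fun z => le_of_lt z.2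
  have hid := hk.integrable_coe.const_mul C
  have hpot := hk.integrable_potential.mul_const (C * M)
  have hsum : Integrable (fun z : PosReal => C * z + potential k z * (C * M)) G := hid.add hpot
  have hval : ∫ z : PosReal, (C * z + potential k z * (C * M)) ∂G = C * M := by
    rw [integral_add hid hpot, integral_const_mul, integral_mul_const]
    linear_combination (-C) * hk.renewalSum_eq_add fun z => (z : ℝ)
  rw [← ofReal_integral_eq_lintegral_ofReal hsum (ae_of_all _ fun z =>
    add_nonneg (mul_nonneg hC (le_of_lt z.2))
      (mul_nonneg (hk.potential_nonneg z) (mul_nonneg hC hM0))), hval]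

lemma lintegral_picard_le (hk : IsSubcritical G k κ) (hf : Measurable f) (h0 : ∀ x, 0 ≤ f x)
    (hC : ∀ x, f x ≤ C) (n : ℕ) (x : PosReal) :
    ∫⁻ t in Set.Ioi (0 : ℝ), ENNReal.ofReal (picard (meanMechanism G k) (impulse f) n t x) ≤
      ENNReal.ofReal (C * x + potential k x * (C * renewalSum G k fun z => z)) := by
  have hF := isSource_impulse hf h0 hC
  have hH := hk.isBranchingMechanism
  have hM : 0 ≤ C * renewalSum G k fun z => (z : ℝ) :=
    mul_nonneg hF.const_nonneg (hk.renewalSum_nonneg fun z => le_of_lt z.2)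
  induction n generalizing x with
  | zero => simp [picard]
  | succ n ih =>
    have hpath := hH.isNonnegPath_picard hF n
    have hmass := (lintegral_mono ih).trans_eq
      (lintegral_ofReal_add_potential_mul hk hF.const_nonneg)
    have hmeas : Measurable fun t => ENNReal.ofReal (impulse f t x) :=
      (hF.measurable.comp (measurable_id.prodMk measurable_const)).ennreal_ofReal
    simp only [picard, ENNReal.ofReal_add (hF.nonneg _ x) (hH.duhamel_nonneg hpath.nonneg _ x)]
    rw [lintegral_add_left hmeas, ENNReal.ofReal_add (mul_nonneg hF.const_nonneg (le_of_lt x.2))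
      (mul_nonneg (hk.potential_nonneg x) hM), ENNReal.ofReal_mul (hk.potential_nonneg x)]
    exact add_le_add (lintegral_impulse_le h0 hC x)
      ((lintegral_duhamel_le hk hpath x).trans (mul_le_mul_right hmass _))

lemma lintegral_meanPath_le (hk : IsSubcritical G k κ) (hf : Measurable f) (h0 : ∀ x, 0 ≤ f x)
    (hC : ∀ x, f x ≤ C) (x : PosReal) :
    ∫⁻ t in Set.Ioi (0 : ℝ), ENNReal.ofReal (meanPath G k f t x) ≤
      ENNReal.ofReal (C * (1 + κ * renewalSum G k fun z => z) * x) := by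
  have hF := isSource_impulse hf h0 hC
  have hH := hk.isBranchingMechanism
  have hM : 0 ≤ C * renewalSum G k fun z => (z : ℝ) :=
    mul_nonneg hF.const_nonneg (hk.renewalSum_nonneg fun z => le_of_lt z.2)
  have hlim : ∀ t, ENNReal.ofReal (meanPath G k f t x) = liminf (fun n =>
      ENNReal.ofReal (picard (meanMechanism G k) (impulse f) n t x)) atTop := fun t =>
    ((ENNReal.continuous_ofReal.tendsto _).comp (hH.tendsto_picard hF t x)).liminf_eq.symm
  simp_rw [hlim]
  refine (lintegral_liminf_le fun n => ((hH.isNonnegPath_picard hF n).measurable.comp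
    (measurable_id.prodMk measurable_const)).ennreal_ofReal).trans ?_
  refine (liminf_le_of_frequently_le'
    (.of_forall fun n => lintegral_picard_le hk hf h0 hC n x)).trans
    (ENNReal.ofReal_le_ofReal ?_)
  linarith [mul_le_mul_of_nonneg_right (hk.potential_le x) hM]

end TotalMass

/-! ### The cumulant equation -/

/-- The mechanism `α(y) [1 - g(y, ⟨G, e^{-φ}⟩)]` of the cumulant equation. -/
noncomputable def cumulantMechanism (α : PosReal → ℝ) (p : PosReal → ℕ → ℝ) (G : Measure PosReal)
    (y : ℝ) (φ : PosReal → ℝ) : ℝ :=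
  zeroExt (fun y => α y * (1 - genFun p y (∫ z, Real.exp (-φ z) ∂G))) y

/-- A birth rate `0 ≤ α ≤ a₀` and an offspring kernel with second factorial moments at most `C₂`,
whose mean rate of reproduction is at most `κ` and subcritical for the lifetime law `G`. -/
structure IsSubcriticalBranching (G : Measure PosReal) (α : PosReal → ℝ) (p : PosReal → ℕ → ℝ)
    (κ a₀ C₂ : ℝ) : Prop where
  measurable : Measurable α
  nonneg : ∀ x, 0 ≤ α x
  le : ∀ x, α x ≤ a₀
  offspring : IsOffspringKernel p
  summable_second : ∀ x, Summable fun i : ℕ => p x i * ((i : ℝ) * ((i : ℝ) - 1))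
  second_le : ∀ x, ∑' i : ℕ, p x i * ((i : ℝ) * ((i : ℝ) - 1)) ≤ C₂
  mean : IsSubcritical G (meanRate α p) κ

lemma exp_neg_le_one_sub_add_sq {z : ℝ} (hz : 0 ≤ z) : Real.exp (-z) ≤ 1 - z + z ^ 2 := by
  have hinv : Real.exp (-z) ≤ 1 / (1 + z) := by
    rw [Real.exp_neg, ← one_div]
    exact one_div_le_one_div_of_le (by linarith) (by linarith [Real.add_one_le_exp z])
  refine hinv.trans ((div_le_iff₀ (by linarith)).2 ?_)
  linarith [pow_nonneg hz 3, show (1 - z + z ^ 2) * (1 + z) = 1 + z ^ 3 by ring]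

lemma abs_genFun_sub_le {p : PosReal → ℕ → ℝ} (hp : IsOffspringKernel p) (x : PosReal) {z w : ℝ}
    (hz : z ∈ Set.Icc (0 : ℝ) 1) (hw : w ∈ Set.Icc (0 : ℝ) 1) :
    |genFun p x w - genFun p x z| ≤ genFunDeriv p x * |w - z| := by
  wlog h : z ≤ w generalizing z w
  · rw [abs_sub_comm, abs_sub_comm w]
    exact this hw hz (le_of_not_ge h)
  rw [abs_of_nonneg (sub_nonneg.2 (hp.genFun_mono x hz.1 h hw.2)), abs_of_nonneg (sub_nonneg.2 h)]
  exact hp.genFun_sub_le x hz.1 h hw.2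

section LaplaceFunctional

variable {β : Type*} [MeasurableSpace β] {ν : Measure β} {φ : β → ℝ} {C : ℝ}

lemma integrable_of_nonneg_of_le [IsFiniteMeasure ν] (hφ : Measurable φ) (h0 : ∀ x, 0 ≤ φ x)
    (hC : ∀ x, φ x ≤ C) : Integrable φ ν :=
  .of_bound hφ.aestronglyMeasurable C <| ae_of_all _ fun x => by
    rw [Real.norm_of_nonneg (h0 x)]
    exact hC x

lemma integrable_exp_neg [IsFiniteMeasure ν] (hφ : Measurable φ) (h0 : ∀ x, 0 ≤ φ x) :
    Integrable (fun z => Real.exp (-φ z)) ν :=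
  integrable_of_nonneg_of_le hφ.neg.exp (fun _ => (Real.exp_pos _).le)
    fun x => Real.exp_le_one_iff.2 (neg_nonpos.2 (h0 x))

variable [IsProbabilityMeasure ν]

lemma integral_exp_neg_mem_Icc (h0 : ∀ x, 0 ≤ φ x) :
    ∫ z, Real.exp (-φ z) ∂ν ∈ Set.Icc (0 : ℝ) 1 :=
  integral_mem_Icc_of_forall_mem (fun _ => (Real.exp_pos _).le)
    fun x => Real.exp_le_one_iff.2 (neg_nonpos.2 (h0 x))

lemma one_sub_integral_exp_neg (hφ : Measurable φ) (h0 : ∀ x, 0 ≤ φ x) :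
    1 - ∫ z, Real.exp (-φ z) ∂ν = ∫ z, (1 - Real.exp (-φ z)) ∂ν := by
  rw [integral_sub (integrable_const 1) (integrable_exp_neg hφ h0), integral_const, probReal_univ,
    one_smul]

lemma one_sub_integral_exp_neg_le (hφ : Measurable φ) (h0 : ∀ x, 0 ≤ φ x) (hC : ∀ x, φ x ≤ C) :
    1 - ∫ z, Real.exp (-φ z) ∂ν ≤ ∫ z, φ z ∂ν := by
  rw [one_sub_integral_exp_neg hφ h0]
  exact integral_mono ((integrable_const 1).sub (integrable_exp_neg hφ h0))
    (integrable_of_nonneg_of_le hφ h0 hC) fun z => by linarith [Real.add_one_le_exp (-φ z)]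

lemma le_one_sub_integral_exp_neg (hφ : Measurable φ) (h0 : ∀ x, 0 ≤ φ x) (hC : ∀ x, φ x ≤ C)
    (h2 : Integrable (fun z => φ z ^ 2) ν) :
    ∫ z, φ z ∂ν - ∫ z, φ z ^ 2 ∂ν ≤ 1 - ∫ z, Real.exp (-φ z) ∂ν := by
  have h1 := integrable_of_nonneg_of_le (ν := ν) hφ h0 hC
  rw [one_sub_integral_exp_neg hφ h0, ← integral_sub h1 h2]
  exact integral_mono (h1.sub h2) ((integrable_const 1).sub (integrable_exp_neg hφ h0))
    fun z => by linarith [exp_neg_le_one_sub_add_sq (h0 z)]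

lemma sq_integral_le (h1 : Integrable φ ν) (h2 : Integrable (fun z => φ z ^ 2) ν) :
    (∫ z, φ z ∂ν) ^ 2 ≤ ∫ z, φ z ^ 2 ∂ν :=
  even_two.convexOn_pow.map_integral_le (continuous_pow 2).continuousOn isClosed_univ
    (ae_of_all _ fun _ => Set.mem_univ _) h1 h2

lemma tendsto_integral_exp_neg {φ : ℕ → β → ℝ} {ψ : β → ℝ} (hφ : ∀ n, Measurable (φ n))
    (h0 : ∀ n x, 0 ≤ φ n x) (hlim : ∀ x, Tendsto (fun n => φ n x) atTop (𝓝 (ψ x))) :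
    Tendsto (fun n => ∫ z, Real.exp (-φ n z) ∂ν) atTop (𝓝 (∫ z, Real.exp (-ψ z) ∂ν)) := by
  refine tendsto_integral_of_dominated_convergence (fun _ => 1)
    (fun n => (hφ n).neg.exp.aestronglyMeasurable) (integrable_const _)
    (fun n => ae_of_all _ fun x => ?_)
    (ae_of_all _ fun x => (Real.continuous_exp.tendsto _).comp (hlim x).neg)
  rw [Real.norm_of_nonneg (Real.exp_pos _).le]
  exact Real.exp_le_one_iff.2 (neg_nonpos.2 (h0 n x))

end LaplaceFunctional

lemma measurable_integral_exp_neg {G : Measure PosReal} [SFinite G] {φ : ℝ → PosReal → ℝ}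
    (hφ : Measurable (Function.uncurry φ)) : Measurable fun t => ∫ z, Real.exp (-φ t z) ∂G :=
  measurable_integral_apply (φ := fun t z => Real.exp (-φ t z)) hφ.neg.exp

namespace IsSubcriticalBranching

variable {G : Measure PosReal} {α : PosReal → ℝ} {p : PosReal → ℕ → ℝ} {κ a₀ C₂ : ℝ}

lemma second_nonneg (hD : IsSubcriticalBranching G α p κ a₀ C₂) : 0 ≤ C₂ :=
  le_trans (tsum_nonneg fun i => mul_nonneg (hD.offspring.nonneg _ i) <| by
    rcases i.eq_zero_or_pos with rfl | hi
    · simp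
    · exact mul_nonneg i.cast_nonneg (sub_nonneg.2 (Nat.one_le_cast.2 hi)))
    (hD.second_le ⟨1, Set.mem_Ioi.2 one_pos⟩)

lemma errorConst_nonneg (hD : IsSubcriticalBranching G α p κ a₀ C₂) : 0 ≤ κ + a₀ * C₂ :=
  add_nonneg hD.mean.const_nonneg <| mul_nonneg
    ((hD.nonneg ⟨1, Set.mem_Ioi.2 one_pos⟩).trans (hD.le _)) hD.second_nonneg

variable [IsProbabilityMeasure G]

lemma cumulantMechanism_le_meanMechanism (hD : IsSubcriticalBranching G α p κ a₀ C₂)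
    {φ : PosReal → ℝ} {C : ℝ} (hφ : Measurable φ) (h0 : ∀ x, 0 ≤ φ x) (hC : ∀ x, φ x ≤ C) (y : ℝ) :
    cumulantMechanism α p G y φ ≤ meanMechanism G (meanRate α p) y φ := by
  rw [meanMechanism, ← zeroExt_mul_const]
  refine zeroExt_mono (fun x => ?_) y
  have hmem := integral_exp_neg_mem_Icc (ν := G) h0
  rw [meanRate, mul_assoc]
  refine mul_le_mul_of_nonneg_left ?_ (hD.nonneg x)
  calc 1 - genFun p x (∫ z, Real.exp (-φ z) ∂G)
      ≤ genFunDeriv p x * (1 - ∫ z, Real.exp (-φ z) ∂G) := by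
        simpa only [hD.offspring.genFun_one] using hD.offspring.genFun_sub_le x hmem.1 hmem.2 le_rfl
    _ ≤ genFunDeriv p x * ∫ z, φ z ∂G :=
        mul_le_mul_of_nonneg_left (one_sub_integral_exp_neg_le hφ h0 hC)
          (hD.offspring.genFunDeriv_nonneg x)

lemma isBranchingMechanism (hD : IsSubcriticalBranching G α p κ a₀ C₂) :
    IsBranchingMechanism κ (cumulantMechanism α p G) where
  zero_of_nonpos y hy φ := zeroExt_of_nonpos _ hy
  nonneg y φ h :=
    have hmem := integral_exp_neg_mem_Icc (ν := G) h
    zeroExt_nonneg (fun x => mul_nonneg (hD.nonneg x) <| sub_nonneg.2 <|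
      hD.offspring.genFun_le_one x hmem.1 hmem.2) y
  mono y φ ψ hφ hψ h0 hle _ := by
    have h0' : ∀ x, 0 ≤ ψ x := fun x => (h0 x).trans (hle x)
    refine zeroExt_mono (fun x => mul_le_mul_of_nonneg_left (sub_le_sub_left ?_ 1) (hD.nonneg x)) y
    exact hD.offspring.genFun_mono x (integral_exp_neg_mem_Icc h0').1
      (integral_mono (integrable_exp_neg hψ h0') (integrable_exp_neg hφ h0)
        fun z => Real.exp_le_exp.2 (neg_le_neg (hle z))) (integral_exp_neg_mem_Icc h0).2
  le y φ C hφ h0 hC := (hD.cumulantMechanism_le_meanMechanism hφ h0 hC y).trans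
    (hD.mean.isBranchingMechanism.le y φ C hφ h0 hC)
  tendsto y φ ψ C hφ h0 _ hlim := by
    rcases lt_or_ge 0 y with hy | hy
    · simp only [cumulantMechanism, zeroExt_of_pos _ hy]
      refine Tendsto.const_mul _ (Tendsto.const_sub _ ?_)
      have hexp := tendsto_integral_exp_neg (ν := G) hφ h0 hlim
      have hlimit := integral_exp_neg_mem_Icc (ν := G)
        fun x => ge_of_tendsto' (hlim x) fun n => h0 n x
      rw [tendsto_iff_dist_tendsto_zero] at hexp ⊢
      exact squeeze_zero (fun _ => dist_nonneg)
        (fun n => abs_genFun_sub_le hD.offspring ⟨y, hy⟩ hlimit (integral_exp_neg_mem_Icc (h0 n)))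
        (by simpa only [mul_zero, Real.dist_eq] using hexp.const_mul (genFunDeriv p ⟨y, hy⟩))
    · simp only [cumulantMechanism, zeroExt_of_nonpos _ hy]
      exact tendsto_const_nhds
  measurable φ hφ h0 := by
    have hrate : Measurable (Function.uncurry fun (t : ℝ) (y : PosReal) =>
        α y * (1 - genFun p y (∫ z, Real.exp (-φ t z) ∂G))) :=
      (hD.measurable.comp measurable_snd).mul <| measurable_const.sub <|
        hD.offspring.measurable_genFun measurable_snd
          ((measurable_integral_exp_neg hφ).comp measurable_fst)
          (fun q => (integral_exp_neg_mem_Icc (h0 q.1)).1)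
          (fun q => (integral_exp_neg_mem_Icc (h0 q.1)).2)
    exact (measurable_zeroExt_uncurry hrate).comp measurable_swap

lemma meanMechanism_sub_le_cumulantMechanism (hD : IsSubcriticalBranching G α p κ a₀ C₂)
    {φ : PosReal → ℝ} {C : ℝ} (hφ : Measurable φ) (h0 : ∀ x, 0 ≤ φ x) (hC : ∀ x, φ x ≤ C) (y : ℝ) :
    meanMechanism G (meanRate α p) y φ -
      zeroExt (fun _ => (κ + a₀ * C₂) * ∫ z, φ z ^ 2 ∂G) y ≤ cumulantMechanism α p G y φ := by
  rw [meanMechanism, ← zeroExt_mul_const, ← zeroExt_sub]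
  refine zeroExt_mono (fun x => ?_) y
  have hint : Integrable φ G := integrable_of_nonneg_of_le hφ h0 hC
  have hsq : Integrable (fun z => φ z ^ 2) G := integrable_of_nonneg_of_le (hφ.pow_const 2)
    (fun _ => sq_nonneg _) fun z => pow_le_pow_left₀ (h0 z) (hC z) 2
  have hS : 0 ≤ ∫ z, φ z ^ 2 ∂G := integral_nonneg fun z => sq_nonneg _
  obtain ⟨q, hq⟩ : ∃ q, q = 1 - ∫ z, Real.exp (-φ z) ∂G := ⟨_, rfl⟩
  have hmem := integral_exp_neg_mem_Icc (ν := G) h0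
  have hq0 : 0 ≤ q := by linarith [hmem.2]
  have hq1 : q ≤ 1 := by linarith [hmem.1]
  have hqge : ∫ z, φ z ∂G - ∫ z, φ z ^ 2 ∂G ≤ q := hq ▸ le_one_sub_integral_exp_neg hφ h0 hC hsq
  have hqsq : q ^ 2 ≤ ∫ z, φ z ^ 2 ∂G :=
    (pow_le_pow_left₀ hq0 (hq ▸ one_sub_integral_exp_neg_le hφ h0 hC) 2).trans
      (sq_integral_le hint hsq)
  have hgen := hD.offspring.le_one_sub_genFun (hD.summable_second x) hq0 hq1
  rw [show ∫ z, Real.exp (-φ z) ∂G = 1 - q by rw [hq]; ring]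
  have hrate : meanRate α p x + α x * C₂ ≤ κ + a₀ * C₂ :=
    add_le_add (hD.mean.le x) (mul_le_mul_of_nonneg_right (hD.le x) hD.second_nonneg)
  calc meanRate α p x * (∫ z, φ z ∂G) - (κ + a₀ * C₂) * ∫ z, φ z ^ 2 ∂G
      ≤ meanRate α p x * (∫ z, φ z ∂G - ∫ z, φ z ^ 2 ∂G) - α x * C₂ * ∫ z, φ z ^ 2 ∂G := by
        linarith [mul_le_mul_of_nonneg_right hrate hS]
    _ ≤ meanRate α p x * q - α x * C₂ * q ^ 2 :=
        sub_le_sub (mul_le_mul_of_nonneg_left hqge (hD.mean.nonneg x))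
          (mul_le_mul_of_nonneg_left hqsq (mul_nonneg (hD.nonneg x) hD.second_nonneg))
    _ = α x * (genFunDeriv p x * q - C₂ * q ^ 2) := by rw [meanRate]; ring
    _ ≤ α x * (1 - genFun p x (1 - q)) := mul_le_mul_of_nonneg_left
        (by linarith [mul_le_mul_of_nonneg_right (hD.second_le x) (sq_nonneg q)]) (hD.nonneg x)

lemma isCumulant_restart (hD : IsSubcriticalBranching G α p κ a₀ C₂) {F U : ℝ → PosReal → ℝ}
    (hU : IsMildSolution (cumulantMechanism α p G) F U) {τ : ℝ}
    (hF : ∀ t, 0 ≤ t → ∀ x : PosReal, F (τ + t) x = zeroExt (F τ) (x - t)) :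
    IsCumulant α p G (U τ) (fun t => U (τ + t)) where
  measurable := hU.measurable.comp
    ((measurable_const.add (measurable_subtype_coe.comp measurable_fst)).prodMk measurable_snd)
  nonneg t x := hU.nonneg _ x
  locBdd T := (hU.toIsNonnegPath.exists_le (τ + T)).imp fun C hC t ht x =>
    hC _ (add_le_add le_rfl (NNReal.coe_le_coe.2 ht)) x
  eqn t x := by
    rw [hU.restart hD.isBranchingMechanism hF t.coe_nonneg x]
    congr 1
    refine intervalIntegral.integral_congr fun s hs => ?_
    rw [Set.uIcc_of_le t.coe_nonneg] at hs
    simp only [cumulantMechanism, sub_toNNReal t hs.1, Real.coe_toNNReal _ (sub_nonneg.2 hs.2),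
      add_sub_assoc]

end IsSubcriticalBranching

/-! ### Trains of impulses -/

/-- Impulses `h` released at the times `0, 1, …, m`: the source of the cumulant equation whose
solution encodes the joint Laplace transform at these times. -/
noncomputable def train (h : PosReal → ℝ) (m : ℕ) (t : ℝ) (x : PosReal) : ℝ :=
  ∑ i ∈ Finset.range (m + 1), impulse h (t - i) x

/-- The solution of the cumulant equation driven by impulses `h` at the times `0, 1, …, m`. -/
noncomputable def trainCumulant (α : PosReal → ℝ) (p : PosReal → ℕ → ℝ) (G : Measure PosReal)
    (h : PosReal → ℝ) (m : ℕ) : ℝ → PosReal → ℝ :=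
  mildSolution (cumulantMechanism α p G) (train h m)

/-- The solution of the mean equation driven by impulses `f` at the times `0, 1, …, m`, which by
linearity is a superposition of mean paths. -/
noncomputable def trainMean (G : Measure PosReal) (k f : PosReal → ℝ) (m : ℕ) (t : ℝ)
    (x : PosReal) : ℝ :=
  ∑ i ∈ Finset.range (m + 1), meanPath G k f (t - i) x

section Train

variable {h : PosReal → ℝ} {C : ℝ}

lemma card_le_of_forall_mem_Ioc {S : Finset ℕ} {a b : ℝ} (hab : a ≤ b)
    (hS : ∀ i ∈ S, (i : ℝ) ∈ Set.Ioc a b) : (S.card : ℝ) ≤ b - a + 1 := by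
  have hsub : S.map Nat.castEmbedding ⊆ Finset.Ioc ⌊a⌋ ⌊b⌋ := by
    intro j hj
    obtain ⟨i, hi, rfl⟩ := Finset.mem_map.1 hj
    exact Finset.mem_Ioc.2 ⟨Int.floor_lt.2 (by exact_mod_cast (hS i hi).1),
      Int.le_floor.2 (by exact_mod_cast (hS i hi).2)⟩
  have hcard := Finset.card_le_card hsub
  rw [Finset.card_map, Int.card_Ioc] at hcard
  have hfloor : (S.card : ℤ) ≤ ⌊b⌋ - ⌊a⌋ := by
    have := Int.floor_mono hab
    omega
  have hreal : (S.card : ℝ) ≤ (⌊b⌋ : ℝ) - ⌊a⌋ := by exact_mod_cast hfloor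
  linarith [Int.floor_le b, Int.lt_floor_add_one a]

lemma impulse_le_indicator (h0 : ∀ x, 0 ≤ h x) (hC : ∀ x, h x ≤ C) (t : ℝ) (x : PosReal) :
    impulse h t x ≤ (Set.Ico 0 (x : ℝ)).indicator (fun _ => C) t := by
  have hC0 : 0 ≤ C := (h0 x).trans (hC x)
  rcases lt_or_ge t 0 with ht | ht
  · rw [impulse_of_neg h ht]
    exact Set.indicator_nonneg (fun _ _ => hC0) _
  · rw [impulse_of_nonneg h ht]
    exact (le_abs_self _).trans <| abs_zeroExt_sub_le_indicator
      (fun x => (abs_of_nonneg (h0 x)).trans_le (hC x)) x ht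

lemma train_le (h0 : ∀ x, 0 ≤ h x) (hC : ∀ x, h x ≤ C) (m : ℕ) (t : ℝ) (x : PosReal) :
    train h m t x ≤ C * (x + 1) := by
  classical
  set S := (Finset.range (m + 1)).filter fun i : ℕ => t - i ∈ Set.Ico 0 (x : ℝ)
  have hcard : (S.card : ℝ) ≤ t - (t - x) + 1 :=
    card_le_of_forall_mem_Ioc (by linarith [x.2.out]) fun i hi => by
      have hi := (Finset.mem_filter.1 hi).2
      exact ⟨by linarith [hi.2], by linarith [hi.1]⟩
  calc train h m t x
      ≤ ∑ i ∈ Finset.range (m + 1), (Set.Ico 0 (x : ℝ)).indicator (fun _ => C) (t - i) :=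
        Finset.sum_le_sum fun i _ => impulse_le_indicator h0 hC (t - i) x
    _ = S.card * C := by
        simp only [Set.indicator_apply, ← Finset.sum_filter, Finset.sum_const, nsmul_eq_mul, S]
    _ ≤ C * (x + 1) := by
        rw [mul_comm]
        exact mul_le_mul_of_nonneg_left (by linarith) ((h0 x).trans (hC x))

lemma isSource_train (hm : Measurable h) (h0 : ∀ x, 0 ≤ h x) (hC : ∀ x, h x ≤ C) (m : ℕ) :
    IsSource (train h m) ((m + 1) * C) where
  measurable := Finset.measurable_sum (Finset.range (m + 1)) fun i _ =>
    (isSource_impulse hm h0 hC).measurable.comp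
      ((measurable_fst.sub (measurable_const (a := (i : ℝ)))).prodMk measurable_snd)
  nonneg t x := Finset.sum_nonneg fun i _ => (isSource_impulse hm h0 hC).nonneg _ _
  zero_of_neg t ht x := Finset.sum_eq_zero fun i _ =>
    impulse_of_neg h (by linarith [(i.cast_nonneg : (0 : ℝ) ≤ i)]) x
  le t x := (Finset.sum_le_card_nsmul _ _ C fun i _ => (isSource_impulse hm h0 hC).le _ _).trans_eq
    (by simp)

lemma train_add_eq_zeroExt (h : PosReal → ℝ) (m : ℕ) (t : ℝ) (ht : 0 ≤ t) (x : PosReal) :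
    train h m (m + t) x = zeroExt (train h m m) (x - t) := by
  have hle : ∀ i ∈ Finset.range (m + 1), (i : ℝ) ≤ m := fun i hi => by
    exact_mod_cast Nat.lt_succ_iff.1 (Finset.mem_range.1 hi)
  rcases lt_or_ge 0 ((x : ℝ) - t) with hx | hx
  · rw [zeroExt_of_pos _ hx]
    refine Finset.sum_congr rfl fun i hi => ?_
    rw [impulse_of_nonneg h (by linarith [hle i hi]),
      impulse_of_nonneg h (sub_nonneg.2 (hle i hi))]
    congr 1
    simp only
    ring
  · rw [zeroExt_of_nonpos _ hx]
    refine Finset.sum_eq_zero fun i hi => ?_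
    rw [impulse_of_nonneg h (by linarith [hle i hi]),
      zeroExt_of_nonpos _ (by linarith [hle i hi])]

lemma train_zero (h : PosReal → ℝ) (t : ℝ) (x : PosReal) : train h 0 t x = impulse h t x := by
  simp [train]

lemma train_succ (h : PosReal → ℝ) (m : ℕ) (t : ℝ) (x : PosReal) :
    train h (m + 1) t x = train h m t x + impulse h (t - (m + 1 : ℕ)) x :=
  Finset.sum_range_succ _ _

lemma train_const_mul (h : PosReal → ℝ) (c : ℝ) (m : ℕ) (t : ℝ) (x : PosReal) :
    train (fun z => c * h z) m t x = c * train h m t x := by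
  rw [train, train, Finset.mul_sum]
  refine Finset.sum_congr rfl fun i _ => ?_
  simp only [impulse, zeroExt_const_mul, mul_ite, mul_zero]

end Train

section TrainMean

variable {G : Measure PosReal} [IsProbabilityMeasure G] {k f : PosReal → ℝ} {κ C : ℝ}

lemma isMildSolution_trainMean (hk : IsSubcritical G k κ) (hf : Measurable f) (h0 : ∀ x, 0 ≤ f x)
    (hC : ∀ x, f x ≤ C) (m : ℕ) :
    IsMildSolution (meanMechanism G k) (train f m) (trainMean G k f m) := by
  have hπ := isMildSolution_meanPath hk hf h0 hC
  have hshift : ∀ i : ℕ, IsPath fun t x => meanPath G k f (t - i) x := fun i =>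
    hπ.toIsPath.shift i.cast_nonneg
  refine ⟨⟨IsPath.finset_sum _ hshift, fun t x => Finset.sum_nonneg fun i _ => hπ.nonneg _ _⟩,
    fun t x => ?_⟩
  change _ = _ + duhamel _ (fun t x => ∑ i ∈ Finset.range (m + 1), meanPath G k f (t - i) x) t x
  rw [hk.duhamel_finset_sum _ hshift, train, ← Finset.sum_add_distrib]
  refine Finset.sum_congr rfl fun i _ => ?_
  rw [duhamel_shift, hπ.eqn]

end TrainMean

lemma IsSubcritical.integrable_add_one_sq {G : Measure PosReal} [IsFiniteMeasure G]
    {k : PosReal → ℝ} {κ : ℝ} (hk : IsSubcritical G k κ) :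
    Integrable (fun z : PosReal => ((z : ℝ) + 1) ^ 2) G := by
  simp only [add_sq, mul_one, one_pow]
  exact (hk.sq_integrable.add (hk.integrable_coe.const_mul 2)).add (integrable_const 1)

namespace IsSubcriticalBranching

variable {G : Measure PosReal} [IsProbabilityMeasure G] {α : PosReal → ℝ} {p : PosReal → ℕ → ℝ}
  {κ a₀ C₂ : ℝ} {h f : PosReal → ℝ} {C : ℝ} {U : ℝ → PosReal → ℝ}

lemma isMildSolution_trainCumulant (hD : IsSubcriticalBranching G α p κ a₀ C₂) (hm : Measurable h)
    (h0 : ∀ x, 0 ≤ h x) (hC : ∀ x, h x ≤ C) (m : ℕ) :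
    IsMildSolution (cumulantMechanism α p G) (train h m) (trainCumulant α p G h m) :=
  hD.isBranchingMechanism.isMildSolution_mildSolution (isSource_train hm h0 hC m)

lemma isCumulant_trainCumulant (hD : IsSubcriticalBranching G α p κ a₀ C₂) (hm : Measurable h)
    (h0 : ∀ x, 0 ≤ h x) (hC : ∀ x, h x ≤ C) (m : ℕ) :
    IsCumulant α p G (trainCumulant α p G h m m) fun t => trainCumulant α p G h m (m + t) :=
  hD.isCumulant_restart (hD.isMildSolution_trainCumulant hm h0 hC m) (train_add_eq_zeroExt h m)

lemma trainCumulant_zero (hD : IsSubcriticalBranching G α p κ a₀ C₂) (hm : Measurable h)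
    (h0 : ∀ x, 0 ≤ h x) (hC : ∀ x, h x ≤ C) (x : PosReal) :
    trainCumulant α p G h 0 0 x = h x := by
  have hU := hD.isMildSolution_trainCumulant hm h0 hC 0
  have hduhamel : duhamel (cumulantMechanism α p G) (trainCumulant α p G h 0) 0 x = 0 :=
    setIntegral_eq_zero_of_forall_eq_zero fun s (hs : 0 < s) =>
      hD.isBranchingMechanism.map_eq_zero hU.toIsPath (by linarith) _
  rw [hU.eqn, hduhamel, train_zero, impulse_of_nonneg h le_rfl, add_zero, sub_zero,
    zeroExt_of_pos _ x.2]

lemma trainCumulant_succ (hD : IsSubcriticalBranching G α p κ a₀ C₂) (hm : Measurable h)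
    (h0 : ∀ x, 0 ≤ h x) (hC : ∀ x, h x ≤ C) (m : ℕ) (x : PosReal) :
    trainCumulant α p G h (m + 1) (m + 1 : ℕ) x =
      h x + trainCumulant α p G h m (m + 1 : ℕ) x := by
  have hpast : ∀ t < ((m + 1 : ℕ) : ℝ), train h (m + 1) t = train h m t := fun t ht =>
    funext fun x => by rw [train_succ, impulse_of_neg h (sub_neg.2 ht), add_zero]
  have hduhamel := duhamel_congr (H := cumulantMechanism α p G) (t := ((m + 1 : ℕ) : ℝ))
    (φ := trainCumulant α p G h (m + 1)) (ψ := trainCumulant α p G h m)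
    (fun r hr => mildSolution_congr hpast hr) x
  rw [(hD.isMildSolution_trainCumulant hm h0 hC (m + 1)).eqn,
    (hD.isMildSolution_trainCumulant hm h0 hC m).eqn, hduhamel, train_succ,
    impulse_of_nonneg h (sub_self _).ge, sub_self, sub_zero, zeroExt_of_pos _ x.2]
  ring

lemma duhamel_cumulantMechanism_le (hD : IsSubcriticalBranching G α p κ a₀ C₂)
    (hU : IsNonnegPath U) (t : ℝ) (x : PosReal) :
    duhamel (cumulantMechanism α p G) U t x ≤ duhamel (meanMechanism G (meanRate α p)) U t x := by
  refine integral_mono (hD.isBranchingMechanism.integrableOn hU t x)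
    (hD.mean.integrableOn_meanMechanism hU.toIsPath t x) fun s => ?_
  obtain ⟨B, hB⟩ := hU.exists_le (t - s)
  exact hD.cumulantMechanism_le_meanMechanism (hU.measurable_apply _) (hU.nonneg _) (hB _ le_rfl) _

lemma le_duhamel_cumulantMechanism (hD : IsSubcriticalBranching G α p κ a₀ C₂)
    (hU : IsNonnegPath U) {S : ℝ} (hS : ∀ t, ∫ z, U t z ^ 2 ∂G ≤ S) (t : ℝ) (x : PosReal) :
    duhamel (meanMechanism G (meanRate α p)) U t x - (κ + a₀ * C₂) * S * x ≤
      duhamel (cumulantMechanism α p G) U t x := by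
  have hmean := hD.mean.integrableOn_meanMechanism hU.toIsPath t x
  have herror := integrableOn_Ioi_indicator_Ico_const (x : ℝ) ((κ + a₀ * C₂) * S)
  rw [← setIntegral_Ioi_indicator_Ico_const (le_of_lt x.2) ((κ + a₀ * C₂) * S), duhamel, duhamel,
    ← integral_sub hmean herror]
  refine setIntegral_mono_on (hmean.sub herror) (hD.isBranchingMechanism.integrableOn hU t x)
    measurableSet_Ioi fun s (hs : 0 < s) => ?_
  obtain ⟨B, hB⟩ := hU.exists_le (t - s)
  have hlower := hD.meanMechanism_sub_le_cumulantMechanism (hU.measurable_apply (t - s))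
    (hU.nonneg _) (hB _ le_rfl) (x - s)
  have hle := (le_abs_self _).trans <| abs_zeroExt_sub_le_indicator
    (h := fun _ : PosReal => (κ + a₀ * C₂) * ∫ z, U (t - s) z ^ 2 ∂G)
    (C := (κ + a₀ * C₂) * S) (fun _ => by
      rw [abs_of_nonneg (mul_nonneg hD.errorConst_nonneg (integral_nonneg fun z => sq_nonneg _))]
      exact mul_le_mul_of_nonneg_left (hS (t - s)) hD.errorConst_nonneg) (x : ℝ) hs.le
  linarith

lemma trainCumulant_le (hD : IsSubcriticalBranching G α p κ a₀ C₂) (hm : Measurable h)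
    (h0 : ∀ x, 0 ≤ h x) (hC : ∀ x, h x ≤ C) (m : ℕ) (t : ℝ) (x : PosReal) :
    trainCumulant α p G h m t x ≤
      C * ((1 + κ * renewalSum G (meanRate α p) fun z => z + 1) * (x + 1)) := by
  have hU := hD.isMildSolution_trainCumulant hm h0 hC m
  refine hD.mean.le_mul_of_le_add_duhamel hU.toIsPath
    (hD.mean.integrable_coe.add (integrable_const 1)) (fun z => by simp) ((h0 x).trans (hC x))
    (fun t _ x => ?_) t x
  rw [hU.eqn]
  exact add_le_add (train_le h0 hC m t x) (hD.duhamel_cumulantMechanism_le hU.toIsNonnegPath t x)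

lemma trainCumulant_le_trainMean (hD : IsSubcriticalBranching G α p κ a₀ C₂) (hm : Measurable h)
    (h0 : ∀ x, 0 ≤ h x) (hC : ∀ x, h x ≤ C) (m : ℕ) (t : ℝ) (x : PosReal) :
    trainCumulant α p G h m t x ≤ trainMean G (meanRate α p) h m t x := by
  have hU := hD.isMildSolution_trainCumulant hm h0 hC m
  have hV := isMildSolution_trainMean hD.mean hm h0 hC m
  refine sub_nonpos.1 (hD.mean.nonpos_of_le_duhamel (hU.toIsPath.sub hV.toIsPath)
    (fun t _ x => ?_) t x)
  rw [hD.mean.duhamel_sub hU.toIsPath hV.toIsPath, hU.eqn t x, hV.eqn t x]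
  linarith [hD.duhamel_cumulantMechanism_le hU.toIsNonnegPath t x]

lemma integral_trainCumulant_sq_le (hD : IsSubcriticalBranching G α p κ a₀ C₂) (hm : Measurable h)
    (h0 : ∀ x, 0 ≤ h x) (hC : ∀ x, h x ≤ C) (m : ℕ) (t : ℝ) :
    ∫ z, trainCumulant α p G h m t z ^ 2 ∂G ≤
      C ^ 2 * ∫ z : PosReal,
        ((1 + κ * renewalSum G (meanRate α p) fun z => z + 1) * ((z : ℝ) + 1)) ^ 2 ∂G := by
  rw [← integral_const_mul]
  refine integral_mono_of_nonneg (ae_of_all _ fun z => sq_nonneg _) ?_ (ae_of_all _ fun z => ?_)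
  · simp only [mul_pow]
    exact (hD.mean.integrable_add_one_sq.const_mul _).const_mul _
  · simp only [← mul_pow]
    exact pow_le_pow_left₀ ((hD.isMildSolution_trainCumulant hm h0 hC m).nonneg t z)
      (hD.trainCumulant_le hm h0 hC m t z) 2

/-- The cumulant mechanism and its linearisation differ by a quadratic term, so the cumulant driven
by small impulses is close to the solution of the mean equation. -/
lemma exists_trainMean_sub_le_trainCumulant (hD : IsSubcriticalBranching G α p κ a₀ C₂)
    (hm : Measurable f) (h0 : ∀ x, 0 ≤ f x) (hC : ∀ x, f x ≤ C) :
    ∃ B : ℝ, 0 ≤ B ∧ ∀ ε : ℝ, 0 ≤ ε → ∀ (m : ℕ) (t : ℝ) (x : PosReal),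
      ε * trainMean G (meanRate α p) f m t x - ε ^ 2 * (B * x) ≤
        trainCumulant α p G (fun z => ε * f z) m t x := by
  have hk := hD.mean
  set S := ∫ z : PosReal,
    ((1 + κ * renewalSum G (meanRate α p) fun z => z + 1) * ((z : ℝ) + 1)) ^ 2 ∂G
  set E := (κ + a₀ * C₂) * (C ^ 2 * S)
  have hE : 0 ≤ E := mul_nonneg hD.errorConst_nonneg
    (mul_nonneg (sq_nonneg C) (integral_nonneg fun _ => sq_nonneg _))
  have hM : 0 ≤ renewalSum G (meanRate α p) fun z => z :=
    hk.renewalSum_nonneg fun z => le_of_lt z.2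
  refine ⟨E * (1 + κ * renewalSum G (meanRate α p) fun z => z), mul_nonneg hE
    (add_nonneg zero_le_one (mul_nonneg hk.const_nonneg hM)), fun ε hε m t x => ?_⟩
  have hmε := hm.const_mul ε
  have h0ε : ∀ z, 0 ≤ ε * f z := fun z => mul_nonneg hε (h0 z)
  have hCε : ∀ z, ε * f z ≤ ε * C := fun z => mul_le_mul_of_nonneg_left (hC z) hε
  have hU := hD.isMildSolution_trainCumulant hmε h0ε hCε m
  have hV := isMildSolution_trainMean hk hm h0 hC m
  have hVε := hV.toIsPath.const_mul ε
  have hdiff := hk.le_mul_of_le_add_duhamel (hVε.sub hU.toIsPath) hk.integrable_coe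
    (fun _ => le_rfl) (mul_nonneg (sq_nonneg ε) hE) (fun t _ x => ?_) t x
  · linarith
  · rw [hk.duhamel_sub hVε hU.toIsPath, duhamel_meanMechanism_const_mul, hV.eqn t x, hU.eqn t x,
      train_const_mul]
    have hlower := hD.le_duhamel_cumulantMechanism hU.toIsNonnegPath
      (hD.integral_trainCumulant_sq_le hmε h0ε hCε m) t x
    have herror : (κ + a₀ * C₂) * ((ε * C) ^ 2 * S) * x = ε ^ 2 * E * x := by simp only [E]; ring
    rw [herror] at hlower
    linarith

end IsSubcriticalBranching

/-! ### Counting measures -/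

/-- The tautological kernel `ν ↦ ν`. -/
noncomputable def countKernel : Kernel CountMeas PosReal where
  toFun := CountMeas.toMeas
  measurable' := measurable_subtype_coe.comp measurable_subtype_coe

/-- The intensity `B ↦ ∫ ν(B) L(dν)` of the immigration, so that a nonnegative `f` has
`∫ ⟨ν, f⟩ L(dν) = ∫ f d(intensity L)`. -/
noncomputable def intensity (L : Measure CountMeas) : Measure PosReal := countKernel ∘ₘ L

instance CountMeas.isFiniteMeasure_toMeas (ν : CountMeas) : IsFiniteMeasure ν.toMeas :=
  ν.1.isFiniteMeasure

lemma measurable_toMeas : Measurable CountMeas.toMeas := countKernel.measurable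

/-- The total mass takes only the countably many values `0, 1, 2, …`, on each of which the kernel
is finite. -/
instance isSFiniteKernel_countKernel : IsSFiniteKernel countKernel := by
  classical
  have hs : ∀ n : ℕ, MeasurableSet {ν : CountMeas | ν.toMeas Set.univ = n} := fun n =>
    (measurableSet_singleton (n : ℝ≥0∞)).preimage
      ((Measure.measurable_coe MeasurableSet.univ).comp measurable_toMeas)
  refine ⟨⟨fun n => Kernel.piecewise (hs n) countKernel 0, fun n => ?_, ?_⟩⟩
  · refine ⟨⟨n, ENNReal.natCast_lt_top n, fun ν => ?_⟩⟩
    rw [Kernel.piecewise_apply]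
    split_ifs with h
    · exact le_of_eq h
    · simp
  · ext ν s hsm
    obtain ⟨n, hn⟩ := ν.2 Set.univ MeasurableSet.univ
    have hn' : ν.toMeas Set.univ = n := hn
    rw [Kernel.sum_apply' _ _ hsm, tsum_eq_single n]
    · simp [Kernel.piecewise_apply, hn']
    · intro m hm
      rw [Kernel.piecewise_apply, if_neg]
      · simp
      · simp only [Set.mem_ofPred_eq, hn', Nat.cast_inj]
        exact fun h => hm h.symm

section Pairing

variable {f : PosReal → ℝ}

lemma measurable_pairing_uncurry {β : Type*} [MeasurableSpace β] {h : β → PosReal → ℝ}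
    (hh : Measurable (Function.uncurry h)) :
    Measurable fun q : β × CountMeas => pairing q.2 (h q.1) := by
  have h1 : Measurable (Function.uncurry fun (q : β × CountMeas) (x : PosReal) => h q.1 x) :=
    hh.comp ((measurable_fst.comp measurable_fst).prodMk measurable_snd)
  exact (h1.stronglyMeasurable.integral_kernel_prod_right
    (κ := countKernel.comap Prod.snd measurable_snd)).measurable

lemma measurable_pairing (hf : Measurable f) : Measurable fun ν => pairing ν f :=
  (hf.stronglyMeasurable.integral_kernel (κ := countKernel)).measurable

lemma pairing_nonneg (ν : CountMeas) (h0 : ∀ x, 0 ≤ f x) : 0 ≤ pairing ν f :=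
  integral_nonneg h0

end Pairing

section Intensity

variable {L : Measure CountMeas} {f : PosReal → ℝ}

lemma lintegral_intensity {h : PosReal → ℝ≥0∞} (hh : Measurable h) :
    ∫⁻ x, h x ∂intensity L = ∫⁻ ν, ∫⁻ x, h x ∂ν.toMeas ∂L :=
  Measure.lintegral_bind countKernel.aemeasurable hh.aemeasurable

lemma ae_integrable_of_integrable_intensity (hf : Integrable f (intensity L)) :
    ∀ᵐ ν ∂L, Integrable f ν.toMeas :=
  Measure.ae_integrable_of_integrable_comp hf

lemma integrable_pairing (hf : Integrable f (intensity L)) :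
    Integrable (fun ν => pairing ν f) L :=
  Integrable.integral_comp (κ := Kernel.const Unit L) (η := countKernel) (a := ())
    (by rwa [← Measure.comp_eq_comp_const_apply])

lemma integral_pairing (hf : Integrable f (intensity L)) :
    ∫ ν, pairing ν f ∂L = ∫ x, f x ∂intensity L := by
  rw [intensity, Measure.comp_eq_comp_const_apply] at *
  exact (Kernel.integral_comp hf).symm

end Intensity

/-- The masses of `(n, ∞)` decrease to `0` through the integers. -/
lemma CountMeas.exists_measure_Ioi_eq_zero (ν : CountMeas) :
    ∃ n : ℕ, ν.toMeas {x : PosReal | (n : ℝ) < x} = 0 := by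
  have hms : ∀ n : ℕ, MeasurableSet {x : PosReal | (n : ℝ) < x} := fun n =>
    measurableSet_lt measurable_const measurable_subtype_coe
  have hempty : ⋂ n : ℕ, {x : PosReal | (n : ℝ) < x} = ∅ := by
    refine Set.eq_empty_of_forall_notMem fun x hx => ?_
    obtain ⟨n, hn⟩ := exists_nat_ge (x : ℝ)
    exact absurd (Set.mem_iInter.1 hx n) (not_lt.2 hn)
  have hlim : Tendsto (fun n : ℕ => ν.toMeas {x : PosReal | (n : ℝ) < x}) atTop (𝓝 0) := by
    simpa only [hempty, measure_empty, Function.comp_def] using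
      tendsto_measure_iInter_atTop (μ := ν.toMeas)
      (s := fun n : ℕ => {x : PosReal | (n : ℝ) < x}) (fun n => (hms n).nullMeasurableSet)
      (fun m n hmn x (hx : (n : ℝ) < x) => lt_of_le_of_lt (Nat.cast_le.2 hmn) hx)
      ⟨0, measure_ne_top _ _⟩
  obtain ⟨n, hn⟩ := (hlim.eventually_lt_const zero_lt_one).exists
  obtain ⟨j, hj : ν.toMeas {x : PosReal | (n : ℝ) < x} = j⟩ := ν.2 _ (hms n)
  refine ⟨n, ?_⟩
  rw [hj] at hn ⊢
  exact_mod_cast Nat.lt_one_iff.1 (by exact_mod_cast hn)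

lemma CountMeas.integrable_coe (ν : CountMeas) :
    Integrable (fun x : PosReal => (x : ℝ)) ν.toMeas := by
  obtain ⟨n, hn⟩ := ν.exists_measure_Ioi_eq_zero
  refine Integrable.of_bound measurable_subtype_coe.aestronglyMeasurable n ?_
  have h : ∀ᵐ x : PosReal ∂ν.toMeas, ¬ ((n : ℝ) < x) := by
    rw [ae_iff]
    simpa only [not_not] using hn
  filter_upwards [h] with x hx
  rw [Real.norm_of_nonneg (le_of_lt x.2)]
  exact not_lt.1 hx

/-! ### Joint measurability of right-continuous processes -/

lemma tendsto_floor_add_one_div (s : ℝ≥0) :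
    Tendsto (fun n : ℕ => ((⌊s * (n + 1)⌋₊ : ℝ≥0) + 1) / (n + 1)) atTop (𝓝[≥] s) := by
  have hlow : ∀ n : ℕ, s ≤ ((⌊s * (n + 1)⌋₊ : ℝ≥0) + 1) / (n + 1) := fun n => by
    rw [le_div_iff₀ (by positivity)]
    exact (Nat.lt_floor_add_one _).le
  have hup : ∀ n : ℕ, ((⌊s * (n + 1)⌋₊ : ℝ≥0) + 1) / (n + 1) ≤ s + 1 / (n + 1) := fun n => by
    rw [div_le_iff₀ (by positivity), add_mul, div_mul_cancel₀ _ (by positivity)]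
    gcongr
    exact Nat.floor_le zero_le
  have h0 : Tendsto (fun n : ℕ => s + (1 : ℝ≥0) / (n + 1)) atTop (𝓝 s) := by
    simpa using tendsto_one_div_add_atTop_nhds_zero_nat.const_add s
  exact tendsto_nhdsWithin_iff.2
    ⟨tendsto_of_tendsto_of_tendsto_of_le_of_le tendsto_const_nhds h0 hlow hup,
      Eventually.of_forall hlow⟩

lemma measurable_uncurry_of_continuousWithinAt_Ici {Ω E : Type*} [MeasurableSpace Ω]
    [TopologicalSpace E] [TopologicalSpace.PseudoMetrizableSpace E] [MeasurableSpace E]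
    [BorelSpace E] {X : ℝ≥0 → Ω → E} (hX : ∀ t, Measurable (X t))
    (hc : ∀ ω t, ContinuousWithinAt (fun s => X s ω) (Set.Ici t) t) :
    Measurable (Function.uncurry X) := by
  have hgrid : ∀ (e : ℕ → ℝ≥0) {k : ℝ≥0 → ℕ}, Measurable k →
      Measurable fun q : ℝ≥0 × Ω => X (e (k q.1)) q.2 := fun e k hk =>
    (measurable_from_prod_countable_right (f := fun r : ℕ × Ω => X (e r.1) r.2)
      fun i => hX (e i)).comp ((hk.comp measurable_fst).prodMk measurable_snd)
  exact measurable_of_tendsto_metrizable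
    (fun n : ℕ => hgrid (fun i => ((i : ℝ≥0) + 1) / (n + 1))
      (Nat.measurable_floor.comp (measurable_id.mul_const ((n : ℝ≥0) + 1))))
    (tendsto_pi_nhds.2 fun q =>
    (hc q.2 q.1).tendsto.comp (tendsto_floor_add_one_div q.1))

lemma measurable_of_forall_lintegral_boundedContinuous {β X : Type*} [MeasurableSpace β]
    [TopologicalSpace X] [HasOuterApproxClosed X] [MeasurableSpace X] [BorelSpace X]
    {M : β → Measure X} [∀ b, IsFiniteMeasure (M b)]
    (h : ∀ g : BoundedContinuousFunction X ℝ≥0, Measurable fun b => ∫⁻ x, g x ∂M b) :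
    Measurable M := by
  have hclosed : ∀ F : Set X, IsClosed F → Measurable fun b => M b F := fun F hF =>
    measurable_of_tendsto_metrizable (f := fun n b => ∫⁻ x, hF.apprSeq n x ∂M b) (fun n => h _)
      (tendsto_pi_nhds.2 fun b => HasOuterApproxClosed.tendsto_lintegral_apprSeq hF _)
  exact Measurable.measure_of_isPiSystem
    (by rw [BorelSpace.measurable_eq (α := X), borel_eq_generateFrom_isClosed])
    isPiSystem_isClosed hclosed (hclosed _ isClosed_univ)

lemma measurable_uncurry_of_rightContinuous {Ω : Type*} [MeasurableSpace Ω]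
    {Y : ℝ≥0 → Ω → CountMeas} (hY : ∀ t, Measurable (Y t))
    (hc : ∀ ω t, ContinuousWithinAt (fun s => Y s ω) (Set.Ici t) t) :
    Measurable (Function.uncurry Y) := by
  have hlint : ∀ g : BoundedContinuousFunction PosReal ℝ≥0,
      Measurable fun q : ℝ≥0 × Ω => ∫⁻ x, g x ∂(Y q.1 q.2).toMeas := fun g =>
    measurable_uncurry_of_continuousWithinAt_Ici
      (X := fun t ω => ∫⁻ x, g x ∂(Y t ω).toMeas)
      (fun t => (Measure.measurable_lintegral g.continuous.measurable.coe_nnreal_ennreal).comp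
        (measurable_toMeas.comp (hY t)))
      fun ω t => FiniteMeasure.tendsto_iff_forall_lintegral_tendsto.1
        ((continuous_subtype_val.tendsto _).comp (hc ω t)) g
  exact (measurable_of_forall_lintegral_boundedContinuous
    (M := fun q : ℝ≥0 × Ω => (Y q.1 q.2).toMeas) hlint).subtype_mk.subtype_mk

/-! ### The immigration exponent -/

/-- The nonnegative part of the first-order expansion `ε v - ε² B x`, which bounds the cumulants of
`ε f` from below when `v` is the corresponding mean. -/
noncomputable def firstOrderMinorant (v : PosReal → ℝ) (B ε : ℝ) (x : PosReal) : ℝ :=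
  max 0 (ε * v x - ε ^ 2 * (B * x))

lemma one_sub_exp_neg_mem_Icc {y : ℝ} (hy : 0 ≤ y) : 1 - Real.exp (-y) ∈ Set.Icc (0 : ℝ) 1 :=
  ⟨by linarith [Real.exp_le_one_iff.2 (neg_nonpos.2 hy)], by linarith [Real.exp_pos (-y)]⟩

lemma one_sub_exp_neg_le (y : ℝ) : 1 - Real.exp (-y) ≤ y := by
  linarith [Real.add_one_le_exp (-y)]

lemma tendsto_mul_one_sub_exp_neg {y : ℝ → ℝ} {l : ℝ} (h0 : ∀ t, 0 ≤ y t)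
    (h : Tendsto (fun t => t * y t) atTop (𝓝 l)) :
    Tendsto (fun t => t * (1 - Real.exp (-y t))) atTop (𝓝 l) := by
  have hlow : Tendsto (fun t => t * y t - (t * y t) ^ 2 * t⁻¹) atTop (𝓝 l) := by
    simpa using h.sub ((h.pow 2).mul tendsto_inv_atTop_zero)
  refine tendsto_of_tendsto_of_tendsto_of_le_of_le' hlow h ?_ ?_
  · filter_upwards [eventually_gt_atTop 0] with t ht
    calc t * y t - (t * y t) ^ 2 * t⁻¹ = t * (y t - y t ^ 2) := by field_simp
      _ ≤ t * (1 - Real.exp (-y t)) :=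
        mul_le_mul_of_nonneg_left (by linarith [exp_neg_le_one_sub_add_sq (h0 t)]) ht.le
  · filter_upwards [eventually_ge_atTop 0] with t ht
    exact mul_le_mul_of_nonneg_left (one_sub_exp_neg_le _) ht

lemma tendsto_mul_integral_one_sub_exp_neg {β : Type*} [MeasurableSpace β] {ν : Measure β}
    {F : β → ℝ} {v : ℝ → β → ℝ} (hF : Integrable F ν) (hv : ∀ t, Measurable (v t))
    (h0 : ∀ t z, 0 ≤ v t z) (hle : ∀ t, 0 < t → ∀ z, t * v t z ≤ F z)
    (hlim : ∀ z, Tendsto (fun t => t * v t z) atTop (𝓝 (F z))) :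
    Tendsto (fun t => t * ∫ z, (1 - Real.exp (-v t z)) ∂ν) atTop (𝓝 (∫ z, F z ∂ν)) := by
  simp only [← integral_const_mul]
  refine tendsto_integral_filter_of_dominated_convergence F ?_ ?_ hF
    (ae_of_all _ fun z => tendsto_mul_one_sub_exp_neg (fun t => h0 t z) (hlim z))
  · exact Eventually.of_forall fun t =>
      ((measurable_const.sub (hv t).neg.exp).const_mul t).aestronglyMeasurable
  · filter_upwards [eventually_gt_atTop 0] with t ht
    refine ae_of_all _ fun z => ?_
    rw [Real.norm_of_nonneg (mul_nonneg ht.le (one_sub_exp_neg_mem_Icc (h0 t z)).1)]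
    exact (mul_le_mul_of_nonneg_left (one_sub_exp_neg_le _) ht.le).trans (hle t ht z)

section Immigration

variable {L : Measure CountMeas} {f g : PosReal → ℝ} {V : ℝ → PosReal → ℝ}

lemma immExponent_nonneg (h0 : ∀ x, 0 ≤ f x) : 0 ≤ immExponent L f :=
  integral_nonneg fun ν => (one_sub_exp_neg_mem_Icc (pairing_nonneg ν h0)).1

lemma immExponent_le_integral (hf : Integrable f (intensity L)) (h0 : ∀ x, 0 ≤ f x) :
    immExponent L f ≤ ∫ x, f x ∂intensity L := by
  rw [← integral_pairing hf]
  exact integral_mono_of_nonneg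
    (ae_of_all _ fun ν => (one_sub_exp_neg_mem_Icc (pairing_nonneg ν h0)).1)
    (integrable_pairing hf) (ae_of_all _ fun ν => one_sub_exp_neg_le _)

variable [IsFiniteMeasure L]

lemma integrable_one_sub_exp_neg_pairing (hf : Measurable f) (h0 : ∀ x, 0 ≤ f x) :
    Integrable (fun ν => 1 - Real.exp (-pairing ν f)) L :=
  (integrable_const 1).sub (integrable_exp_neg (measurable_pairing hf) fun ν => pairing_nonneg ν h0)

lemma immExponent_le_measure_univ (h0 : ∀ x, 0 ≤ f x) : immExponent L f ≤ L.real Set.univ :=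
  (integral_mono_of_nonneg
    (ae_of_all _ fun ν => (one_sub_exp_neg_mem_Icc (pairing_nonneg ν h0)).1)
    (integrable_const 1)
    (ae_of_all _ fun ν => (one_sub_exp_neg_mem_Icc (pairing_nonneg ν h0)).2)).trans_eq (by simp)

lemma immExponent_mono (hf : Measurable f) (hg : Measurable g) (h0 : ∀ x, 0 ≤ f x)
    (hfg : ∀ x, f x ≤ g x) {C : ℝ} (hC : ∀ x, g x ≤ C) : immExponent L f ≤ immExponent L g := by
  have h0' : ∀ x, 0 ≤ g x := fun x => (h0 x).trans (hfg x)
  refine integral_mono (integrable_one_sub_exp_neg_pairing hf h0)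
    (integrable_one_sub_exp_neg_pairing hg h0') fun ν => ?_
  have hle : pairing ν f ≤ pairing ν g := integral_mono_of_nonneg (ae_of_all _ h0)
    (integrable_of_nonneg_of_le hg h0' hC) (ae_of_all _ hfg)
  exact sub_le_sub_left (Real.exp_le_exp.2 (neg_le_neg hle)) 1

lemma measurable_immExponent (hV : Measurable (Function.uncurry V)) :
    Measurable fun s => immExponent L (V s) :=
  ((measurable_const.sub
    (measurable_pairing_uncurry hV).neg.exp).stronglyMeasurable.integral_prod_right'
      (ν := L)).measurable

lemma intervalIntegrable_immExponent (hV : Measurable (Function.uncurry V))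
    (h0 : ∀ t x, 0 ≤ V t x) (a b : ℝ) :
    IntervalIntegrable (fun s => immExponent L (V s)) volume a b := by
  rw [intervalIntegrable_iff]
  refine Measure.integrableOn_of_bounded (M := L.real Set.univ) (by simp)
    (measurable_immExponent hV).aestronglyMeasurable (ae_of_all _ fun s => ?_)
  rw [Real.norm_of_nonneg (immExponent_nonneg (h0 s))]
  exact immExponent_le_measure_univ (h0 s)

end Immigration

/-! ### First-order expansion of the immigration exponent -/

section FirstOrder

variable {v : PosReal → ℝ} {S : ℝ → PosReal → ℝ} {B C ε : ℝ}

lemma firstOrderMinorant_nonneg (v : PosReal → ℝ) (B ε : ℝ) (x : PosReal) :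
    0 ≤ firstOrderMinorant v B ε x := le_max_left _ _

lemma firstOrderMinorant_le (h0 : ∀ x, 0 ≤ v x) (hB : 0 ≤ B) (hε : 0 ≤ ε) (x : PosReal) :
    firstOrderMinorant v B ε x ≤ ε * v x := by
  have hx : (0 : ℝ) < x := x.2
  refine max_le (mul_nonneg hε (h0 x)) (sub_le_self _ (by positivity))

lemma mul_firstOrderMinorant_inv_le (h0 : ∀ x, 0 ≤ v x) (hB : 0 ≤ B) {t : ℝ} (ht : 0 < t)
    (x : PosReal) : t * firstOrderMinorant v B t⁻¹ x ≤ v x :=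
  calc t * firstOrderMinorant v B t⁻¹ x ≤ t * (t⁻¹ * v x) :=
        mul_le_mul_of_nonneg_left (firstOrderMinorant_le h0 hB (inv_nonneg.2 ht.le) x) ht.le
    _ = v x := by field_simp

lemma measurable_firstOrderMinorant_uncurry (hS : Measurable (Function.uncurry S)) (B ε : ℝ) :
    Measurable (Function.uncurry fun s => firstOrderMinorant (S s) B ε) :=
  measurable_const.max ((hS.const_mul ε).sub
    (((measurable_subtype_coe.comp measurable_snd).const_mul B).const_mul (ε ^ 2)))

lemma measurable_firstOrderMinorant (hv : Measurable v) (B ε : ℝ) :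
    Measurable (firstOrderMinorant v B ε) :=
  measurable_const.max ((hv.const_mul ε).sub
    ((measurable_subtype_coe.const_mul B).const_mul (ε ^ 2)))

lemma tendsto_mul_firstOrderMinorant_inv (h0 : ∀ x, 0 ≤ v x) (B : ℝ) (x : PosReal) :
    Tendsto (fun t : ℝ => t * firstOrderMinorant v B t⁻¹ x) atTop (𝓝 (v x)) := by
  have hsub : Tendsto (fun t : ℝ => v x - t⁻¹ * (B * x)) atTop (𝓝 (v x)) := by
    simpa using (tendsto_inv_atTop_zero.mul_const (B * (x : ℝ))).const_sub (v x)
  have hmax : Tendsto (fun t : ℝ => max 0 (v x - t⁻¹ * (B * x))) atTop (𝓝 (v x)) := by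
    simpa [max_eq_right (h0 x)] using (tendsto_const_nhds (x := (0 : ℝ))).max hsub
  refine hmax.congr' ?_
  filter_upwards [eventually_gt_atTop 0] with t ht
  rw [firstOrderMinorant, mul_max_of_nonneg _ _ ht.le, mul_zero]
  congr 1
  field_simp

variable (hv : Measurable v) (h0 : ∀ x, 0 ≤ v x) (hC : ∀ x, v x ≤ C) (hB : 0 ≤ B)
include hv h0 hC hB

lemma mul_pairing_firstOrderMinorant_inv_le (ν : CountMeas) {t : ℝ} (ht : 0 < t) :
    t * pairing ν (firstOrderMinorant v B t⁻¹) ≤ pairing ν v := by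
  rw [pairing, ← integral_const_mul]
  exact integral_mono_of_nonneg
    (ae_of_all _ fun x => mul_nonneg ht.le (firstOrderMinorant_nonneg _ _ _ x))
    (integrable_of_nonneg_of_le hv h0 hC)
    (ae_of_all _ (mul_firstOrderMinorant_inv_le h0 hB ht))

lemma tendsto_mul_pairing_firstOrderMinorant_inv (ν : CountMeas) :
    Tendsto (fun t : ℝ => t * pairing ν (firstOrderMinorant v B t⁻¹)) atTop (𝓝 (pairing ν v)) := by
  simp only [pairing, ← integral_const_mul]
  refine tendsto_integral_filter_of_dominated_convergence v ?_ ?_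
    (integrable_of_nonneg_of_le hv h0 hC)
    (ae_of_all _ (tendsto_mul_firstOrderMinorant_inv h0 B))
  · exact Eventually.of_forall fun t =>
      ((measurable_firstOrderMinorant hv B t⁻¹).const_mul t).aestronglyMeasurable
  · filter_upwards [eventually_gt_atTop 0] with t ht
    refine ae_of_all _ fun x => ?_
    rw [Real.norm_of_nonneg (mul_nonneg ht.le (firstOrderMinorant_nonneg _ _ _ _))]
    exact mul_firstOrderMinorant_inv_le h0 hB ht x

omit hv h0 hC

variable {L : Measure CountMeas} [IsFiniteMeasure (intensity L)]

include hv h0 hC in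
lemma tendsto_mul_immExponent_firstOrderMinorant_inv :
    Tendsto (fun t : ℝ => t * immExponent L (firstOrderMinorant v B t⁻¹)) atTop
      (𝓝 (∫ x, v x ∂intensity L)) := by
  have hi : Integrable v (intensity L) := integrable_of_nonneg_of_le hv h0 hC
  rw [← integral_pairing hi]
  exact tendsto_mul_integral_one_sub_exp_neg (integrable_pairing hi)
    (fun t => measurable_pairing (measurable_firstOrderMinorant hv B t⁻¹))
    (fun t ν => pairing_nonneg ν (firstOrderMinorant_nonneg _ _ _))
    (fun t ht ν => mul_pairing_firstOrderMinorant_inv_le hv h0 hC hB ν ht)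
    (tendsto_mul_pairing_firstOrderMinorant_inv hv h0 hC hB)

include hv h0 hC in
lemma mul_immExponent_firstOrderMinorant_inv_le {t : ℝ} (ht : 0 < t) :
    t * immExponent L (firstOrderMinorant v B t⁻¹) ≤ ∫ x, v x ∂intensity L := by
  have hi : Integrable v (intensity L) := integrable_of_nonneg_of_le hv h0 hC
  have hle := firstOrderMinorant_le h0 hB (inv_nonneg.2 ht.le)
  have hm : Integrable (firstOrderMinorant v B t⁻¹) (intensity L) :=
    (hi.const_mul t⁻¹).mono' (measurable_firstOrderMinorant hv B t⁻¹).aestronglyMeasurable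
      (ae_of_all _ fun x => (Real.norm_of_nonneg (firstOrderMinorant_nonneg _ _ _ x)).trans_le
        (hle x))
  calc t * immExponent L (firstOrderMinorant v B t⁻¹)
      ≤ t * ∫ x, firstOrderMinorant v B t⁻¹ x ∂intensity L :=
        mul_le_mul_of_nonneg_left
          (immExponent_le_integral hm (firstOrderMinorant_nonneg _ _ _)) ht.le
    _ = ∫ x, t * firstOrderMinorant v B t⁻¹ x ∂intensity L := (integral_const_mul _ _).symm
    _ ≤ ∫ x, v x ∂intensity L := integral_mono (hm.const_mul t) hi
        (mul_firstOrderMinorant_inv_le h0 hB ht)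

lemma tendsto_mul_intervalIntegral_immExponent [IsFiniteMeasure L]
    (hS : Measurable (Function.uncurry S)) (hS0 : ∀ s x, 0 ≤ S s x)
    (hSC : ∀ s ≤ 1, ∀ x, S s x ≤ C) :
    Tendsto (fun t : ℝ => t * ∫ s in (0 : ℝ)..1, immExponent L (firstOrderMinorant (S s) B t⁻¹))
      atTop (𝓝 (∫ s in (0 : ℝ)..1, ∫ x, S s x ∂intensity L)) := by
  simp only [← intervalIntegral.integral_const_mul]
  refine intervalIntegral.tendsto_integral_filter_of_dominated_convergence
    (fun _ => ∫ _, C ∂intensity L) ?_ ?_ intervalIntegrable_const ?_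
  · exact Eventually.of_forall fun t => ((measurable_immExponent
      (measurable_firstOrderMinorant_uncurry hS B t⁻¹)).const_mul t).aestronglyMeasurable
  · filter_upwards [eventually_gt_atTop 0] with t ht
    refine ae_of_all _ fun s hs => ?_
    rw [Set.uIoc_of_le zero_le_one] at hs
    have hm := measurable_apply_of_uncurry hS s
    rw [Real.norm_of_nonneg
      (mul_nonneg ht.le (immExponent_nonneg (firstOrderMinorant_nonneg _ _ _)))]
    exact (mul_immExponent_firstOrderMinorant_inv_le hm (hS0 s) (hSC s hs.2) hB ht).trans
      (integral_mono (integrable_of_nonneg_of_le hm (hS0 s) (hSC s hs.2)) (integrable_const C)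
        (hSC s hs.2))
  · refine ae_of_all _ fun s hs => ?_
    rw [Set.uIoc_of_le zero_le_one] at hs
    exact tendsto_mul_immExponent_firstOrderMinorant_inv (measurable_apply_of_uncurry hS s) (hS0 s)
      (hSC s hs.2) hB

end FirstOrder

/-! ### Laplace functionals along the process -/

lemma abs_exp_neg_le_one {y : ℝ} (hy : 0 ≤ y) : |Real.exp (-y)| ≤ 1 := by
  rw [Real.abs_exp]
  exact Real.exp_le_one_iff.2 (neg_nonpos.2 hy)

lemma isBddBorel_of_nonneg_of_le {h : PosReal → ℝ} {C : ℝ} (hm : Measurable h)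
    (h0 : ∀ x, 0 ≤ h x) (hC : ∀ x, h x ≤ C) : IsBddBorel h :=
  ⟨hm, C, fun x => (abs_of_nonneg (h0 x)).trans_le (hC x)⟩

lemma intervalIntegral_comp_toNNReal (F : ℝ → ℝ) (t : ℝ≥0) :
    ∫ s in (0 : ℝ)..t, F s.toNNReal = ∫ s in (0 : ℝ)..t, F s :=
  intervalIntegral.integral_congr fun s hs => by
    rw [Set.uIcc_of_le t.coe_nonneg] at hs
    simp only [Real.coe_toNNReal s hs.1]

lemma IsSubcriticalBranching.isCumulant_trainCumulant_zero {G : Measure PosReal}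
    [IsProbabilityMeasure G] {α : PosReal → ℝ} {p : PosReal → ℕ → ℝ} {κ a₀ C₂ C : ℝ}
    {h : PosReal → ℝ} (hD : IsSubcriticalBranching G α p κ a₀ C₂) (hm : Measurable h)
    (h0 : ∀ x, 0 ≤ h x) (hC : ∀ x, h x ≤ C) :
    IsCumulant α p G h fun t => trainCumulant α p G h 0 t := by
  have hcum := hD.isCumulant_trainCumulant hm h0 hC 0
  simpa only [Nat.cast_zero, zero_add, funext (hD.trainCumulant_zero hm h0 hC)] using hcum

namespace IsRightContMarkov

variable {G : Measure PosReal} {α : PosReal → ℝ} {p : PosReal → ℕ → ℝ} {κ a₀ C₂ : ℝ}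
  {L : Measure CountMeas} {P : ℝ≥0 → Kernel CountMeas CountMeas} {Ω : Type*}
  [mΩ : MeasurableSpace Ω]
  {μ : Measure Ω} {𝓕 : Filtration ℝ≥0 mΩ} {σ : CountMeas} {Y : ℝ≥0 → Ω → CountMeas}
  {h f : PosReal → ℝ} {C : ℝ} {V : ℝ → PosReal → ℝ}

lemma measurable (hY : IsRightContMarkov μ 𝓕 P σ Y) (t : ℝ≥0) : Measurable (Y t) :=
  (hY.adapted t).mono (𝓕.le t) le_rfl

lemma measurable_sum_pairing (hY : IsRightContMarkov μ 𝓕 P σ Y) (hh : Measurable h) (θ : ℝ≥0)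
    (q : ℕ) : Measurable[𝓕 (θ + q)] fun ω =>
      ∑ k ∈ Finset.range (q + 1), pairing (Y (θ + k) ω) h := by
  refine Finset.measurable_sum _ fun k hk => ?_
  have hkq : θ + k ≤ θ + q :=
    add_le_add_right (Nat.cast_le.2 (Nat.lt_succ_iff.1 (Finset.mem_range.1 hk))) θ
  exact (measurable_pairing hh).comp ((hY.adapted (θ + k)).mono (𝓕.mono hkq) le_rfl)

variable [IsProbabilityMeasure μ]

lemma integral_mul_exp_neg_pairing (hP : IsImmigrationSemigroup α p G L P)
    (hY : IsRightContMarkov μ 𝓕 P σ Y) {s : ℝ≥0} (r : ℝ≥0) {W : Ω → ℝ} (hW : Measurable[𝓕 s] W)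
    (hW1 : ∀ ω, |W ω| ≤ 1) (hh : IsBddBorel h) (h0 : ∀ x, 0 ≤ h x)
    (hV : IsCumulant α p G h fun t => V t) :
    ∫ ω, W ω * Real.exp (-pairing (Y (s + r) ω) h) ∂μ =
      (∫ ω, W ω * Real.exp (-pairing (Y s ω) (V r)) ∂μ) *
        Real.exp (-∫ q in (0 : ℝ)..r, immExponent L (V q)) := by
  have hem : Measurable fun ν => Real.exp (-pairing ν h) := (measurable_pairing hh.1).neg.exp
  have he1 : ∀ ν, |Real.exp (-pairing ν h)| ≤ 1 := fun ν =>
    abs_exp_neg_le_one (pairing_nonneg ν h0)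
  have hmarkov := hY.markov s (s + r) le_self_add _ hem ⟨1, he1⟩
  simp only [add_tsub_cancel_left, hP.laplace h hh h0 _ hV r,
    intervalIntegral_comp_toNNReal fun q => immExponent L (V q)] at hmarkov
  have hi : Integrable (fun ω => Real.exp (-pairing (Y (s + r) ω) h)) μ :=
    .of_bound (hem.comp (hY.measurable _)).aestronglyMeasurable 1 (ae_of_all _ fun ω => he1 _)
  have hWi : Integrable (W * fun ω => Real.exp (-pairing (Y (s + r) ω) h)) μ :=
    hi.bdd_mul (c := 1) (hW.mono (𝓕.le s) le_rfl).aestronglyMeasurable (ae_of_all _ hW1)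
  have hpull := condExp_mul_of_stronglyMeasurable_left (m := 𝓕 s) hW.stronglyMeasurable hWi hi
  calc ∫ ω, W ω * Real.exp (-pairing (Y (s + r) ω) h) ∂μ
      = ∫ ω, (μ[W * fun ω => Real.exp (-pairing (Y (s + r) ω) h) | 𝓕 s]) ω ∂μ :=
        (integral_condExp (𝓕.le s)).symm
    _ = ∫ ω, W ω * Real.exp (-pairing (Y s ω) (V r)) *
          Real.exp (-∫ q in (0 : ℝ)..r, immExponent L (V q)) ∂μ := by
        refine integral_congr_ae ?_
        filter_upwards [hpull, hmarkov] with ω hω hω'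
        rw [hω, Pi.mul_apply, hω', sub_eq_add_neg, Real.exp_add, mul_assoc]
    _ = _ := integral_mul_const _ _

lemma integral_exp_neg_pairing (hP : IsImmigrationSemigroup α p G L P)
    (hY : IsRightContMarkov μ 𝓕 P σ Y) (r : ℝ≥0) (hh : IsBddBorel h) (h0 : ∀ x, 0 ≤ h x)
    (hV : IsCumulant α p G h fun t => V t) :
    ∫ ω, Real.exp (-pairing (Y r ω) h) ∂μ =
      Real.exp (-(pairing σ (V r) + ∫ q in (0 : ℝ)..r, immExponent L (V q))) := by
  have hmarkov := hY.integral_mul_exp_neg_pairing hP (s := 0) r (W := fun _ => 1) measurable_const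
    (fun _ => abs_one.le) hh h0 hV
  have hinitial : ∫ ω, Real.exp (-pairing (Y 0 ω) (V r)) ∂μ = Real.exp (-pairing σ (V r)) := by
    rw [integral_congr_ae (hY.initial.mono fun ω hω => by rw [hω])]
    simp
  simp only [one_mul, zero_add] at hmarkov
  rw [hmarkov, hinitial, neg_add, Real.exp_add]

variable [IsProbabilityMeasure G]

lemma exp_neg_sum_pairing_mul_exp_neg (hD : IsSubcriticalBranching G α p κ a₀ C₂)
    (hm : Measurable h) (h0 : ∀ x, 0 ≤ h x) (hC : ∀ x, h x ≤ C) (N : ℕ → CountMeas) (q m : ℕ) :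
    Real.exp (-∑ k ∈ Finset.range (q + 1), pairing (N k) h) *
        Real.exp (-pairing (N q) (trainCumulant α p G h m (m + 1 : ℕ))) =
      Real.exp (-∑ k ∈ Finset.range q, pairing (N k) h) *
        Real.exp (-pairing (N q) (trainCumulant α p G h (m + 1) (m + 1 : ℕ))) := by
  have hsucc : pairing (N q) (trainCumulant α p G h (m + 1) (m + 1 : ℕ)) =
      pairing (N q) h + pairing (N q) (trainCumulant α p G h m (m + 1 : ℕ)) := by
    rw [funext (hD.trainCumulant_succ hm h0 hC m)]
    exact integral_add (integrable_of_nonneg_of_le hm h0 hC)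
      ((hD.isMildSolution_trainCumulant hm h0 hC m).toIsPath.integrable _ _)
  rw [hsucc, Finset.sum_range_succ, ← Real.exp_add, ← Real.exp_add]
  ring_nf

/-- Induction on `q`: conditioning on the past of the last observation time turns the last factor
into the cumulant after a unit of time, which the impulse of that observation restarts. -/
lemma integral_exp_neg_sum_mul_le (hD : IsSubcriticalBranching G α p κ a₀ C₂)
    (hP : IsImmigrationSemigroup α p G L P) (hY : IsRightContMarkov μ 𝓕 P σ Y) (hm : Measurable h)
    (h0 : ∀ x, 0 ≤ h x) (hC : ∀ x, h x ≤ C) (θ : ℝ≥0) (q m : ℕ) :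
    ∫ ω, Real.exp (-∑ k ∈ Finset.range q, pairing (Y (θ + k) ω) h) *
        Real.exp (-pairing (Y (θ + q) ω) (trainCumulant α p G h m m)) ∂μ ≤
      Real.exp (-∑ j ∈ Finset.range q, ∫ s in (0 : ℝ)..1,
        immExponent L (trainCumulant α p G h (m + j) ((m + j : ℕ) + s))) := by
  induction q generalizing m with
  | zero =>
    have hU := hD.isMildSolution_trainCumulant hm h0 hC m
    have hbound := norm_integral_le_of_norm_le_const (μ := μ) (C := 1)
      (f := fun ω => Real.exp (-pairing (Y (θ + (0 : ℕ)) ω) (trainCumulant α p G h m m)))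
      (ae_of_all _ fun ω => abs_exp_neg_le_one (pairing_nonneg _ (hU.nonneg _)))
    simpa using (le_abs_self _).trans hbound
  | succ q ih =>
    have hU := hD.isMildSolution_trainCumulant hm h0 hC m
    obtain ⟨B, hB⟩ := hU.exists_le m
    have hstep := hY.integral_mul_exp_neg_pairing hP (s := θ + q) 1
      (W := fun ω => Real.exp (-∑ k ∈ Finset.range (q + 1), pairing (Y (θ + k) ω) h))
      (hY.measurable_sum_pairing hm θ q).neg.exp
      (fun ω => abs_exp_neg_le_one (Finset.sum_nonneg fun k _ => pairing_nonneg _ h0))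
      (isBddBorel_of_nonneg_of_le (hU.measurable_apply m) (hU.nonneg m) (hB m le_rfl)) (hU.nonneg m)
      (V := fun t => trainCumulant α p G h m (m + t)) (hD.isCumulant_trainCumulant hm h0 hC m)
    have hlast : (m : ℝ) + ((1 : ℝ≥0) : ℝ) = ((m + 1 : ℕ) : ℝ) := by push_cast; rfl
    rw [show θ + ((q + 1 : ℕ) : ℝ≥0) = θ + q + 1 by push_cast; ring, hstep, hlast,
      Finset.sum_range_succ', neg_add, Real.exp_add]
    simp_rw [exp_neg_sum_pairing_mul_exp_neg hD hm h0 hC fun k => Y (θ + k) _]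
    refine mul_le_mul ((ih (m + 1)).trans_eq ?_) (le_of_eq ?_) (Real.exp_pos _).le
      (Real.exp_pos _).le
    · simp only [show ∀ j, m + 1 + j = m + (j + 1) from fun j => by ring]
    · simp

lemma integral_exp_neg_sum_le (hD : IsSubcriticalBranching G α p κ a₀ C₂)
    (hP : IsImmigrationSemigroup α p G L P) (hY : IsRightContMarkov μ 𝓕 P σ Y) (hm : Measurable h)
    (h0 : ∀ x, 0 ≤ h x) (hC : ∀ x, h x ≤ C) (θ : ℝ≥0) (q : ℕ) :
    ∫ ω, Real.exp (-∑ k ∈ Finset.range (q + 1), pairing (Y (θ + k) ω) h) ∂μ ≤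
      Real.exp (-∑ j ∈ Finset.range q, ∫ s in (0 : ℝ)..1,
        immExponent L (trainCumulant α p G h j (j + s))) := by
  have hbound := hY.integral_exp_neg_sum_mul_le hD hP hm h0 hC θ q 0
  simp only [Nat.cast_zero, funext (hD.trainCumulant_zero hm h0 hC), zero_add] at hbound
  simpa only [Finset.sum_range_succ, neg_add, Real.exp_add] using hbound

end IsRightContMarkov

/-! ### Laplace functionals on a unit grid -/

section UnitGrid

variable {G : Measure PosReal} [IsProbabilityMeasure G] {k f : PosReal → ℝ} {κ C : ℝ}

lemma trainMean_add (G : Measure PosReal) (k f : PosReal → ℝ) (m : ℕ) (t : ℝ) (x : PosReal) :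
    trainMean G k f m (m + t) x = ∑ i ∈ Finset.range (m + 1), meanPath G k f (t + i) x := by
  rw [trainMean, ← Finset.sum_range_reflect]
  refine Finset.sum_congr rfl fun i hi => ?_
  rw [add_tsub_cancel_right, Nat.cast_sub (Nat.lt_succ_iff.1 (Finset.mem_range.1 hi))]
  congr 1
  ring

lemma trainMean_add_le_trainMean_add (hk : IsSubcritical G k κ) (hf : Measurable f)
    (h0 : ∀ x, 0 ≤ f x) (hC : ∀ x, f x ≤ C) {m n : ℕ} (hmn : m ≤ n) (t : ℝ) (x : PosReal) :
    trainMean G k f m (m + t) x ≤ trainMean G k f n (n + t) x := by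
  rw [trainMean_add, trainMean_add]
  exact Finset.sum_le_sum_of_subset_of_nonneg (Finset.range_mono (Nat.succ_le_succ hmn))
    fun i _ _ => (isMildSolution_meanPath hk hf h0 hC).nonneg _ _

lemma measurable_uncurry_comp_const_add {φ : ℝ → PosReal → ℝ}
    (hφ : Measurable (Function.uncurry φ)) (a : ℝ) :
    Measurable (Function.uncurry fun s => φ (a + s)) :=
  hφ.comp ((measurable_const.add measurable_fst).prodMk measurable_snd)

variable {α : PosReal → ℝ} {p : PosReal → ℕ → ℝ} {a₀ C₂ : ℝ} {L : Measure CountMeas}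
  [IsFiniteMeasure L]

lemma IsSubcriticalBranching.exists_intervalIntegral_immExponent_le
    (hD : IsSubcriticalBranching G α p κ a₀ C₂) (hf : Measurable f) (h0 : ∀ x, 0 ≤ f x)
    (hC : ∀ x, f x ≤ C) :
    ∃ B : ℝ, 0 ≤ B ∧ ∀ ε : ℝ, 0 ≤ ε → ∀ m n : ℕ, m ≤ n →
      ∫ s in (0 : ℝ)..1, immExponent L
          (firstOrderMinorant (trainMean G (meanRate α p) f m (m + s)) B ε) ≤
        ∫ s in (0 : ℝ)..1, immExponent L (trainCumulant α p G (fun z => ε * f z) n (n + s)) := by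
  obtain ⟨B, hB0, hB⟩ := hD.exists_trainMean_sub_le_trainCumulant hf h0 hC
  refine ⟨B, hB0, fun ε hε m n hmn => ?_⟩
  have hU := hD.isMildSolution_trainCumulant (hf.const_mul ε) (fun z => mul_nonneg hε (h0 z))
    (fun z => mul_le_mul_of_nonneg_left (hC z) hε) n
  have hV := isMildSolution_trainMean hD.mean hf h0 hC m
  refine intervalIntegral.integral_mono_on zero_le_one
    (intervalIntegrable_immExponent (measurable_firstOrderMinorant_uncurry
      (measurable_uncurry_comp_const_add hV.measurable m) B ε)
      (fun s => firstOrderMinorant_nonneg _ _ _) _ _)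
    (intervalIntegrable_immExponent (measurable_uncurry_comp_const_add hU.measurable n)
      (fun s => hU.nonneg _) _ _) fun s _ => ?_
  obtain ⟨R, hR⟩ := hU.exists_le (n + s)
  refine immExponent_mono (measurable_firstOrderMinorant (hV.measurable_apply _) B ε)
    (hU.measurable_apply _) (firstOrderMinorant_nonneg _ _ _)
    (fun x => max_le (hU.nonneg _ x) ?_) (hR _ le_rfl)
  exact (sub_le_sub_right (mul_le_mul_of_nonneg_left
    (trainMean_add_le_trainMean_add hD.mean hf h0 hC hmn s x) hε) _).trans (hB ε hε n (n + s) x)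

lemma sub_mul_le_sum_range {a : ℕ → ℝ} {I : ℝ} {m : ℕ} (h0 : ∀ j, 0 ≤ a j) (hI0 : 0 ≤ I)
    (hI : ∀ j, m ≤ j → I ≤ a j) (q : ℕ) : ((q : ℝ) - m) * I ≤ ∑ j ∈ Finset.range q, a j := by
  rcases le_total q m with hq | hq
  · exact (mul_nonpos_of_nonpos_of_nonneg (sub_nonpos.2 (Nat.cast_le.2 hq)) hI0).trans
      (Finset.sum_nonneg fun j _ => h0 j)
  · calc ((q : ℝ) - m) * I = ∑ _j ∈ Finset.Ico m q, I := by simp [Nat.cast_sub hq]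
      _ ≤ ∑ j ∈ Finset.Ico m q, a j :=
        Finset.sum_le_sum fun j hj => hI j (Finset.mem_Ico.1 hj).1
      _ ≤ ∑ j ∈ Finset.range q, a j := by
        rw [← Finset.sum_range_add_sum_Ico _ hq]
        exact le_add_of_nonneg_left (Finset.sum_nonneg fun j _ => h0 j)

lemma IsRightContMarkov.exists_integral_exp_neg_sum_le {P : ℝ≥0 → Kernel CountMeas CountMeas}
    {Ω : Type*} [mΩ : MeasurableSpace Ω] {μ : Measure Ω} [IsProbabilityMeasure μ]
    {𝓕 : Filtration ℝ≥0 mΩ} {σ : CountMeas} {Y : ℝ≥0 → Ω → CountMeas}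
    (hD : IsSubcriticalBranching G α p κ a₀ C₂) (hP : IsImmigrationSemigroup α p G L P)
    (hY : IsRightContMarkov μ 𝓕 P σ Y) (hf : Measurable f) (h0 : ∀ x, 0 ≤ f x)
    (hC : ∀ x, f x ≤ C) :
    ∃ B : ℝ, 0 ≤ B ∧ ∀ (m q : ℕ) (ε : ℝ) (θ : ℝ≥0), 0 ≤ ε →
      ∫ ω, Real.exp (-∑ k ∈ Finset.range (q + 1), pairing (Y (θ + k) ω) (fun x => ε * f x)) ∂μ ≤
        Real.exp (-(((q : ℝ) - m) * ∫ s in (0 : ℝ)..1, immExponent L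
          (firstOrderMinorant (trainMean G (meanRate α p) f m (m + s)) B ε))) := by
  obtain ⟨B, hB0, hB⟩ := hD.exists_intervalIntegral_immExponent_le (L := L) hf h0 hC
  refine ⟨B, hB0, fun m q ε θ hε => ?_⟩
  have h0ε : ∀ z, 0 ≤ ε * f z := fun z => mul_nonneg hε (h0 z)
  have hCε : ∀ z, ε * f z ≤ ε * C := fun z => mul_le_mul_of_nonneg_left (hC z) hε
  have hgrid := hY.integral_exp_neg_sum_le hD hP (hf.const_mul ε) h0ε hCε θ q
  refine hgrid.trans (Real.exp_le_exp.2 (neg_le_neg (sub_mul_le_sum_range (fun j => ?_) ?_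
    (hB ε hε m) q)))
  · exact intervalIntegral.integral_nonneg zero_le_one fun s _ => immExponent_nonneg
      ((hD.isMildSolution_trainCumulant (hf.const_mul ε) h0ε hCε j).nonneg _)
  · exact intervalIntegral.integral_nonneg zero_le_one fun s _ =>
      immExponent_nonneg (firstOrderMinorant_nonneg _ _ _)

end UnitGrid

/-! ### First moments -/

lemma lintegral_ofReal_le_of_forall_mul_integral_le {Ω : Type*} [MeasurableSpace Ω]
    {μ : Measure Ω} [IsFiniteMeasure μ] {X : Ω → ℝ} {M : ℝ} (hX : Measurable X)
    (h0 : ∀ ω, 0 ≤ X ω)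
    (hM : ∀ n : ℕ, n * ∫ ω, (1 - Real.exp (-((n : ℝ)⁻¹ * X ω))) ∂μ ≤ M) :
    ∫⁻ ω, ENNReal.ofReal (X ω) ∂μ ≤ ENNReal.ofReal M := by
  set A : ℕ → Ω → ℝ := fun n ω => n * (1 - Real.exp (-((n : ℝ)⁻¹ * X ω)))
  have harg : ∀ (n : ℕ) ω, 0 ≤ (n : ℝ)⁻¹ * X ω := fun n ω =>
    mul_nonneg (inv_nonneg.2 n.cast_nonneg) (h0 ω)
  have hA0 : ∀ n ω, 0 ≤ A n ω := fun n ω =>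
    mul_nonneg n.cast_nonneg (one_sub_exp_neg_mem_Icc (harg n ω)).1
  have hAm : ∀ n, Measurable (A n) := fun n =>
    (measurable_const.sub (hX.const_mul _).neg.exp).const_mul _
  have hAi : ∀ n, Integrable (A n) μ := fun n =>
    ((integrable_const 1).sub (integrable_exp_neg (hX.const_mul _) (harg n))).const_mul _
  have hlim : ∀ ω, Tendsto (fun n => ENNReal.ofReal (A n ω)) atTop (𝓝 (ENNReal.ofReal (X ω))) :=
    fun ω => by
      have hreal : Tendsto (fun r : ℝ => r * (1 - Real.exp (-(|r|⁻¹ * X ω)))) atTop (𝓝 (X ω)) := by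
        refine tendsto_mul_one_sub_exp_neg
          (fun r => mul_nonneg (inv_nonneg.2 (abs_nonneg r)) (h0 ω)) ?_
        refine tendsto_const_nhds.congr' ?_
        filter_upwards [eventually_gt_atTop 0] with r hr
        rw [abs_of_pos hr, mul_inv_cancel_left₀ hr.ne']
      refine ENNReal.tendsto_ofReal ((hreal.comp tendsto_natCast_atTop_atTop).congr fun n => ?_)
      simp only [A, Function.comp_apply, Nat.abs_cast]
  calc ∫⁻ ω, ENNReal.ofReal (X ω) ∂μ
      = ∫⁻ ω, liminf (fun n => ENNReal.ofReal (A n ω)) atTop ∂μ :=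
        lintegral_congr fun ω => (hlim ω).liminf_eq.symm
    _ ≤ liminf (fun n => ∫⁻ ω, ENNReal.ofReal (A n ω) ∂μ) atTop :=
        lintegral_liminf_le fun n => (hAm n).ennreal_ofReal
    _ ≤ ENNReal.ofReal M := by
        refine liminf_le_of_frequently_le' (Eventually.of_forall fun n => ?_).frequently
        rw [← ofReal_integral_eq_lintegral_ofReal (hAi n) (ae_of_all _ (hA0 n)),
          integral_const_mul]
        exact ENNReal.ofReal_le_ofReal (hM n)

lemma IsPath.intervalIntegrable_integral {φ : ℝ → PosReal → ℝ} (hφ : IsPath φ)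
    (ν : Measure PosReal) [IsFiniteMeasure ν] (a b : ℝ) :
    IntervalIntegrable (fun s => ∫ x, φ s x ∂ν) volume a b := by
  obtain ⟨C, hC⟩ := hφ.locBdd (max a b)
  rw [intervalIntegrable_iff]
  refine Measure.integrableOn_of_bounded (M := C * ν.real Set.univ) (by simp)
    (measurable_integral_apply hφ.measurable).aestronglyMeasurable ?_
  filter_upwards [ae_restrict_mem measurableSet_uIoc] with s hs
  exact norm_integral_le_of_norm_le_const (ae_of_all _ (hC s hs.2))

section FirstMoment

variable {G : Measure PosReal} [IsProbabilityMeasure G] {k f : PosReal → ℝ} {κ C : ℝ}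

omit [IsProbabilityMeasure G] in
lemma IsMeanPath.const_mul {π : ℝ → PosReal → ℝ} (hπ : IsMeanPath G k f π) (c : ℝ) :
    IsMeanPath G k (fun x => c * f x) fun t x => c * π t x where
  toIsPath := hπ.toIsPath.const_mul c
  eqn t x := by
    simp only [hπ.eqn t x, impulse, zeroExt_const_mul, duhamel_meanMechanism_const_mul]
    split_ifs <;> ring

lemma meanPath_const_mul (hk : IsSubcritical G k κ) (hf : Measurable f) (h0 : ∀ x, 0 ≤ f x)
    (hC : ∀ x, f x ≤ C) {c : ℝ} (hc : 0 ≤ c) :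
    meanPath G k (fun x => c * f x) = fun t x => c * meanPath G k f t x :=
  (isMeanPath_meanPath hk (hf.const_mul c) (fun x => mul_nonneg hc (h0 x))
    (fun x => mul_le_mul_of_nonneg_left (hC x) hc)).unique hk
    ((isMeanPath_meanPath hk hf h0 hC).const_mul c)

variable {α : PosReal → ℝ} {p : PosReal → ℕ → ℝ} {a₀ C₂ : ℝ} {L : Measure CountMeas}
  [IsFiniteMeasure L] [IsFiniteMeasure (intensity L)]

lemma IsSubcriticalBranching.exponent_trainCumulant_le
    (hD : IsSubcriticalBranching G α p κ a₀ C₂) (hf : Measurable f) (h0 : ∀ x, 0 ≤ f x)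
    (hC : ∀ x, f x ≤ C) (σ : CountMeas) {t : ℝ} (ht : 0 ≤ t) :
    pairing σ (trainCumulant α p G f 0 t) +
        ∫ s in (0 : ℝ)..t, immExponent L (trainCumulant α p G f 0 s) ≤
      pairing σ (meanPath G (meanRate α p) f t) +
        ∫ s in (0 : ℝ)..t, ∫ x, meanPath G (meanRate α p) f s x ∂intensity L := by
  have hU := hD.isMildSolution_trainCumulant hf h0 hC 0
  have hV := (isMildSolution_meanPath hD.mean hf h0 hC).toIsPath
  have hle : ∀ s x, trainCumulant α p G f 0 s x ≤ meanPath G (meanRate α p) f s x := fun s x => by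
    simpa [trainMean] using hD.trainCumulant_le_trainMean hf h0 hC 0 s x
  refine add_le_add (integral_mono (hU.integrable _ _) (hV.integrable _ _) (hle t))
    (intervalIntegral.integral_mono_on ht
      (intervalIntegrable_immExponent hU.measurable hU.nonneg _ _)
      (hV.intervalIntegrable_integral _ _ _) fun s _ => ?_)
  exact (immExponent_le_integral (hU.integrable _ _) (hU.nonneg s)).trans
    (integral_mono (hU.integrable _ _) (hV.integrable _ _) (hle s))

namespace IsRightContMarkov

variable {P : ℝ≥0 → Kernel CountMeas CountMeas} {Ω : Type*} [mΩ : MeasurableSpace Ω]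
  {μ : Measure Ω} [IsProbabilityMeasure μ] {𝓕 : Filtration ℝ≥0 mΩ} {σ : CountMeas}
  {Y : ℝ≥0 → Ω → CountMeas}

lemma integral_one_sub_exp_neg_pairing_le (hD : IsSubcriticalBranching G α p κ a₀ C₂)
    (hP : IsImmigrationSemigroup α p G L P) (hY : IsRightContMarkov μ 𝓕 P σ Y)
    (hf : Measurable f) (h0 : ∀ x, 0 ≤ f x) (hC : ∀ x, f x ≤ C) (t : ℝ≥0) :
    ∫ ω, (1 - Real.exp (-pairing (Y t ω) f)) ∂μ ≤
      pairing σ (meanPath G (meanRate α p) f t) +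
        ∫ s in (0 : ℝ)..t, ∫ x, meanPath G (meanRate α p) f s x ∂intensity L := by
  have hm : Measurable fun ω => pairing (Y t ω) f := (measurable_pairing hf).comp (hY.measurable t)
  rw [integral_sub (integrable_const 1)
      (integrable_exp_neg hm fun ω => pairing_nonneg _ h0), hY.integral_exp_neg_pairing hP t
      (isBddBorel_of_nonneg_of_le hf h0 hC) h0 (hD.isCumulant_trainCumulant_zero hf h0 hC),
    integral_const, probReal_univ, one_smul]
  exact (one_sub_exp_neg_le _).trans (hD.exponent_trainCumulant_le hf h0 hC σ t.coe_nonneg)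

lemma lintegral_pairing_le (hD : IsSubcriticalBranching G α p κ a₀ C₂)
    (hP : IsImmigrationSemigroup α p G L P) (hY : IsRightContMarkov μ 𝓕 P σ Y)
    (hf : Measurable f) (h0 : ∀ x, 0 ≤ f x) (hC : ∀ x, f x ≤ C) (t : ℝ≥0) :
    ∫⁻ ω, ENNReal.ofReal (pairing (Y t ω) f) ∂μ ≤ ENNReal.ofReal
      (pairing σ (meanPath G (meanRate α p) f t) +
        ∫ s in (0 : ℝ)..t, ∫ x, meanPath G (meanRate α p) f s x ∂intensity L) := by
  have hV0 := (isMildSolution_meanPath hD.mean hf h0 hC).nonneg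
  refine lintegral_ofReal_le_of_forall_mul_integral_le
    ((measurable_pairing hf).comp (hY.measurable t)) (fun ω => pairing_nonneg _ h0) fun n => ?_
  set M := pairing σ (meanPath G (meanRate α p) f t) +
    ∫ s in (0 : ℝ)..t, ∫ x, meanPath G (meanRate α p) f s x ∂intensity L
  have hn : (0 : ℝ) ≤ (n : ℝ)⁻¹ := inv_nonneg.2 n.cast_nonneg
  have hM0 : 0 ≤ M := add_nonneg (pairing_nonneg _ (hV0 t)) <|
    intervalIntegral.integral_nonneg t.coe_nonneg fun s _ => integral_nonneg (hV0 s)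
  have hstep := hY.integral_one_sub_exp_neg_pairing_le hD hP (hf.const_mul (n : ℝ)⁻¹)
    (fun x => mul_nonneg hn (h0 x)) (fun x => mul_le_mul_of_nonneg_left (hC x) hn) t
  simp only [meanPath_const_mul hD.mean hf h0 hC hn, pairing, integral_const_mul,
    intervalIntegral.integral_const_mul, ← mul_add] at hstep
  calc n * ∫ ω, (1 - Real.exp (-((n : ℝ)⁻¹ * pairing (Y t ω) f))) ∂μ ≤ n * ((n : ℝ)⁻¹ * M) :=
        mul_le_mul_of_nonneg_left hstep n.cast_nonneg
    _ ≤ M := by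
        rw [← mul_assoc]
        exact mul_le_of_le_one_left hM0 mul_inv_le_one

end IsRightContMarkov

end FirstMoment

/-! ### Total means -/

/-- `Π_∞ f`, the integral over all times of the mean path started from `f ≥ 0`. -/
noncomputable def totalPath (G : Measure PosReal) (k f : PosReal → ℝ) (x : PosReal) : ℝ :=
  ∫ s in Set.Ioi (0 : ℝ), meanPath G k f s x

section TotalMean

variable {G : Measure PosReal} [IsProbabilityMeasure G] {k f : PosReal → ℝ} {κ C : ℝ}

lemma integrableOn_meanPath (hk : IsSubcritical G k κ) (hf : Measurable f) (h0 : ∀ x, 0 ≤ f x)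
    (hC : ∀ x, f x ≤ C) (x : PosReal) :
    IntegrableOn (fun s => meanPath G k f s x) (Set.Ioi (0 : ℝ)) := by
  have hπ := isMildSolution_meanPath hk hf h0 hC
  exact (lintegral_ofReal_ne_top_iff_integrable
    (hπ.measurable.comp measurable_prodMk_right).aestronglyMeasurable
    (ae_of_all _ fun s => hπ.nonneg s x)).1
    ((lintegral_meanPath_le hk hf h0 hC x).trans_lt ENNReal.ofReal_lt_top).ne

lemma totalPath_nonneg (hk : IsSubcritical G k κ) (hf : Measurable f) (h0 : ∀ x, 0 ≤ f x)
    (hC : ∀ x, f x ≤ C) (x : PosReal) : 0 ≤ totalPath G k f x :=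
  integral_nonneg fun s => (isMildSolution_meanPath hk hf h0 hC).nonneg s x

lemma integrable_uncurry_meanPath (hk : IsSubcritical G k κ) (hf : Measurable f)
    (h0 : ∀ x, 0 ≤ f x) (hC : ∀ x, f x ≤ C) {Λ : Measure PosReal} [SFinite Λ]
    (hΛ : Integrable (fun x : PosReal => (x : ℝ)) Λ) :
    Integrable (Function.uncurry (meanPath G k f))
      ((volume.restrict (Set.Ioi (0 : ℝ))).prod Λ) := by
  have hπ := isMildSolution_meanPath hk hf h0 hC
  refine (lintegral_ofReal_ne_top_iff_integrable hπ.measurable.aestronglyMeasurable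
    (ae_of_all _ fun q => hπ.nonneg q.1 q.2)).1 (ne_of_lt ?_)
  rw [lintegral_prod_symm _ hπ.measurable.ennreal_ofReal.aemeasurable]
  exact (lintegral_mono (lintegral_meanPath_le hk hf h0 hC)).trans_lt
    (hΛ.const_mul (C * (1 + κ * renewalSum G k fun z => z))).lintegral_lt_top

variable {Λ : Measure PosReal} [IsFiniteMeasure Λ]

lemma integrable_totalPath (hk : IsSubcritical G k κ) (hf : Measurable f) (h0 : ∀ x, 0 ≤ f x)
    (hC : ∀ x, f x ≤ C) (hΛ : Integrable (fun x : PosReal => (x : ℝ)) Λ) :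
    Integrable (totalPath G k f) Λ :=
  (integrable_uncurry_meanPath hk hf h0 hC hΛ).integral_prod_right

lemma integrableOn_integral_meanPath (hk : IsSubcritical G k κ) (hf : Measurable f)
    (h0 : ∀ x, 0 ≤ f x) (hC : ∀ x, f x ≤ C) (hΛ : Integrable (fun x : PosReal => (x : ℝ)) Λ) :
    IntegrableOn (fun s => ∫ x, meanPath G k f s x ∂Λ) (Set.Ioi (0 : ℝ)) :=
  (integrable_uncurry_meanPath hk hf h0 hC hΛ).integral_prod_left

lemma integral_integral_meanPath (hk : IsSubcritical G k κ) (hf : Measurable f)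
    (h0 : ∀ x, 0 ≤ f x) (hC : ∀ x, f x ≤ C) (hΛ : Integrable (fun x : PosReal => (x : ℝ)) Λ) :
    ∫ s in Set.Ioi (0 : ℝ), ∫ x, meanPath G k f s x ∂Λ = ∫ x, totalPath G k f x ∂Λ :=
  integral_integral_swap (integrable_uncurry_meanPath hk hf h0 hC hΛ)

lemma intervalIntegral_integral_meanPath_le (hk : IsSubcritical G k κ) (hf : Measurable f)
    (h0 : ∀ x, 0 ≤ f x) (hC : ∀ x, f x ≤ C) (hΛ : Integrable (fun x : PosReal => (x : ℝ)) Λ)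
    {t : ℝ} (ht : 0 ≤ t) :
    ∫ s in (0 : ℝ)..t, ∫ x, meanPath G k f s x ∂Λ ≤ ∫ x, totalPath G k f x ∂Λ := by
  rw [← integral_integral_meanPath hk hf h0 hC hΛ, intervalIntegral.integral_of_le ht]
  exact setIntegral_mono_set (integrableOn_integral_meanPath hk hf h0 hC hΛ)
    (ae_of_all _ fun s => integral_nonneg ((isMildSolution_meanPath hk hf h0 hC).nonneg s))
    Set.Ioc_subset_Ioi_self.eventuallyLE

lemma sum_intervalIntegral_unit_shift {Q : ℝ → ℝ} {n : ℕ}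
    (hQ : ∀ i < n, IntervalIntegrable Q volume (i : ℝ) (i + 1 : ℕ)) :
    ∑ i ∈ Finset.range n, ∫ s in (0 : ℝ)..1, Q (s + i) = ∫ s in (0 : ℝ)..n, Q s := by
  have hsum := intervalIntegral.sum_integral_adjacent_intervals (a := fun i : ℕ => (i : ℝ)) hQ
  rw [Nat.cast_zero] at hsum
  rw [← hsum]
  refine Finset.sum_congr rfl fun i _ => ?_
  rw [intervalIntegral.integral_comp_add_right, zero_add, Nat.cast_succ, add_comm 1]

lemma intervalIntegral_integral_trainMean (hk : IsSubcritical G k κ) (hf : Measurable f)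
    (h0 : ∀ x, 0 ≤ f x) (hC : ∀ x, f x ≤ C) (m : ℕ) :
    ∫ s in (0 : ℝ)..1, ∫ x, trainMean G k f m (m + s) x ∂Λ =
      ∫ s in (0 : ℝ)..(m + 1 : ℕ), ∫ x, meanPath G k f s x ∂Λ := by
  have hπ := (isMildSolution_meanPath hk hf h0 hC).toIsPath
  have hi := hπ.intervalIntegrable_integral Λ
  rw [← sum_intervalIntegral_unit_shift fun i _ => hi i (i + 1 : ℕ),
    ← intervalIntegral.integral_finsetSum fun i _ => ?_]
  · refine intervalIntegral.integral_congr fun s _ => ?_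
    simp only [trainMean_add]
    exact integral_finsetSum _ fun i _ => hπ.integrable _ _
  · simpa using (hi (0 + i) (1 + i)).comp_add_right (c := (i : ℝ))

lemma tendsto_intervalIntegral_integral_trainMean (hk : IsSubcritical G k κ) (hf : Measurable f)
    (h0 : ∀ x, 0 ≤ f x) (hC : ∀ x, f x ≤ C) (hΛ : Integrable (fun x : PosReal => (x : ℝ)) Λ) :
    Tendsto (fun m : ℕ => ∫ s in (0 : ℝ)..1, ∫ x, trainMean G k f m (m + s) x ∂Λ) atTop
      (𝓝 (∫ x, totalPath G k f x ∂Λ)) := by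
  simp only [intervalIntegral_integral_trainMean hk hf h0 hC,
    ← integral_integral_meanPath hk hf h0 hC hΛ]
  exact intervalIntegral_tendsto_integral_Ioi 0 (integrableOn_integral_meanPath hk hf h0 hC hΛ)
    (tendsto_natCast_atTop_atTop.comp (tendsto_add_atTop_nat 1))

end TotalMean

/-! ### The assumptions on the branching and immigration laws -/

lemma integrable_coe_pow_of_lintegral_exp {Λ : Measure PosReal} {a : ℝ} (ha : 0 < a)
    (h : ∫⁻ x : PosReal, ENNReal.ofReal (Real.exp (a * x)) ∂Λ < ∞) (n : ℕ) :
    Integrable (fun x : PosReal => (x : ℝ) ^ n) Λ := by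
  have hm : ∀ b : ℝ, Measurable fun x : PosReal => Real.exp (b * x) := fun b =>
    (measurable_subtype_coe.const_mul b).exp
  have hi : Integrable (fun x : PosReal => Real.exp (a * x)) Λ :=
    (lintegral_ofReal_ne_top_iff_integrable (hm a).aestronglyMeasurable
      (ae_of_all _ fun x => (Real.exp_pos _).le)).1 h.ne
  refine integrable_pow_of_integrable_exp_mul ha.ne' hi
    (hi.mono' (hm (-a)).aestronglyMeasurable (ae_of_all _ fun x => ?_)) n
  rw [Real.norm_of_nonneg (Real.exp_pos _).le, Real.exp_le_exp]
  nlinarith [show (0 : ℝ) < x from x.2]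

lemma exists_isSubcriticalBranching {α : PosReal → ℝ} (hα : IsBirthRate α)
    {p : PosReal → ℕ → ℝ} (hp : IsOffspringLaw p) {G : Measure PosReal} [SFinite G]
    (hsub : ∫⁻ s in Set.Ioi (0 : ℝ), renewalDensity α p G s < 1)
    (hG : Integrable (fun x : PosReal => (x : ℝ) ^ 2) G) (hg : SecondDerivBdd p) :
    ∃ κ a₀ C₂ : ℝ, IsSubcriticalBranching G α p κ a₀ C₂ := by
  obtain ⟨a₀, ha₀⟩ := hα.1.2.1
  obtain ⟨C₁, hC₁⟩ := hp.mean_bdd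
  obtain ⟨C₂, hC₂⟩ := hg
  have hle : ∀ x, α x ≤ a₀ := fun x => (le_abs_self _).trans (ha₀ x)
  have hαm := hα.1.measurable
  have hoff := hp.isOffspringKernel
  have hk : Measurable (meanRate α p) := hαm.mul hoff.measurable_genFunDeriv
  refine ⟨a₀ * C₁, a₀, C₂, hαm, hα.2, hle, hoff, fun x => (hC₂ x).1, fun x => (hC₂ x).2, hk,
    fun x => mul_nonneg (hα.2 x) (hoff.genFunDeriv_nonneg x), fun x => ?_, ?_, hG⟩
  · exact mul_le_mul (hle x) (hC₁ x).2 (hoff.genFunDeriv_nonneg x) ((hα.2 x).trans (hle x))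
  · refine lt_of_eq_of_lt (lintegral_lintegral_swap ?_) hsub
    exact ((measurable_zeroExt hk).comp ((measurable_subtype_coe.comp measurable_fst).sub
      measurable_snd)).ennreal_ofReal.aemeasurable

section ImmigrationIntensity

variable {L : Measure CountMeas} {a : ℝ}

lemma integrable_coe_pow_intensity (ha : 0 < a)
    (hL : ∫⁻ ν, (∫⁻ x, ENNReal.ofReal (Real.exp (a * (x : ℝ))) ∂ν.toMeas) ∂L < ∞) (n : ℕ) :
    Integrable (fun x : PosReal => (x : ℝ) ^ n) (intensity L) := by
  refine integrable_coe_pow_of_lintegral_exp ha ?_ n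
  rwa [lintegral_intensity (measurable_subtype_coe.const_mul _).exp.ennreal_ofReal]

lemma isFiniteMeasure_intensity (ha : 0 < a)
    (hL : ∫⁻ ν, (∫⁻ x, ENNReal.ofReal (Real.exp (a * (x : ℝ))) ∂ν.toMeas) ∂L < ∞) :
    IsFiniteMeasure (intensity L) := by
  have h := integrable_coe_pow_intensity ha hL 0
  simp only [pow_zero] at h
  exact (integrable_const_iff_isFiniteMeasure one_ne_zero).1 h

end ImmigrationIntensity

/-! ### Time averages of nonnegative processes -/

section TimeAverage

lemma exp_neg_intervalIntegral_le_of_nonneg {x : ℝ → ℝ} (h0 : ∀ s, 0 ≤ x s) {t : ℝ} {n : ℕ}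
    (hn : (n : ℝ) ≤ t) (hx : IntervalIntegrable x volume 0 t) :
    Real.exp (-∫ s in (0 : ℝ)..t, x s) ≤
      ∫ θ in Set.Ioc (0 : ℝ) 1, Real.exp (-∑ k ∈ Finset.range n, x (θ + k)) := by
  have hsub : ∀ {a b : ℝ}, 0 ≤ a → a ≤ b → b ≤ t → IntervalIntegrable x volume a b :=
    fun ha hab hb => hx.mono_set (by
      rw [Set.uIcc_of_le hab, Set.uIcc_of_le ((ha.trans hab).trans hb)]
      exact Set.Icc_subset_Icc ha hb)
  have hunit : ∀ k < n, IntervalIntegrable x volume (k : ℝ) (k + 1 : ℕ) := fun k hk =>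
    hsub k.cast_nonneg (Nat.cast_le.2 k.le_succ) ((Nat.cast_le.2 hk).trans hn)
  have hshift : ∀ k ∈ Finset.range n, IntervalIntegrable (fun θ => x (θ + k)) volume 0 1 :=
    fun k hk => by simpa using (hunit k (Finset.mem_range.1 hk)).comp_add_right (c := (k : ℝ))
  have hsum : ∫ θ in Set.Ioc (0 : ℝ) 1, ∑ k ∈ Finset.range n, x (θ + k) =
      ∫ s in (0 : ℝ)..n, x s := by
    rw [← intervalIntegral.integral_of_le zero_le_one, intervalIntegral.integral_finsetSum hshift,
      sum_intervalIntegral_unit_shift hunit]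
  have hint : IntegrableOn (fun θ => ∑ k ∈ Finset.range n, x (θ + k)) (Set.Ioc 0 1) :=
    integrable_finsetSum _ fun k hk =>
      (intervalIntegrable_iff_integrableOn_Ioc_of_le zero_le_one).1 (hshift k hk)
  have : IsProbabilityMeasure (volume.restrict (Set.Ioc (0 : ℝ) 1)) := ⟨by simp⟩
  calc Real.exp (-∫ s in (0 : ℝ)..t, x s)
      ≤ Real.exp (∫ θ in Set.Ioc (0 : ℝ) 1, -∑ k ∈ Finset.range n, x (θ + k)) := by
        rw [integral_neg, hsum, Real.exp_le_exp, neg_le_neg_iff,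
          ← intervalIntegral.integral_add_adjacent_intervals
            (hsub le_rfl n.cast_nonneg hn) (hsub n.cast_nonneg hn le_rfl)]
        exact le_add_of_nonneg_right (intervalIntegral.integral_nonneg hn fun s _ => h0 s)
    _ ≤ ∫ θ in Set.Ioc (0 : ℝ) 1, Real.exp (-∑ k ∈ Finset.range n, x (θ + k)) :=
        convexOn_exp.map_integral_le Real.continuous_exp.continuousOn isClosed_univ
          (ae_of_all _ fun _ => Set.mem_univ _) hint.neg <|
          Integrable.of_bound (Real.measurable_exp.comp_aemeasurable
            hint.aemeasurable.neg).aestronglyMeasurable 1 (ae_of_all _ fun θ =>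
              abs_exp_neg_le_one (Finset.sum_nonneg fun k _ => h0 _))

variable {Ω : Type*} [MeasurableSpace Ω] {μ : Measure Ω} {X : ℝ → Ω → ℝ}

lemma integral_exp_neg_intervalIntegral_le [IsFiniteMeasure μ]
    (hX : Measurable (Function.uncurry X)) (h0 : ∀ s ω, 0 ≤ X s ω) {t : ℝ} {n : ℕ}
    (hn : (n : ℝ) ≤ t) (hi : ∀ᵐ ω ∂μ, IntervalIntegrable (fun s => X s ω) volume 0 t) {b : ℝ}
    (hb : ∀ θ, 0 ≤ θ → ∫ ω, Real.exp (-∑ k ∈ Finset.range n, X (θ + k) ω) ∂μ ≤ b) :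
    ∫ ω, Real.exp (-∫ s in (0 : ℝ)..t, X s ω) ∂μ ≤ b := by
  have hm : Measurable fun q : Ω × ℝ => ∑ k ∈ Finset.range n, X (q.2 + k) q.1 :=
    Finset.measurable_sum _ fun k _ =>
      hX.comp ((measurable_snd.add measurable_const).prodMk measurable_fst)
  have hE : Integrable (fun q : Ω × ℝ => Real.exp (-∑ k ∈ Finset.range n, X (q.2 + k) q.1))
      (μ.prod (volume.restrict (Set.Ioc (0 : ℝ) 1))) :=
    integrable_exp_neg hm fun q => Finset.sum_nonneg fun k _ => h0 _ _
  calc ∫ ω, Real.exp (-∫ s in (0 : ℝ)..t, X s ω) ∂μ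
      ≤ ∫ ω, (∫ θ in Set.Ioc (0 : ℝ) 1,
          Real.exp (-∑ k ∈ Finset.range n, X (θ + k) ω)) ∂μ :=
        integral_mono_of_nonneg (ae_of_all _ fun ω => Real.exp_nonneg _) hE.integral_prod_left
          (hi.mono fun ω hω => exp_neg_intervalIntegral_le_of_nonneg (fun s => h0 s ω) hn hω)
    _ = ∫ θ in Set.Ioc (0 : ℝ) 1, (∫ ω, Real.exp (-∑ k ∈ Finset.range n, X (θ + k) ω) ∂μ) :=
        integral_integral_swap hE
    _ ≤ ∫ _ in Set.Ioc (0 : ℝ) 1, b :=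
        setIntegral_mono_on hE.integral_prod_right (integrable_const b)
          measurableSet_Ioc fun θ hθ => hb θ hθ.1.le
    _ = b := by simp

section FirstMomentBound

variable [SFinite μ] {m : ℝ → ℝ}

lemma integrable_uncurry_of_lintegral_le (hX : Measurable (Function.uncurry X))
    (h0 : ∀ s ω, 0 ≤ X s ω) (h : ∀ s, 0 ≤ s → ∫⁻ ω, ENNReal.ofReal (X s ω) ∂μ ≤
      ENNReal.ofReal (m s)) {t : ℝ} (hm : IntegrableOn m (Set.Ioc 0 t)) :
    Integrable (Function.uncurry X) ((volume.restrict (Set.Ioc 0 t)).prod μ) := by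
  refine (lintegral_ofReal_ne_top_iff_integrable hX.aestronglyMeasurable
    (ae_of_all _ fun q => h0 q.1 q.2)).1 (ne_of_lt ?_)
  rw [lintegral_prod _ hX.ennreal_ofReal.aemeasurable]
  exact (setLIntegral_mono' measurableSet_Ioc fun s hs => h s hs.1.le).trans_lt
    hm.lintegral_lt_top

lemma ae_forall_intervalIntegrable (hX : Measurable (Function.uncurry X))
    (h0 : ∀ s ω, 0 ≤ X s ω) (h : ∀ s, 0 ≤ s → ∫⁻ ω, ENNReal.ofReal (X s ω) ∂μ ≤
      ENNReal.ofReal (m s)) (hm : ∀ t, IntegrableOn m (Set.Ioc 0 t)) :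
    ∀ᵐ ω ∂μ, ∀ t : ℝ, 0 ≤ t → IntervalIntegrable (fun s => X s ω) volume 0 t := by
  have hnat : ∀ᵐ ω ∂μ, ∀ n : ℕ, IntegrableOn (fun s => X s ω) (Set.Ioc 0 (n : ℝ)) :=
    ae_all_iff.2 fun n => (integrable_uncurry_of_lintegral_le hX h0 h (hm n)).prod_left_ae
  filter_upwards [hnat] with ω hω t ht
  obtain ⟨n, hn⟩ := exists_nat_ge t
  exact (intervalIntegrable_iff_integrableOn_Ioc_of_le ht).2
    ((hω n).mono_set (Set.Ioc_subset_Ioc_right hn))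

lemma integrable_intervalIntegral (hX : Measurable (Function.uncurry X))
    (h0 : ∀ s ω, 0 ≤ X s ω) (h : ∀ s, 0 ≤ s → ∫⁻ ω, ENNReal.ofReal (X s ω) ∂μ ≤
      ENNReal.ofReal (m s)) {t : ℝ} (ht : 0 ≤ t) (hm : IntegrableOn m (Set.Ioc 0 t)) :
    Integrable (fun ω => ∫ s in (0 : ℝ)..t, X s ω) μ := by
  simp only [intervalIntegral.integral_of_le ht]
  exact (integrable_uncurry_of_lintegral_le hX h0 h hm).integral_prod_right

lemma integral_intervalIntegral_le (hX : Measurable (Function.uncurry X))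
    (h0 : ∀ s ω, 0 ≤ X s ω) (h : ∀ s, 0 ≤ s → ∫⁻ ω, ENNReal.ofReal (X s ω) ∂μ ≤
      ENNReal.ofReal (m s)) (hm0 : ∀ s, 0 ≤ m s) {t : ℝ} (ht : 0 ≤ t)
    (hm : IntegrableOn m (Set.Ioc 0 t)) :
    ∫ ω, (∫ s in (0 : ℝ)..t, X s ω) ∂μ ≤ ∫ s in (0 : ℝ)..t, m s := by
  have hi := integrable_uncurry_of_lintegral_le hX h0 h hm
  simp only [intervalIntegral.integral_of_le ht]
  rw [← integral_integral_swap hi]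
  refine setIntegral_mono_on hi.integral_prod_left hm measurableSet_Ioc fun s hs => ?_
  rw [integral_eq_lintegral_of_nonneg_ae (ae_of_all _ (h0 s))
    (hX.comp measurable_prodMk_left).aestronglyMeasurable]
  exact ENNReal.toReal_le_of_le_ofReal (hm0 s) (h s hs.1.le)

end FirstMomentBound

end TimeAverage

/-! ### Concentration from Laplace transforms -/

/-- The rate `e⁻ᶻ - 1 + z`, which vanishes only at `0`: its mean at the deviation of `W` from `c`
is controlled by an upper bound on the Laplace transform of `W` and one on its mean. -/
noncomputable def expRate (z : ℝ) : ℝ := Real.exp (-z) - 1 + z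

lemma expRate_nonneg (z : ℝ) : 0 ≤ expRate z := by
  have := Real.add_one_le_exp (-z)
  unfold expRate
  linarith

lemma expRate_pos {z : ℝ} (hz : z ≠ 0) : 0 < expRate z := by
  have := Real.add_one_lt_exp (neg_ne_zero.2 hz)
  unfold expRate
  linarith

lemma expRate_add (z w : ℝ) : expRate (z + w) = Real.exp (-z) * expRate w + expRate z +
    (1 - Real.exp (-z)) * w := by
  simp only [expRate, neg_add, Real.exp_add]
  ring

lemma min_expRate_le_expRate {η z : ℝ} (hη : 0 ≤ η) (hz : η ≤ |z|) :
    min (expRate η) (expRate (-η)) ≤ expRate z := by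
  rcases le_abs'.1 hz with h | h
  · have hmono : 0 ≤ (1 - Real.exp (-(-η))) * (z - -η) :=
      mul_nonneg_of_nonpos_of_nonpos (by simpa using hη) (by linarith)
    have hpos := mul_nonneg (Real.exp_pos (-(-η))).le (expRate_nonneg (z - -η))
    rw [← add_sub_cancel (-η) z, expRate_add]
    exact (min_le_right _ _).trans (by linarith)
  · have hmono : 0 ≤ (1 - Real.exp (-η)) * (z - η) :=
      mul_nonneg (by simpa using hη) (by linarith)
    have hpos := mul_nonneg (Real.exp_pos (-η)).le (expRate_nonneg (z - η))
    rw [← add_sub_cancel η z, expRate_add]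
    exact (min_le_left _ _).trans (by linarith)

section Concentration

variable {Ω : Type*} [MeasurableSpace Ω] {μ : Measure Ω} [IsProbabilityMeasure μ]

lemma min_expRate_mul_measureReal_le {W : Ω → ℝ} (hW : Integrable W μ) (h0 : ∀ ω, 0 ≤ W ω)
    (c : ℝ) {η : ℝ} (hη : 0 ≤ η) :
    min (expRate η) (expRate (-η)) * μ.real {ω | η ≤ ‖W ω - c‖} ≤
      Real.exp c * ∫ ω, Real.exp (-W ω) ∂μ - 1 + (∫ ω, W ω ∂μ - c) := by
  have hE : Integrable (fun ω => Real.exp (-W ω)) μ :=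
    Integrable.of_bound (Real.measurable_exp.comp_aemeasurable
      hW.aemeasurable.neg).aestronglyMeasurable 1 (ae_of_all _ fun ω => abs_exp_neg_le_one (h0 ω))
  have hrate : ∀ ω, expRate (W ω - c) = Real.exp c * Real.exp (-W ω) - 1 + (W ω - c) := fun ω => by
    rw [expRate, ← Real.exp_add, neg_sub, ← sub_eq_add_neg]
  have hE1 : Integrable (fun ω => Real.exp c * Real.exp (-W ω) - 1) μ :=
    (hE.const_mul _).sub (integrable_const 1)
  have hWc : Integrable (fun ω => W ω - c) μ := hW.sub (integrable_const c)
  calc min (expRate η) (expRate (-η)) * μ.real {ω | η ≤ ‖W ω - c‖}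
      ≤ min (expRate η) (expRate (-η)) *
          μ.real {ω | min (expRate η) (expRate (-η)) ≤ expRate (W ω - c)} :=
        mul_le_mul_of_nonneg_left (measureReal_mono fun ω hω => min_expRate_le_expRate hη hω)
          (le_min (expRate_nonneg _) (expRate_nonneg _))
    _ ≤ ∫ ω, expRate (W ω - c) ∂μ :=
        mul_meas_ge_le_integral_of_nonneg (ae_of_all μ fun ω => expRate_nonneg _)
          (by simp only [hrate]; exact hE1.add hWc) _
    _ = Real.exp c * ∫ ω, Real.exp (-W ω) ∂μ - 1 + (∫ ω, W ω ∂μ - c) := by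
        simp only [hrate]
        rw [integral_add hE1 hWc, integral_sub (hE.const_mul _) (integrable_const 1),
          integral_sub hW (integrable_const c), integral_const_mul]
        simp

lemma tendstoInMeasure_of_eventually_laplace_le {ι : Type*} {l : Filter ι} {W : ι → Ω → ℝ}
    {M : ι → ℝ} {c : ℝ} (hi : ∀ᶠ t in l, Integrable (W t) μ) (h0 : ∀ᶠ t in l, ∀ ω, 0 ≤ W t ω)
    (hM : ∀ᶠ t in l, ∫ ω, W t ω ∂μ ≤ M t) (hMc : Tendsto M l (𝓝 c))
    (hlap : ∀ b, Real.exp (-c) < b → ∀ᶠ t in l, ∫ ω, Real.exp (-W t ω) ∂μ ≤ b) :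
    TendstoInMeasure μ W l fun _ => c := by
  rw [tendstoInMeasure_iff_measureReal_norm]
  intro η hη
  set δ := min (expRate η) (expRate (-η))
  have hδ : 0 < δ := lt_min (expRate_pos hη.ne') (expRate_pos (neg_ne_zero.2 hη.ne'))
  refine Metric.tendsto_nhds.2 fun ε hε => ?_
  have hb : Real.exp (-c) < Real.exp (-c) * (1 + δ * ε / 2) :=
    lt_mul_of_one_lt_right (Real.exp_pos _) (by linarith [mul_pos hδ hε])
  have hc : c < c + δ * ε / 2 := by linarith [mul_pos hδ hε]
  filter_upwards [hi, h0, hM, hMc.eventually_lt_const hc, hlap _ hb] with t hi h0 hM hMc hlap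
  rw [Real.dist_0_eq_abs, abs_of_nonneg measureReal_nonneg]
  refine lt_of_mul_lt_mul_left ((min_expRate_mul_measureReal_le hi h0 c hη.le).trans_lt ?_) hδ.le
  have hexp := mul_le_mul_of_nonneg_left hlap (Real.exp_pos c).le
  rw [← mul_assoc, ← Real.exp_add, add_neg_cancel, Real.exp_zero, one_mul] at hexp
  linarith

lemma tendstoInMeasure_sub_const {ι : Type*} {l : Filter ι} {V W : ι → Ω → ℝ} {a b : ℝ}
    (hV : TendstoInMeasure μ V l fun _ => a) (hW : TendstoInMeasure μ W l fun _ => b) :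
    TendstoInMeasure μ (fun t ω => V t ω - W t ω) l fun _ => a - b := by
  rw [tendstoInMeasure_iff_measureReal_norm] at hV hW ⊢
  intro ε hε
  have hsum := (hV (ε / 2) (half_pos hε)).add (hW (ε / 2) (half_pos hε))
  rw [add_zero] at hsum
  refine squeeze_zero (fun _ => measureReal_nonneg) (fun t => ?_) hsum
  refine (measureReal_mono fun ω (hω : ε ≤ ‖V t ω - W t ω - (a - b)‖) => ?_).trans
    (measureReal_union_le _ _)
  by_contra! hcon
  simp only [Set.mem_union, Set.mem_ofPred_eq, not_or, not_le] at hcon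
  have htri := norm_sub_le (V t ω - a) (W t ω - b)
  rw [← sub_sub_sub_comm] at htri
  linarith

end Concentration

/-! ### Occupation times of nonnegative test functions -/

lemma tendsto_floor_pred_sub_mul_inv (m : ℕ) :
    Tendsto (fun t : ℝ => (((⌊t⌋₊ - 1 : ℕ) : ℝ) - m) * t⁻¹) atTop (𝓝 1) := by
  have hlim : Tendsto (fun t : ℝ => (⌊t⌋₊ : ℝ) / t - (1 + m) * t⁻¹) atTop (𝓝 1) := by
    simpa using tendsto_nat_floor_div_atTop.sub (tendsto_inv_atTop_zero.const_mul (1 + (m : ℝ)))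
  refine hlim.congr' ?_
  filter_upwards [eventually_ge_atTop 1] with t ht
  rw [Nat.cast_sub ((Nat.one_le_floor_iff t).2 ht), Nat.cast_one]
  ring

lemma tendsto_exp_neg_floor_mul_immExponent {L : Measure CountMeas} [IsFiniteMeasure L]
    [IsFiniteMeasure (intensity L)] {G : Measure PosReal} [IsProbabilityMeasure G]
    {k f : PosReal → ℝ} {κ B C : ℝ} (hk : IsSubcritical G k κ) (hB : 0 ≤ B) (hf : Measurable f)
    (h0 : ∀ x, 0 ≤ f x) (hC : ∀ x, f x ≤ C) (m : ℕ) :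
    Tendsto (fun t : ℝ => Real.exp (-((((⌊t⌋₊ - 1 : ℕ) : ℝ) - m) * ∫ s in (0 : ℝ)..1,
        immExponent L (firstOrderMinorant (trainMean G k f m (m + s)) B t⁻¹)))) atTop
      (𝓝 (Real.exp (-∫ s in (0 : ℝ)..1, ∫ x, trainMean G k f m (m + s) x ∂intensity L))) := by
  have hS := isMildSolution_trainMean hk hf h0 hC m
  obtain ⟨C', hC'⟩ := hS.locBdd (m + 1)
  have hlim := (tendsto_floor_pred_sub_mul_inv m).mul (tendsto_mul_intervalIntegral_immExponent
    (L := L) hB (measurable_uncurry_comp_const_add hS.measurable m) (fun s => hS.nonneg (m + s))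
    fun s hs x => (le_abs_self _).trans (hC' (m + s) (add_le_add_right hs _) x))
  rw [one_mul] at hlim
  refine hlim.neg.rexp.congr' ?_
  filter_upwards [eventually_gt_atTop 0] with t ht
  rw [mul_assoc, inv_mul_cancel_left₀ ht.ne']

section Occupation

variable {G : Measure PosReal} [IsProbabilityMeasure G] {α : PosReal → ℝ} {p : PosReal → ℕ → ℝ}
  {κ a₀ C₂ : ℝ} {L : Measure CountMeas} [IsFiniteMeasure L] {P : ℝ≥0 → Kernel CountMeas CountMeas}
  {Ω : Type*} [mΩ : MeasurableSpace Ω] {μ : Measure Ω} [IsProbabilityMeasure μ]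
  {𝓕 : Filtration ℝ≥0 mΩ} {σ : CountMeas} {Y : ℝ≥0 → Ω → CountMeas} {f : PosReal → ℝ} {C : ℝ}

namespace IsRightContMarkov

omit [IsProbabilityMeasure μ] in
lemma measurable_uncurry_pairing (hY : IsRightContMarkov μ 𝓕 P σ Y) (hf : Measurable f) :
    Measurable (Function.uncurry fun (s : ℝ) (ω : Ω) => pairing (Y s.toNNReal ω) f) :=
  (measurable_pairing hf).comp
    ((measurable_uncurry_of_rightContinuous hY.measurable hY.rightCont).comp
      ((measurable_real_toNNReal.comp measurable_fst).prodMk measurable_snd))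

lemma exists_integral_exp_neg_occupation_le (hD : IsSubcriticalBranching G α p κ a₀ C₂)
    (hP : IsImmigrationSemigroup α p G L P) (hY : IsRightContMarkov μ 𝓕 P σ Y)
    (hf : Measurable f) (h0 : ∀ x, 0 ≤ f x) (hC : ∀ x, f x ≤ C)
    (hi : ∀ᵐ ω ∂μ, ∀ t : ℝ, 0 ≤ t →
      IntervalIntegrable (fun s : ℝ => pairing (Y s.toNNReal ω) f) volume 0 t) :
    ∃ B : ℝ, 0 ≤ B ∧ ∀ (m : ℕ) (t : ℝ), 1 ≤ t →
      ∫ ω, Real.exp (-(t⁻¹ * occupation Y f t ω)) ∂μ ≤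
        Real.exp (-((((⌊t⌋₊ - 1 : ℕ) : ℝ) - m) * ∫ s in (0 : ℝ)..1, immExponent L
          (firstOrderMinorant (trainMean G (meanRate α p) f m (m + s)) B t⁻¹))) := by
  obtain ⟨B, hB0, hB⟩ := hY.exists_integral_exp_neg_sum_le hD hP hf h0 hC
  refine ⟨B, hB0, fun m t ht => ?_⟩
  have ht0 : 0 < t := one_pos.trans_le ht
  have hfloor : ⌊t⌋₊ - 1 + 1 = ⌊t⌋₊ := Nat.sub_add_cancel ((Nat.one_le_floor_iff t).2 ht)
  have hscale : ∀ ω, t⁻¹ * occupation Y f t ω =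
      ∫ s in (0 : ℝ)..t, pairing (Y s.toNNReal ω) fun x => t⁻¹ * f x := fun ω => by
    simp only [occupation, pairing, integral_const_mul, intervalIntegral.integral_const_mul]
  simp only [hscale]
  refine integral_exp_neg_intervalIntegral_le (hY.measurable_uncurry_pairing (hf.const_mul _))
    (fun s ω => pairing_nonneg _ fun x => mul_nonneg (inv_nonneg.2 ht0.le) (h0 x))
    (Nat.floor_le ht0.le) (hi.mono fun ω hω => ?_) fun θ hθ => ?_
  · simpa only [pairing, integral_const_mul] using (hω t ht0.le).const_mul t⁻¹
  · have hgrid := hB m (⌊t⌋₊ - 1) t⁻¹ θ.toNNReal (inv_nonneg.2 ht0.le)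
    rw [hfloor] at hgrid
    simpa only [Real.toNNReal_add hθ (Nat.cast_nonneg _), Real.toNNReal_natCast] using hgrid

variable [IsFiniteMeasure (intensity L)]

lemma lintegral_pairing_le_add_integral_totalPath (hD : IsSubcriticalBranching G α p κ a₀ C₂)
    (hΛ : Integrable (fun x : PosReal => (x : ℝ)) (intensity L))
    (hP : IsImmigrationSemigroup α p G L P) (hY : IsRightContMarkov μ 𝓕 P σ Y)
    (hf : Measurable f) (h0 : ∀ x, 0 ≤ f x) (hC : ∀ x, f x ≤ C) {s : ℝ} (hs : 0 ≤ s) :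
    ∫⁻ ω, ENNReal.ofReal (pairing (Y s.toNNReal ω) f) ∂μ ≤ ENNReal.ofReal
      (pairing σ (meanPath G (meanRate α p) f s) +
        ∫ x, totalPath G (meanRate α p) f x ∂intensity L) := by
  refine (hY.lintegral_pairing_le hD hP hf h0 hC s.toNNReal).trans (ENNReal.ofReal_le_ofReal ?_)
  rw [Real.coe_toNNReal s hs]
  exact add_le_add_right (intervalIntegral_integral_meanPath_le hD.mean hf h0 hC hΛ hs) _

lemma integrableOn_firstMomentBound (hk : IsSubcritical G (meanRate α p) κ) (hf : Measurable f)
    (h0 : ∀ x, 0 ≤ f x) (hC : ∀ x, f x ≤ C) (c t : ℝ) :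
    IntegrableOn (fun s => pairing σ (meanPath G (meanRate α p) f s) + c) (Set.Ioc 0 t) :=
  ((integrableOn_integral_meanPath hk hf h0 hC σ.integrable_coe).mono_set
    Set.Ioc_subset_Ioi_self).add (integrable_const c)

lemma ae_intervalIntegrable_pairing (hD : IsSubcriticalBranching G α p κ a₀ C₂)
    (hΛ : Integrable (fun x : PosReal => (x : ℝ)) (intensity L))
    (hP : IsImmigrationSemigroup α p G L P) (hY : IsRightContMarkov μ 𝓕 P σ Y)
    (hf : Measurable f) (h0 : ∀ x, 0 ≤ f x) (hC : ∀ x, f x ≤ C) :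
    ∀ᵐ ω ∂μ, ∀ t : ℝ, 0 ≤ t →
      IntervalIntegrable (fun s : ℝ => pairing (Y s.toNNReal ω) f) volume 0 t :=
  ae_forall_intervalIntegrable (hY.measurable_uncurry_pairing hf) (fun _ _ => pairing_nonneg _ h0)
    (fun _ => hY.lintegral_pairing_le_add_integral_totalPath hD hΛ hP hf h0 hC)
    (integrableOn_firstMomentBound hD.mean hf h0 hC _)

lemma integrable_occupation (hD : IsSubcriticalBranching G α p κ a₀ C₂)
    (hΛ : Integrable (fun x : PosReal => (x : ℝ)) (intensity L))
    (hP : IsImmigrationSemigroup α p G L P) (hY : IsRightContMarkov μ 𝓕 P σ Y)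
    (hf : Measurable f) (h0 : ∀ x, 0 ≤ f x) (hC : ∀ x, f x ≤ C) {t : ℝ} (ht : 0 ≤ t) :
    Integrable (occupation Y f t) μ :=
  integrable_intervalIntegral (hY.measurable_uncurry_pairing hf) (fun _ _ => pairing_nonneg _ h0)
    (fun _ => hY.lintegral_pairing_le_add_integral_totalPath hD hΛ hP hf h0 hC) ht
    (integrableOn_firstMomentBound hD.mean hf h0 hC _ t)

lemma integral_occupation_le (hD : IsSubcriticalBranching G α p κ a₀ C₂)
    (hΛ : Integrable (fun x : PosReal => (x : ℝ)) (intensity L))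
    (hP : IsImmigrationSemigroup α p G L P) (hY : IsRightContMarkov μ 𝓕 P σ Y)
    (hf : Measurable f) (h0 : ∀ x, 0 ≤ f x) (hC : ∀ x, f x ≤ C) {t : ℝ} (ht : 0 ≤ t) :
    ∫ ω, occupation Y f t ω ∂μ ≤ pairing σ (totalPath G (meanRate α p) f) +
      t * ∫ x, totalPath G (meanRate α p) f x ∂intensity L := by
  set c := ∫ x, totalPath G (meanRate α p) f x ∂intensity L
  have hV0 : ∀ s, 0 ≤ pairing σ (meanPath G (meanRate α p) f s) := fun s =>
    pairing_nonneg σ ((isMildSolution_meanPath hD.mean hf h0 hC).nonneg s)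
  have hVi : IntervalIntegrable (fun s => pairing σ (meanPath G (meanRate α p) f s)) volume 0 t :=
    (isMildSolution_meanPath hD.mean hf h0 hC).toIsPath.intervalIntegrable_integral _ 0 t
  have hc : 0 ≤ c := integral_nonneg (totalPath_nonneg hD.mean hf h0 hC)
  calc ∫ ω, occupation Y f t ω ∂μ
      ≤ ∫ s in (0 : ℝ)..t, (pairing σ (meanPath G (meanRate α p) f s) + c) :=
        integral_intervalIntegral_le (hY.measurable_uncurry_pairing hf)
          (fun _ _ => pairing_nonneg _ h0)
          (fun _ => hY.lintegral_pairing_le_add_integral_totalPath hD hΛ hP hf h0 hC)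
          (fun s => add_nonneg (hV0 s) hc) ht (integrableOn_firstMomentBound hD.mean hf h0 hC c t)
    _ = (∫ s in (0 : ℝ)..t, pairing σ (meanPath G (meanRate α p) f s)) + t * c := by
        rw [intervalIntegral.integral_add hVi intervalIntegrable_const,
          intervalIntegral.integral_const, sub_zero, smul_eq_mul]
    _ ≤ pairing σ (totalPath G (meanRate α p) f) + t * c :=
        add_le_add_left (intervalIntegral_integral_meanPath_le hD.mean hf h0 hC σ.integrable_coe ht)
          _

lemma eventually_integral_exp_neg_occupation_le (hD : IsSubcriticalBranching G α p κ a₀ C₂)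
    (hΛ : Integrable (fun x : PosReal => (x : ℝ)) (intensity L))
    (hP : IsImmigrationSemigroup α p G L P) (hY : IsRightContMarkov μ 𝓕 P σ Y)
    (hf : Measurable f) (h0 : ∀ x, 0 ≤ f x) (hC : ∀ x, f x ≤ C) {b : ℝ}
    (hb : Real.exp (-∫ x, totalPath G (meanRate α p) f x ∂intensity L) < b) :
    ∀ᶠ t in atTop, ∫ ω, Real.exp (-(t⁻¹ * occupation Y f t ω)) ∂μ ≤ b := by
  obtain ⟨B, hB0, hB⟩ := hY.exists_integral_exp_neg_occupation_le hD hP hf h0 hC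
    (hY.ae_intervalIntegrable_pairing hD hΛ hP hf h0 hC)
  obtain ⟨m, hm⟩ := ((tendsto_intervalIntegral_integral_trainMean hD.mean hf h0 hC hΛ).neg.rexp
    |>.eventually_lt_const hb).exists
  filter_upwards [eventually_ge_atTop 1, (tendsto_exp_neg_floor_mul_immExponent hD.mean hB0
    hf h0 hC m).eventually_lt_const hm] with t ht hlt
  exact (hB m t ht).trans hlt.le

lemma tendstoInMeasure_occupation_of_nonneg (hD : IsSubcriticalBranching G α p κ a₀ C₂)
    (hΛ : Integrable (fun x : PosReal => (x : ℝ)) (intensity L))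
    (hP : IsImmigrationSemigroup α p G L P) (hY : IsRightContMarkov μ 𝓕 P σ Y)
    (hf : Measurable f) (h0 : ∀ x, 0 ≤ f x) (hC : ∀ x, f x ≤ C) :
    TendstoInMeasure μ (fun (t : ℝ) ω => t⁻¹ * occupation Y f t ω) atTop
      fun _ => ∫ x, totalPath G (meanRate α p) f x ∂intensity L := by
  set c := ∫ x, totalPath G (meanRate α p) f x ∂intensity L
  have hM : Tendsto (fun t : ℝ => t⁻¹ * pairing σ (totalPath G (meanRate α p) f) + c) atTop
      (𝓝 c) := by
    simpa using (tendsto_inv_atTop_zero.mul_const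
      (pairing σ (totalPath G (meanRate α p) f))).add_const c
  refine tendstoInMeasure_of_eventually_laplace_le ?_ ?_ ?_ hM fun b =>
    hY.eventually_integral_exp_neg_occupation_le hD hΛ hP hf h0 hC
  · filter_upwards [eventually_ge_atTop 0] with t ht
    exact (hY.integrable_occupation hD hΛ hP hf h0 hC ht).const_mul _
  · filter_upwards [eventually_ge_atTop 0] with t ht ω
    exact mul_nonneg (inv_nonneg.2 ht)
      (intervalIntegral.integral_nonneg ht fun s _ => pairing_nonneg _ h0)
  · filter_upwards [eventually_gt_atTop 0] with t ht
    rw [integral_const_mul]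
    refine (mul_le_mul_of_nonneg_left (hY.integral_occupation_le hD hΛ hP hf h0 hC ht.le)
      (inv_nonneg.2 ht.le)).trans_eq ?_
    rw [mul_add, inv_mul_cancel_left₀ ht.ne']

end IsRightContMarkov

end Occupation

/-! ### Signed test functions -/

namespace IsBddBorel

variable {f : PosReal → ℝ}

lemma measurable_posPart (hf : IsBddBorel f) : Measurable fun x => (f x)⁺ :=
  hf.1.max measurable_const

lemma measurable_negPart (hf : IsBddBorel f) : Measurable fun x => (f x)⁻ :=
  hf.1.neg.max measurable_const

lemma exists_posPart_negPart_le (hf : IsBddBorel f) :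
    ∃ C : ℝ, (∀ x, (f x)⁺ ≤ C) ∧ ∀ x, (f x)⁻ ≤ C := by
  obtain ⟨C, hC⟩ := hf.2
  exact ⟨C, fun x => (max_le (le_abs_self _) (abs_nonneg _)).trans (hC x),
    fun x => (max_le (neg_le_abs _) (abs_nonneg _)).trans (hC x)⟩

lemma integrable (hf : IsBddBorel f) (Λ : Measure PosReal) [IsFiniteMeasure Λ] :
    Integrable f Λ :=
  let ⟨C, hC⟩ := hf.2
  Integrable.of_bound hf.1.aestronglyMeasurable C (ae_of_all _ hC)

lemma posPart (hf : IsBddBorel f) : IsBddBorel fun x => (f x)⁺ :=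
  let ⟨_, hC, _⟩ := hf.exists_posPart_negPart_le
  isBddBorel_of_nonneg_of_le hf.measurable_posPart (fun _ => posPart_nonneg _) hC

lemma negPart (hf : IsBddBorel f) : IsBddBorel fun x => (f x)⁻ :=
  let ⟨_, _, hC⟩ := hf.exists_posPart_negPart_le
  isBddBorel_of_nonneg_of_le hf.measurable_negPart (fun _ => negPart_nonneg _) hC

lemma pairing_eq_sub (hf : IsBddBorel f) (ν : CountMeas) :
    pairing ν f = pairing ν (fun x => (f x)⁺) - pairing ν (fun x => (f x)⁻) := by
  rw [pairing, pairing, pairing, ← integral_sub (hf.posPart.integrable _) (hf.negPart.integrable _)]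
  simp only [posPart_sub_negPart]

end IsBddBorel

/-- The solution of the mean equation with an initial value `f` of either sign, obtained from the
nonnegative solutions started from the positive and negative parts of `f` by linearity. -/
noncomputable def signedMeanPath (G : Measure PosReal) (k f : PosReal → ℝ) (t : ℝ) (x : PosReal) :
    ℝ :=
  meanPath G k (fun y => (f y)⁺) t x - meanPath G k (fun y => (f y)⁻) t x

section SignedMean

variable {G : Measure PosReal} [IsProbabilityMeasure G] {k f : PosReal → ℝ} {κ : ℝ}

lemma isMeanPath_signedMeanPath (hk : IsSubcritical G k κ) (hf : IsBddBorel f) :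
    IsMeanPath G k f (signedMeanPath G k f) := by
  obtain ⟨C, hCp, hCn⟩ := hf.exists_posPart_negPart_le
  have hsub := (isMeanPath_meanPath hk hf.measurable_posPart (fun _ => posPart_nonneg _) hCp).sub hk
    (isMeanPath_meanPath hk hf.measurable_negPart (fun _ => negPart_nonneg _) hCn)
  simp only [posPart_sub_negPart] at hsub
  exact hsub

lemma integrableOn_signedMeanPath (hk : IsSubcritical G k κ) (hf : IsBddBorel f) (x : PosReal) :
    IntegrableOn (fun s => signedMeanPath G k f s x) (Set.Ioi (0 : ℝ)) := by
  obtain ⟨C, hCp, hCn⟩ := hf.exists_posPart_negPart_le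
  exact (integrableOn_meanPath hk hf.measurable_posPart (fun _ => posPart_nonneg _) hCp x).sub
    (integrableOn_meanPath hk hf.measurable_negPart (fun _ => negPart_nonneg _) hCn x)

lemma integrableOn_signedMeanPath_toNNReal (hk : IsSubcritical G k κ) (hf : IsBddBorel f)
    (x : PosReal) :
    IntegrableOn (fun s : ℝ => signedMeanPath G k f s.toNNReal x) (Set.Ioi (0 : ℝ)) :=
  (integrableOn_signedMeanPath hk hf x).congr_fun
    (fun s hs => by rw [Real.coe_toNNReal s (le_of_lt hs)]) measurableSet_Ioi

lemma totalMean_signedMeanPath (hk : IsSubcritical G k κ) (hf : IsBddBorel f) :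
    totalMean (fun t : ℝ≥0 => signedMeanPath G k f t) = fun x =>
      totalPath G k (fun y => (f y)⁺) x - totalPath G k (fun y => (f y)⁻) x := by
  obtain ⟨C, hCp, hCn⟩ := hf.exists_posPart_negPart_le
  funext x
  calc totalMean (fun t : ℝ≥0 => signedMeanPath G k f t) x
      = ∫ s in Set.Ioi (0 : ℝ), signedMeanPath G k f s x :=
        setIntegral_congr_fun measurableSet_Ioi fun s hs => by
          simp only [Real.coe_toNNReal s (le_of_lt hs)]
    _ = _ := integral_sub
        (integrableOn_meanPath hk hf.measurable_posPart (fun _ => posPart_nonneg _) hCp x)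
        (integrableOn_meanPath hk hf.measurable_negPart (fun _ => negPart_nonneg _) hCn x)

variable {Λ : Measure PosReal} [IsFiniteMeasure Λ]

lemma integrable_totalPath_posPart (hk : IsSubcritical G k κ) (hf : IsBddBorel f)
    (hΛ : Integrable (fun x : PosReal => (x : ℝ)) Λ) :
    Integrable (totalPath G k fun y => (f y)⁺) Λ :=
  let ⟨_, hC, _⟩ := hf.exists_posPart_negPart_le
  integrable_totalPath hk hf.measurable_posPart (fun _ => posPart_nonneg _) hC hΛ

lemma integrable_totalPath_negPart (hk : IsSubcritical G k κ) (hf : IsBddBorel f)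
    (hΛ : Integrable (fun x : PosReal => (x : ℝ)) Λ) :
    Integrable (totalPath G k fun y => (f y)⁻) Λ :=
  let ⟨_, _, hC⟩ := hf.exists_posPart_negPart_le
  integrable_totalPath hk hf.measurable_negPart (fun _ => negPart_nonneg _) hC hΛ

lemma integrable_totalMean_signedMeanPath (hk : IsSubcritical G k κ) (hf : IsBddBorel f)
    (hΛ : Integrable (fun x : PosReal => (x : ℝ)) Λ) :
    Integrable (totalMean fun t : ℝ≥0 => signedMeanPath G k f t) Λ := by
  rw [totalMean_signedMeanPath hk hf]
  exact (integrable_totalPath_posPart hk hf hΛ).sub (integrable_totalPath_negPart hk hf hΛ)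

end SignedMean

lemma IsMeanSolution.unique {G : Measure PosReal} [IsProbabilityMeasure G] {α : PosReal → ℝ}
    {p : PosReal → ℕ → ℝ} {κ : ℝ} {f : PosReal → ℝ} {π π' : ℝ≥0 → PosReal → ℝ}
    (hk : IsSubcritical G (meanRate α p) κ) (hπ : IsMeanSolution α p G f π)
    (hπ' : IsMeanSolution α p G f π') : π = π' := by
  funext t x
  simpa only [extendTime, if_pos t.coe_nonneg, Real.toNNReal_coe] using
    congr_fun₂ ((hπ.isMeanPath hk).unique hk (hπ'.isMeanPath hk)) (t : ℝ) x

namespace IsRightContMarkov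

variable {G : Measure PosReal} [IsProbabilityMeasure G] {α : PosReal → ℝ} {p : PosReal → ℕ → ℝ}
  {κ a₀ C₂ : ℝ} {L : Measure CountMeas} [IsFiniteMeasure L] [IsFiniteMeasure (intensity L)]
  {P : ℝ≥0 → Kernel CountMeas CountMeas} {Ω : Type*} [mΩ : MeasurableSpace Ω] {μ : Measure Ω}
  [IsProbabilityMeasure μ] {𝓕 : Filtration ℝ≥0 mΩ} {σ : CountMeas} {Y : ℝ≥0 → Ω → CountMeas}
  {f : PosReal → ℝ}

lemma ae_intervalIntegrable_pairing_posPart_negPart (hD : IsSubcriticalBranching G α p κ a₀ C₂)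
    (hΛ : Integrable (fun x : PosReal => (x : ℝ)) (intensity L))
    (hP : IsImmigrationSemigroup α p G L P) (hY : IsRightContMarkov μ 𝓕 P σ Y)
    (hf : IsBddBorel f) : ∀ᵐ ω ∂μ, ∀ t : ℝ, 0 ≤ t →
      IntervalIntegrable (fun s : ℝ => pairing (Y s.toNNReal ω) fun x => (f x)⁺) volume 0 t ∧
      IntervalIntegrable (fun s : ℝ => pairing (Y s.toNNReal ω) fun x => (f x)⁻) volume 0 t := by
  obtain ⟨C, hCp, hCn⟩ := hf.exists_posPart_negPart_le
  filter_upwards [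
    hY.ae_intervalIntegrable_pairing hD hΛ hP hf.measurable_posPart (fun _ => posPart_nonneg _) hCp,
    hY.ae_intervalIntegrable_pairing hD hΛ hP hf.measurable_negPart (fun _ => negPart_nonneg _) hCn]
    with ω hp hn t ht
  exact ⟨hp t ht, hn t ht⟩

lemma ae_intervalIntegrable_pairing_of_isBddBorel (hD : IsSubcriticalBranching G α p κ a₀ C₂)
    (hΛ : Integrable (fun x : PosReal => (x : ℝ)) (intensity L))
    (hP : IsImmigrationSemigroup α p G L P) (hY : IsRightContMarkov μ 𝓕 P σ Y)
    (hf : IsBddBorel f) : ∀ᵐ ω ∂μ, ∀ t : ℝ, 0 ≤ t →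
      IntervalIntegrable (fun s : ℝ => pairing (Y s.toNNReal ω) f) volume 0 t := by
  filter_upwards [hY.ae_intervalIntegrable_pairing_posPart_negPart hD hΛ hP hf] with ω h t ht
  simp only [hf.pairing_eq_sub]
  exact (h t ht).1.sub (h t ht).2

lemma tendstoInMeasure_occupation (hD : IsSubcriticalBranching G α p κ a₀ C₂)
    (hΛ : Integrable (fun x : PosReal => (x : ℝ)) (intensity L))
    (hP : IsImmigrationSemigroup α p G L P) (hY : IsRightContMarkov μ 𝓕 P σ Y)
    (hf : IsBddBorel f) :
    TendstoInMeasure μ (fun (t : ℝ) ω => t⁻¹ * occupation Y f t ω) atTop fun _ =>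
      ∫ x, totalMean (fun t : ℝ≥0 => signedMeanPath G (meanRate α p) f t) x ∂intensity L := by
  obtain ⟨C, hCp, hCn⟩ := hf.exists_posPart_negPart_le
  simp only [totalMean_signedMeanPath hD.mean hf]
  rw [integral_sub (integrable_totalPath_posPart hD.mean hf hΛ)
    (integrable_totalPath_negPart hD.mean hf hΛ)]
  refine (tendstoInMeasure_sub_const
    (hY.tendstoInMeasure_occupation_of_nonneg hD hΛ hP hf.measurable_posPart
      (fun _ => posPart_nonneg _) hCp)
    (hY.tendstoInMeasure_occupation_of_nonneg hD hΛ hP hf.measurable_negPart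
      (fun _ => negPart_nonneg _) hCn)).congr' ?_ (ae_of_all _ fun _ => rfl)
  filter_upwards [eventually_ge_atTop 0] with t ht
  filter_upwards [hY.ae_intervalIntegrable_pairing_posPart_negPart hD hΛ hP hf] with ω h
  simp only [occupation, hf.pairing_eq_sub]
  rw [intervalIntegral.integral_sub (h t ht).1 (h t ht).2, mul_sub]

end IsRightContMarkov

end AgeBranching

theorem mainTheorem6_general
    {α : PosReal → ℝ} {p : PosReal → ℕ → ℝ} {G : Measure PosReal} [IsProbabilityMeasure G]
    {κ a₀ C₂ : ℝ} (hD : IsSubcriticalBranching G α p κ a₀ C₂)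
    {L : Measure CountMeas} [IsFiniteMeasure L] [IsFiniteMeasure (intensity L)]
    (hΛ : Integrable (fun x : PosReal => (x : ℝ)) (intensity L))
    {P : ℝ≥0 → Kernel CountMeas CountMeas} (hP : IsImmigrationSemigroup α p G L P)
    {Ω : Type*} [mΩ : MeasurableSpace Ω] {μ : Measure Ω} [IsProbabilityMeasure μ]
    {𝓕 : Filtration ℝ≥0 mΩ} {σ : CountMeas} {Y : ℝ≥0 → Ω → CountMeas}
    (hY : IsRightContMarkov μ 𝓕 P σ Y) {f : PosReal → ℝ} (hf : IsBddBorel f) :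
    ∃ π : ℝ≥0 → PosReal → ℝ,
      IsMeanSolution α p G f π ∧
      (∀ π', IsMeanSolution α p G f π' → π' = π) ∧
      (∀ x, IntegrableOn (fun s : ℝ => π s.toNNReal x) (Set.Ioi 0)) ∧
      (∀ᵐ ν ∂L, Integrable (totalMean π) ν.toMeas) ∧
      Integrable (fun ν => pairing ν (totalMean π)) L ∧
      (∀ᵐ ω ∂μ, ∀ t : ℝ, 0 ≤ t →
        IntervalIntegrable (fun s : ℝ => pairing (Y s.toNNReal ω) f) volume 0 t) ∧
      TendstoInMeasure μ (fun (t : ℝ) ω => t⁻¹ * occupation Y f t ω) atTop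
        (fun _ => ∫ ν, pairing ν (totalMean π) ∂L) := by
  have hπ := (isMeanPath_signedMeanPath hD.mean hf).isMeanSolution hD.mean
  have htotal := integrable_totalMean_signedMeanPath hD.mean hf hΛ
  refine ⟨_, hπ, fun π' hπ' => hπ'.unique hD.mean hπ,
    integrableOn_signedMeanPath_toNNReal hD.mean hf,
    ae_integrable_of_integrable_intensity htotal, integrable_pairing htotal,
    hY.ae_intervalIntegrable_pairing_of_isBddBorel hD hΛ hP hf, ?_⟩
  rw [integral_pairing htotal]
  exact hY.tendstoInMeasure_occupation hD hΛ hP hf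

theorem mainTheorem6
    (α : PosReal → ℝ) (hα : IsBirthRate α)
    (p : PosReal → ℕ → ℝ) (hp : IsOffspringLaw p)
    (G : Measure PosReal) [IsProbabilityMeasure G] (hG : ∀ x, G {x} = 0)
    (L : Measure CountMeas) [IsFiniteMeasure L] (hL : L {ν | ν.toMeas = 0} = 0)
    (α₁ : ℝ) (hα₁ : SubcriticalMalthusian α p G α₁)
    (hLexp : ∫⁻ ν, ∫⁻ x, ENNReal.ofReal (Real.exp (α₁ * (x : ℝ))) ∂ν.toMeas ∂L < ∞)
    (hGexp : ∫⁻ x, ENNReal.ofReal (Real.exp (2 * α₁ * (x : ℝ))) ∂G < ∞)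
    (hg : SecondDerivBdd p)
    (P : ℝ≥0 → Kernel CountMeas CountMeas) (hP : IsImmigrationSemigroup α p G L P)
    {Ω : Type*} [mΩ : MeasurableSpace Ω] (μ : Measure Ω) [IsProbabilityMeasure μ]
    (𝓕 : Filtration ℝ≥0 mΩ) (σ : CountMeas) (Y : ℝ≥0 → Ω → CountMeas)
    (hY : IsRightContMarkov μ 𝓕 P σ Y)
    (f : PosReal → ℝ) (hf : IsBddBorel f) :
    ∃ π : ℝ≥0 → PosReal → ℝ,
      IsMeanSolution α p G f π ∧
      (∀ π', IsMeanSolution α p G f π' → π' = π) ∧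
      (∀ x, IntegrableOn (fun s : ℝ => π s.toNNReal x) (Set.Ioi 0)) ∧
      (∀ᵐ ν ∂L, Integrable (totalMean π) ν.toMeas) ∧
      Integrable (fun ν => pairing ν (totalMean π)) L ∧
      (∀ᵐ ω ∂μ, ∀ t : ℝ, 0 ≤ t →
        IntervalIntegrable (fun s : ℝ => pairing (Y s.toNNReal ω) f) volume 0 t) ∧
      TendstoInMeasure μ (fun (t : ℝ) ω => t⁻¹ * occupation Y f t ω) atTop
        (fun _ => ∫ ν, pairing ν (totalMean π) ∂L) := by
  have := isFiniteMeasure_intensity hα₁.pos hLexp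
  have hΛ := integrable_coe_pow_intensity hα₁.pos hLexp 1
  have hG2 := integrable_coe_pow_of_lintegral_exp (mul_pos two_pos hα₁.pos) hGexp 2
  obtain ⟨κ, a₀, C₂, hD⟩ := exists_isSubcriticalBranching hα hp hα₁.subcritical hG2 hg
  exact mainTheorem6_general hD (by simpa only [pow_one] using hΛ) hP hY hf
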